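/- **Market.** Let $\sigma>0$, $\lambda\ge 0$, $p_{up}\in[0,1]$, $\eta_1>1$, $\eta_2>0$, $\mu,r\in\mathbb R$, $T>0$, $M\ge 1$, $\Delta t=T/M$, $t_m=m\Delta t$, and cashflows $q_0,\dots,q_{M-1}\ge 0$. Let $\rho(\zeta)=p_{up}\eta_1e^{-\eta_1\zeta}\mathbb 1_{\zeta\ge0}+(1-p_{up})\eta_2e^{\eta_2\zeta}\mathbb 1_{\zeta<0}$, $\kappa=\int(e^\zeta-1)\rho(\zeta)\,d\zeta$, and let $g(z,\Delta t)=\sum_{\ell\ge0}g_\ell(z,\Delta t)$ be the transition density of the log-price in the Kou model, where $g_\ell(z,\Delta t)=e^{-\lambda\Delta t}\frac{(\lambda\Delta t)^\ell}{\ell!}\,n_\ell(-z)$, $n_0$ is the density of $\mathcal N\big((\mu-\lambda\kappa-\tfrac{\sigma^2}{2})\Delta t,\ \sigma^2\Delta t\big)$ and $n_{\ell+1}=n_\ell*\rho$. Let $g(z,\Delta t;N)=\sum_{\ell=0}^{N}g_\ell(z,\Delta t)$. **Criterion.** Either Mean–bPoE: $\gamma,D>0$, payoff $f(w,W)=\gamma\max\big(1-\tfrac{w-D}{W-D},0\big)-w$,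 feasible thresholds $W>D$, and $\operatorname{opt}=\inf$; or Mean–CVaR: $\gamma>0$, $\alpha\in(0,1)$, $f(w,W)=\gamma\big(W+\tfrac1\alpha\min(w-W,0)\big)+w$, feasible thresholds $W\ge0$, and $\operatorname{opt}=\sup$. **Localized problem.** Let $y^\dagger_{\min}<y_{\min}<y_{\max}<y^\dagger_{\max}$, $b_{\max}>0$, $\Omega=[y^\dagger_{\min},y^\dagger_{\max}]\times[0,b_{\max}]$. Functions on $\Omega$ are evaluated outside $\Omega$ by the asymptotic forms: as constant in $y$ for $y<y^\dagger_{\min}$ (including $y=-\infty$), as proportional to $e^y$ for $y>y^\dagger_{\max}$, as proportional to $b$ for $b>b_{\max}$. For a fixed feasible threshold $W$ define backwards $\widehat V(y,b,W,T)=f(e^y+b,W)$ and, for $m=M-1,\dots,0$, * $\widehat V(y,b,W,t_{m+1}^-)=\widehat V(y,be^{r\Delta t},W,t_{m+1})$; * $\widehat V(y,b,W,t_m^+)$ equals $\int_{y^\dagger_{\min}}^{y^\dagger_{\max}}\widehat V(y',b,W,t_{m+1}^-)\,g(y-y',\Delta t)\,dy'$ if $y_{\min}<y<y_{\max}$, $\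 \widehat V(y,b,W,t_{m+1}^-)$ if $y\le y_{\min}$, and $e^{\mu\Delta t}\,\widehat V(y,b,W,t_{m+1}^-)$ if $y\ge y_{\max}$; * $\widehat V(y,b,W,t_m)=\operatorname{opt}_{u\in[0,1]}\widehat V\big(\ln(u\omega),(1-u)\omega,W,t_m^+\big)$ with $\omega=e^y+b+q_m$. Given initial amounts $s_0,b_0\ge0$, put $F(W)=\widehat V(\ln s_0,b_0,W,t_0)$ and $V^p(s_0,b_0,t_0^-)=\operatorname{opt}_{W\text{ feasible}}F(W)$. (For $s_0=0$ read $e^{\ln s_0}=0$ in $\omega$; $F$ depends on the state only through $\omega=s_0+b_0+q_0$.) An optimal threshold is a feasible $W$ that attains this optimum. **Threshold interval.** Let $\Gamma=[W_{\min},W_{\max}]$ with $W_{\min}<W_{\max}$ contain an optimal threshold. For Mean–CVaR let $W_{\min}\ge0$. For Mean–bPoE let either $W_{\min}>D$, or $W_{\min}=D$ and $F(W)\to+\infty$ as $W\downarrow D$. **Size of the domain.** Suppose $\Omega$ is large relative to the data, in the sense that $e^{y_{\min}}\max(1,e^{-rT})<s_0+b_0+q_0$, that $\big(s_0+b_0+\sum_{m<M}q_m+Me^{y^\dagger_{\min}}\big)\max(1,e^{rT})<e^{y_{\max}}$,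 and that $e^{y_{\max}}\max(1,e^{-rT})\le b_{\max}$. **Scheme.** For each $h>0$ take $N_y^\dagger$ equal intervals of $[y^\dagger_{\min},y^\dagger_{\max}]$, partitions $\{b_j\}$ of $[0,b_{\max}]$, $\{W_k\}$ of $\Gamma$, $\{u_i\}$ of $[0,1]$ (all including the end points), and a truncation index $N_g$. For each $W_k$, $\widehat V_h$ is defined at the nodes $(y_n,b_j)$ by the same recursion, with linear interpolation between nodes (in $b$ in the interest step, in $y$ and $b$ in the rebalancing step; the same continuation outside $\Omega$), with the integral at the nodes $y_{\min}<y_n<y_{\max}$ replaced by $\sum_l\varphi_l\,g(y_n-y_l,\Delta t;N_g)\,\widehat V_h(y_l,b_j,W_k,t_{m+1}^-)$, $\varphi_l$ the composite trapezoidal weights, and with $\operatorname{opt}$ over $u\in[0,1]$ replaced by the optimum over $\{u_i\}$. Let $F_h(W_k)=\widehat V_h(\ln s_0,b_0,W_k,t_0)$ be given by the discrete rebalancing formula at the initial state. Let $V_h^p(s_0,b_0,t_0^-)$ be the optimum of $F_h$ over the feasible $W_k$; a feasible node that attains it is a computed optimal threshold $W_h^{p*}$. **Theorem.** Suppose that,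 as $h\downarrow0$, $N_y^\dagger\to\infty$, $N_g\to\infty$ and the mesh widths of $\{b_j\}$, $\{W_k\}$, $\{u_i\}$ tend to $0$. Then 1. $\displaystyle\lim_{h\to0}\big|V_h^p(s_0,b_0,t_0^-)-V^p(s_0,b_0,t_0^-)\big|=0$; 2. for all $h_n\downarrow0$ (more generally $h_n>0$, $h_n\to0$) and all computed optimal thresholds $W_{h_n}^{p*}$, some subsequence of $(W_{h_n}^{p*})_n$ converges to an optimal threshold, which lies in $\Gamma$. -/

import Mathlib

open Filter Topology

namespace MeanRisk

/-! ### The two scalarized mean-risk criteria -/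

/-- The Mean-bPoE criterion (weight `γ`, disaster level `D`; a minimization) and the
Mean-CVaR criterion (weight `γ`, confidence level `α`; a maximization). -/
inductive Criterion where
  | bPoE (γ D : ℝ)
  | cvar (γ α : ℝ)

namespace Criterion

/-- Admissible parameters. -/
def Valid : Criterion → Prop
  | bPoE γ D => 0 < γ ∧ 0 < D
  | cvar γ α => 0 < γ ∧ 0 < α ∧ α < 1

/-- Feasible thresholds: `W > D` for bPoE, `W ≥ 0` for CVaR. -/
def Feasible : Criterion → ℝ → Prop
  | bPoE _ D, W => D < W
  | cvar _ _, W => 0 ≤ W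

/-- Payoff of the terminal wealth `w` for the threshold `W`. -/
noncomputable def payoff : Criterion → ℝ → ℝ → ℝ
  | bPoE γ D, W, w => γ * max (1 - (w - D) / (W - D)) 0 - w
  | cvar γ α, W, w => γ * (W + 1 / α * min (w - W) 0) + w

/-- The optimization performed: infimum for bPoE, supremum for CVaR. -/
noncomputable def opt {ι : Type} : Criterion → (ι → ℝ) → ℝ
  | bPoE _ _, f => ⨅ i, f i
  | cvar _ _, f => ⨆ i, f i

/-- `c.AtLeastAsGood x x'`: the objective value `x` is at least as good as `x'`. -/
def AtLeastAsGood : Criterion → ℝ → ℝ → Prop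
  | bPoE _ _, x, x' => x ≤ x'
  | cvar _ _, x, x' => x' ≤ x

/-- Condition on the left end `Wmin` of the threshold interval, for the objective `F`.
For bPoE the payoff is singular at the infeasible threshold `D`, so either `Wmin > D`, or
`Wmin = D` and the objective blows up there. -/
def LeftEnd : Criterion → ℝ → (ℝ → ℝ) → Prop
  | bPoE _ D, Wmin, F => D < Wmin ∨ (Wmin = D ∧ Tendsto F (𝓝[>] D) atTop)
  | cvar _ _, Wmin, _ => 0 ≤ Wmin

end Criterion

/-! ### The market: Kou jump-diffusion, bank account, contributions -/

/-- Market and contract data: drift `μ`, risk-free rate `r`, volatility `σ`, jump intensity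
`lam`, double-exponential parameters `pUp`, `η₁`, `η₂`, horizon `T`, `M` equally spaced
rebalancing times, cashflows `q m` for `m < M`. -/
structure Market where
  μ : ℝ
  r : ℝ
  σ : ℝ
  lam : ℝ
  pUp : ℝ
  η₁ : ℝ
  η₂ : ℝ
  T : ℝ
  M : ℕ
  q : ℕ → ℝ
  σ_pos : 0 < σ
  lam_nonneg : 0 ≤ lam
  pUp_nonneg : 0 ≤ pUp
  pUp_le_one : pUp ≤ 1
  one_lt_η₁ : 1 < η₁
  η₂_pos : 0 < η₂
  T_pos : 0 < T
  M_pos : 0 < M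
  q_nonneg : ∀ m < M, 0 ≤ q m

namespace Market

variable (P : Market)

/-- Length of a period. -/
noncomputable def dt : ℝ := P.T / P.M

/-- Density of the logarithm of the jump multiplier (asymmetric double exponential). -/
noncomputable def jumpDensity (ζ : ℝ) : ℝ :=
  if 0 ≤ ζ then P.pUp * P.η₁ * Real.exp (-P.η₁ * ζ)
  else (1 - P.pUp) * P.η₂ * Real.exp (P.η₂ * ζ)

/-- `κ = 𝔼[ξ - 1]`, the expected relative jump size. -/
noncomputable def kappa : ℝ := ∫ ζ, (Real.exp ζ - 1) * P.jumpDensity ζ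

/-- Mean of the continuous part of the log-return over one period. -/
noncomputable def drift : ℝ := (P.μ - P.lam * P.kappa - P.σ ^ 2 / 2) * P.dt

/-- Density of the log-return over one period, conditionally on exactly `ℓ` jumps:
the normal density of the continuous part, convolved `ℓ` times with the jump density. -/
noncomputable def condDensity : ℕ → ℝ → ℝ
  | 0, x => Real.exp (-(x - P.drift) ^ 2 / (2 * P.σ ^ 2 * P.dt)) /
      Real.sqrt (2 * Real.pi * P.σ ^ 2 * P.dt)
  | ℓ + 1, x => ∫ ζ, condDensity ℓ (x - ζ) * P.jumpDensity ζ

/-- The `ℓ`-th term of the series of the transition density: the contribution of exactly `ℓ`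
jumps (Poisson weight times conditional density). The argument `z` is "old log-price minus
new log-price", whence the sign. -/
noncomputable def densityTerm (ℓ : ℕ) (z : ℝ) : ℝ :=
  Real.exp (-(P.lam * P.dt)) * (P.lam * P.dt) ^ ℓ / (ℓ.factorial : ℝ) * P.condDensity ℓ (-z)

/-- The transition density `g(z, Δt)` of the log-price: the density of moving from `y` to `y'`
over one period is `g(y - y', Δt)`. -/
noncomputable def density (z : ℝ) : ℝ := ∑' ℓ, P.densityTerm ℓ z

/-- The partial sum `g(z, Δt; N)` over at most `N` jumps. -/
noncomputable def densityTrunc (N : ℕ) (z : ℝ) : ℝ :=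
  ∑ ℓ ∈ Finset.range (N + 1), P.densityTerm ℓ z

end Market

/-! ### The localized problem -/

/-- The truncated domain `[yminD, ymaxD] × [0, bmax]` with boundary layers
`[yminD, ymin]` and `[ymax, ymaxD]`. -/
structure Domain where
  yminD : ℝ
  ymin : ℝ
  ymax : ℝ
  ymaxD : ℝ
  bmax : ℝ
  yminD_lt : yminD < ymin
  ymin_lt : ymin < ymax
  ymax_lt : ymax < ymaxD
  bmax_pos : 0 < bmax

namespace Domain

variable (L : Domain)

/-- Linear extrapolation in `b` beyond `bmax`. -/
noncomputable def extB (F : ℝ → ℝ) (b : ℝ) : ℝ :=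
  if b ≤ L.bmax then F b else b / L.bmax * F L.bmax

/-- A function of the log-amount `y ∈ [yminD, ymaxD]`, as a function of the amount `s ≥ 0` in
the risky asset, continued outside by the asymptotic forms: constant in `y` below `yminD`
(in particular at `s = 0`, that is `y = -∞`), proportional to `s = e^y` above `ymaxD`. -/
noncomputable def extS (F : ℝ → ℝ) (s : ℝ) : ℝ :=
  if s ≤ Real.exp L.yminD then F L.yminD
  else if s ≤ Real.exp L.ymaxD then F (Real.log s)
  else s / Real.exp L.ymaxD * F L.ymaxD

/-- Value of `F(y, b)` at the amounts `(s, b)`, with the above continuation. -/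
noncomputable def atAmounts (F : ℝ → ℝ → ℝ) (s b : ℝ) : ℝ :=
  L.extB (fun b' => L.extS (fun y => F y b') s) b

end Domain

section Exact

variable (P : Market) (L : Domain) (c : Criterion)

/-- Interest settlement, from `t_{m+1}` back to `t_{m+1}^-`. -/
noncomputable def settle (F : ℝ → ℝ → ℝ) (y b : ℝ) : ℝ :=
  L.extB (F y) (b * Real.exp (P.r * P.dt))

/-- Time advancement, from `t_{m+1}^-` back to `t_m^+`: truncated convolution in the interior,
asymptotic boundary conditions in the two boundary layers. -/
noncomputable def advance (F : ℝ → ℝ → ℝ) (y b : ℝ) : ℝ :=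
  if y ≤ L.ymin then F y b
  else if y < L.ymax then ∫ y' in L.yminD..L.ymaxD, F y' b * P.density (y - y')
  else Real.exp (P.μ * P.dt) * F y b

/-- Rebalancing, from `t_m^+` back to `t_m`, when the wealth including the cashflow is `w`:
optimization over the fraction `u ∈ [0,1]` held in the risky asset. -/
noncomputable def rebalance (F : ℝ → ℝ → ℝ) (w : ℝ) : ℝ :=
  c.opt fun u : Set.Icc (0 : ℝ) 1 => L.atAmounts F (u * w) ((1 - u) * w)

/-- `value P L c W k y b` is the auxiliary function at time `t_{M-k}`, state `(y, b)`, for the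
fixed threshold `W` (`k` periods to go). -/
noncomputable def value (W : ℝ) : ℕ → ℝ → ℝ → ℝ
  | 0 => fun y b => c.payoff W (Real.exp y + b)
  | k + 1 => fun y b =>
      rebalance L c (advance P L (settle P L (value W k))) (Real.exp y + b + P.q (P.M - (k + 1)))

/-- The exact objective as a function of the threshold: the auxiliary function at time `t_0` for
the initial amounts `(s₀, b₀)`. It is written in terms of `s₀ = e^{y₀}` so that `s₀ = 0` makes
sense. -/
noncomputable def objective (s₀ b₀ W : ℝ) : ℝ :=
  rebalance L c (advance P L (settle P L (value P L c W (P.M - 1)))) (s₀ + b₀ + P.q 0)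

theorem objective_eq_value (s₀ b₀ W : ℝ) (hs : 0 < s₀) :
    objective P L c s₀ b₀ W = value P L c W P.M (Real.log s₀) b₀ := by
  obtain ⟨k, hk⟩ : ∃ k, P.M = k + 1 := ⟨P.M - 1, by have := P.M_pos; omega⟩
  simp [objective, hk, value, Real.exp_log hs]

/-- The exact value function at `t_0^-`: optimization over all feasible thresholds. -/
noncomputable def valueFunction (s₀ b₀ : ℝ) : ℝ :=
  c.opt fun W : {W : ℝ // c.Feasible W} => objective P L c s₀ b₀ W

/-- `W` is an exact optimal threshold (among all feasible thresholds). -/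
def IsOptimalThreshold (s₀ b₀ W : ℝ) : Prop :=
  c.Feasible W ∧ ∀ W', c.Feasible W' →
    c.AtLeastAsGood (objective P L c s₀ b₀ W) (objective P L c s₀ b₀ W')

/-- The domain is large enough for the initial data: the invested wealth is above
`e^ymin` (also after discounting), all contributions held at the risk-free rate remain below
`e^ymax`, and `bmax` is at least `e^ymax` (also after discounting). -/
structure LargeEnough (s₀ b₀ : ℝ) : Prop where
  lower : Real.exp L.ymin * max 1 (Real.exp (-(P.r * P.T))) < s₀ + b₀ + P.q 0
  upper : (s₀ + b₀ + ∑ m ∈ Finset.range P.M, P.q m + P.M * Real.exp L.yminD) *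
    max 1 (Real.exp (P.r * P.T)) < Real.exp L.ymax
  bond : Real.exp L.ymax * max 1 (Real.exp (-(P.r * P.T))) ≤ L.bmax

end Exact

/-! ### The numerical scheme -/

/-- `x 0 < x 1 < ⋯ < x N` are the nodes of a partition of `[lo, hi]` into `N ≥ 1` intervals. -/
structure IsPartition (lo hi : ℝ) (N : ℕ) (x : ℕ → ℝ) : Prop where
  pos : 0 < N
  first : x 0 = lo
  last : x N = hi
  lt : ∀ i < N, x i < x (i + 1)

/-- Piecewise linear interpolation of the node values `v 0, …, v N` at the nodes
`x 0 < ⋯ < x N`: each cell to the left of `t` contributes its full increment, the cell that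
contains `t` the proportional part. (Constant outside `[x 0, x N]`.) -/
noncomputable def interp (N : ℕ) (x v : ℕ → ℝ) (t : ℝ) : ℝ :=
  v 0 + ∑ i ∈ Finset.range N,
    (v (i + 1) - v i) * max 0 (min 1 ((t - x i) / (x (i + 1) - x i)))

/-- A discretization: `Ny` equal intervals in `y`, partitions of `[0, bmax]`, of the threshold
interval `[Wmin, Wmax]` and of the control set `[0,1]`, and the truncation index `Ng`. -/
structure Grid (L : Domain) (Wmin Wmax : ℝ) where
  Ny : ℕ
  Nb : ℕ
  Nw : ℕ
  Nu : ℕ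
  Ng : ℕ
  b : ℕ → ℝ
  W : ℕ → ℝ
  u : ℕ → ℝ
  Ny_pos : 0 < Ny
  b_part : IsPartition 0 L.bmax Nb b
  W_part : IsPartition Wmin Wmax Nw W
  u_part : IsPartition 0 1 Nu u

namespace Grid

variable {L : Domain} {Wmin Wmax : ℝ} (G : Grid L Wmin Wmax)

/-- Step size in `y`. -/
noncomputable def dy : ℝ := (L.ymaxD - L.yminD) / G.Ny

/-- The uniform nodes `yminD = y 0 < ⋯ < y Ny = ymaxD`. -/
noncomputable def y (n : ℕ) : ℝ := L.yminD + n * G.dy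

/-- Weights of the composite trapezoidal rule. -/
noncomputable def weight (l : ℕ) : ℝ := if l = 0 ∨ l = G.Ny then G.dy / 2 else G.dy

/-- Linear interpolation, in `y` and in `b`, of the node values `v n j`. -/
noncomputable def interp₂ (v : ℕ → ℕ → ℝ) (y b : ℝ) : ℝ :=
  interp G.Nb G.b (fun j => interp G.Ny G.y (fun n => v n j) y) b

variable (P : Market) (c : Criterion)

/-- Discrete interest settlement. -/
noncomputable def settleH (v : ℕ → ℕ → ℝ) (n j : ℕ) : ℝ :=
  L.extB (interp G.Nb G.b (v n)) (G.b j * Real.exp (P.r * P.dt))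

/-- Discrete time advancement: trapezoidal convolution against the truncated series at interior
nodes, boundary conditions at the other nodes. -/
noncomputable def advanceH (v : ℕ → ℕ → ℝ) (n j : ℕ) : ℝ :=
  if G.y n ≤ L.ymin then v n j
  else if G.y n < L.ymax then
    ∑ l ∈ Finset.range (G.Ny + 1), G.weight l * P.densityTrunc G.Ng (G.y n - G.y l) * v l j
  else Real.exp (P.μ * P.dt) * v n j

/-- Discrete rebalancing at the wealth `w` (cashflow included): exhaustive search over the
control nodes, with linear interpolation of the node values. -/
noncomputable def rebalanceH (v : ℕ → ℕ → ℝ) (w : ℝ) : ℝ :=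
  c.opt fun i : Fin (G.Nu + 1) => L.atAmounts (G.interp₂ v) (G.u i * w) ((1 - G.u i) * w)

/-- Computed auxiliary function at the node `(y n, b j)` and time `t_{M-k}`. -/
noncomputable def valueH (W : ℝ) : ℕ → ℕ → ℕ → ℝ
  | 0 => fun n j => c.payoff W (Real.exp (G.y n) + G.b j)
  | k + 1 => fun n j =>
      G.rebalanceH c (G.advanceH P (G.settleH P (valueH W k)))
        (Real.exp (G.y n) + G.b j + P.q (P.M - (k + 1)))

/-- The computed objective as a function of the threshold, at the initial amounts. -/
noncomputable def objectiveH (s₀ b₀ W : ℝ) : ℝ :=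
  G.rebalanceH c (G.advanceH P (G.settleH P (G.valueH P c W (P.M - 1)))) (s₀ + b₀ + P.q 0)

/-- The feasible threshold nodes. (For bPoE a node equal to `D` is not searched.) -/
def Nodes : Set ℝ := {W | ∃ k ≤ G.Nw, W = G.W k ∧ c.Feasible W}

/-- The computed value function at `t_0^-`: exhaustive search over the threshold nodes. -/
noncomputable def valueFunctionH (s₀ b₀ : ℝ) : ℝ :=
  c.opt fun W : G.Nodes c => G.objectiveH P c s₀ b₀ W

/-- `W` is a computed optimal threshold: a best one among the threshold nodes. -/
def IsComputedThreshold (s₀ b₀ W : ℝ) : Prop :=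
  W ∈ G.Nodes c ∧ ∀ W' ∈ G.Nodes c,
    c.AtLeastAsGood (G.objectiveH P c s₀ b₀ W) (G.objectiveH P c s₀ b₀ W')

end Grid

/-- The nodes `x h 0 < ⋯ < x h (N h)` become arbitrarily fine as `h ↓ 0`. -/
def GapsVanish (N : ℝ → ℕ) (x : ℝ → ℕ → ℝ) : Prop :=
  ∀ ε > 0, ∀ᶠ h in 𝓝[>] (0 : ℝ), ∀ i < N h, x h (i + 1) - x h i < ε

/-- The family `G h` of discretizations is refined as `h ↓ 0`. -/
structure Refines {L : Domain} {Wmin Wmax : ℝ} (G : ℝ → Grid L Wmin Wmax) : Prop where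
  y : Tendsto (fun h => (G h).Ny) (𝓝[>] 0) atTop
  g : Tendsto (fun h => (G h).Ng) (𝓝[>] 0) atTop
  b : GapsVanish (fun h => (G h).Nb) (fun h => (G h).b)
  W : GapsVanish (fun h => (G h).Nw) (fun h => (G h).W)
  u : GapsVanish (fun h => (G h).Nu) (fun h => (G h).u)

end MeanRisk

/-! ### One backward step as a map between functions of the wealth. -/

namespace MeanRisk

/-! After rebalancing, the value depends on the state only through the wealth, and a sign turns bPoE
into a maximization. Each backward step therefore maps a function of wealth to a function of wealth.
The obstacle is that these functions need not be continuous: time advancement changes its rule at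
`ymin` and `ymax`, so values can jump at wealths where an allocation just reaches another layer.
Uniform convergence of the scheme cannot be expected.

One-sided comparison survives. An allocation of the wealth `x` can be imitated from a slightly
larger `x'` without leaving its layer: the surplus leaves room to move the risky amount away from
the layer boundary, so that the interpolation nodes lie in the right layer too. `Close` records the
resulting inequality `R₁ x ≤ R₂ x' + ε`. In a boundary layer, part of the surplus survives as a
surplus one period later, unless the bond position is saturated at `bmax`. Then the next wealth is
so large that it lies in the jump-free `zone`, where no surplus is needed. `Compat.exists_control`
constructs the imitation, and `Compat.close_step` carries `Close` through a step, for the scheme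
against the exact problem and conversely.

In the interior layer the convolution smooths. Node values are bounded above by the exact function
shifted by a small `τ` to the right, and below by its shift to the left, since a shift in log-price
is a gain in wealth. By translation, shifting the whole integrand changes the integral only by two
short end pieces. This is `interiorClose`; the measurability it needs follows from right lower
semicontinuity, itself a consequence of `Close` in both directions (`right_lsc_of_close`).

The size conditions on the domain place the initial wealth strictly inside the jump-free window.
There both comparisons apply with equal wealths, so the scheme converges for a fixed payoff
(`tendsto_wealthValue`). Stability in the payoff, uniform in the grid (`Grid.exists_stability`),
extends this to converging thresholds. Compactness of the threshold interval, together with nodes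
approaching an exact optimal threshold, shows that limits of computed thresholds are optimal. If
`Wmin = D`, the limit `D` is excluded: near it the exact objective would stay bounded, against the
assumed blow-up. -/

/-- The constants that enter one backward step, in terms of amounts: the layers of the risky
amount are separated by `a₀ < a₁ < a₂ < a₃`, `E` is the interest factor, `c` the growth factor of
the upper layer and `q` the cashflow. -/
structure Frame where
  a₀ : ℝ
  a₁ : ℝ
  a₂ : ℝ
  a₃ : ℝ
  bm : ℝ
  E : ℝ
  c : ℝ
  q : ℝ
  a₀_pos : 0 < a₀
  lt₁ : a₀ < a₁
  lt₂ : a₁ < a₂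
  lt₃ : a₂ < a₃
  bm_pos : 0 < bm
  E_pos : 0 < E
  c_pos : 0 < c
  q_nonneg : 0 ≤ q

namespace Frame

variable (F : Frame)

/-- The risky amount, clamped to the domain. -/
noncomputable def clampS (s : ℝ) : ℝ := max F.a₀ (min s F.a₃)

/-- The bond amount after interest, clamped to the domain. -/
noncomputable def sat (b : ℝ) : ℝ := min (b * F.E) (min (F.bm * F.E) F.bm)

/-- The wealth one period later in a boundary layer. -/
noncomputable def omega (s b : ℝ) : ℝ := F.clampS s + F.sat b + F.q

/-- The factor of the linear continuation outside the domain. -/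
noncomputable def amp (s b : ℝ) : ℝ := max 1 (b / F.bm) * max 1 (s / F.a₃)

/-- The factor of the linear continuation in the interest step. -/
noncomputable def kap (b : ℝ) : ℝ := max 1 (b * F.E / F.bm)

/-- The growth factor of the two boundary layers. -/
noncomputable def lay (Y : ℝ) : ℝ := if Y ≤ F.a₁ then 1 else F.c

/-- `R'` is obtained from `R` by one backward step of mesh at most `η`; `N Y b v` says that `v` is
the value after time advancement at the node `(log Y, b)`, and `U` is the set of controls. -/
structure Step (η : ℝ) (R : ℝ → ℝ) (N : ℝ → ℝ → ℝ → Prop) (U : Set ℝ) (R' : ℝ → ℝ) : Prop where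
  mem : ∀ {Y b v}, N Y b v → F.a₀ ≤ Y ∧ Y ≤ F.a₃ ∧ 0 ≤ b ∧ b ≤ F.bm
  near_le : ∀ w, 0 ≤ w → ∀ ε > 0, ∃ u ∈ U, ∃ Y b v, N Y b v ∧ |Y - F.clampS (u * w)| ≤ η ∧
    |b - min ((1 - u) * w) F.bm| ≤ η ∧ R' w ≤ F.amp (u * w) ((1 - u) * w) * v + ε
  near_ge : ∀ w, 0 ≤ w → ∀ u ∈ U, ∃ Y b v, N Y b v ∧ |Y - F.clampS (u * w)| ≤ η ∧
    |b - min ((1 - u) * w) F.bm| ≤ η ∧ F.amp (u * w) ((1 - u) * w) * v ≤ R' w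
  layer_le : ∀ {Y b v}, N Y b v → (Y ≤ F.a₁ ∨ F.a₂ ≤ Y) → ∃ β, 0 ≤ β ∧ β ≤ F.bm ∧
    |β - min (b * F.E) F.bm| ≤ η ∧ v ≤ F.lay Y * (F.kap b * R (Y + β + F.q))
  layer_ge : ∀ {Y b v}, N Y b v → (Y ≤ F.a₁ ∨ F.a₂ ≤ Y) → ∃ β, 0 ≤ β ∧ β ≤ F.bm ∧
    |β - min (b * F.E) F.bm| ≤ η ∧ F.lay Y * (F.kap b * R (Y + β + F.q)) ≤ v
  sub : ∀ u ∈ U, 0 ≤ u ∧ u ≤ 1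
  floor : ∀ t, 0 ≤ t → t ≤ 1 → ∃ u ∈ U, u ≤ t ∧ t ≤ u + η
  ceil : ∀ t, 0 ≤ t → t ≤ 1 → ∃ u ∈ U, t ≤ u ∧ u ≤ t + η

/-- The wealths, at distance `ε` from the boundary, at which no jump occurs. -/
def zone (θ lo hi ε x : ℝ) : Prop := θ + ε ≤ x ∨ (lo + ε ≤ x ∧ x ≤ hi - ε)

/-- The jump-free zones of two successive times are compatible. -/
structure Compat (θ lo hi θ' lo' hi' : ℝ) : Prop where
  θ_le : θ ≤ min (F.bm * F.E) F.bm
  θ_step : θ ≤ min 1 F.E * θ'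
  a₂_le : F.a₂ ≤ θ'
  lo_step : lo ≤ min 1 F.E * lo'
  a₁_le : F.a₁ ≤ lo'
  hi_step : max 1 F.E * hi' + F.a₀ + F.q ≤ hi
  hi_le : hi' ≤ F.a₂

theorem clampS_ge (s : ℝ) : F.a₀ ≤ F.clampS s := le_max_left _ _

theorem clampS_le (s : ℝ) : F.clampS s ≤ F.a₃ :=
  max_le (F.lt₁.trans (F.lt₂.trans F.lt₃)).le (min_le_right _ _)

theorem clampS_mono {s t : ℝ} (h : s ≤ t) : F.clampS s ≤ F.clampS t :=
  max_le_max le_rfl (min_le_min h le_rfl)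

theorem clampS_sub (s t : ℝ) : |F.clampS s - F.clampS t| ≤ |s - t| := by
  unfold clampS
  refine (abs_max_sub_max_le_max _ _ _ _).trans (max_le (by simp) ?_)
  exact (abs_min_sub_min_le_max _ _ _ _).trans (by simp)

theorem sat_sub (b b' : ℝ) : |F.sat b - F.sat b'| ≤ F.E * |b - b'| := by
  unfold sat
  refine (abs_min_sub_min_le_max _ _ _ _).trans ?_
  rw [← sub_mul, abs_mul, abs_of_pos F.E_pos, sub_self, abs_zero, mul_comm]
  exact max_le le_rfl (mul_nonneg F.E_pos.le (abs_nonneg _))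

/-- Extra bond `d` earns `E * d` unless the cap is reached. The capped alternative is kept because
it forces the next wealth into the jump-free zone. -/
theorem sat_gain {b b' d : ℝ} (h : b + d ≤ b') :
    F.sat b + F.E * d ≤ F.sat b' ∨ F.sat b' = min (F.bm * F.E) F.bm := by
  rcases le_total (b' * F.E) (min (F.bm * F.E) F.bm) with h1 | h1
  · left
    have h2 : (b + d) * F.E ≤ b' * F.E := mul_le_mul_of_nonneg_right h F.E_pos.le
    have h3 : F.sat b ≤ b * F.E := min_le_left _ _
    have h4 : F.sat b' = b' * F.E := min_eq_left h1
    linarith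
  · right
    exact min_eq_right h1

theorem omega_sub (s b s' b' : ℝ) :
    |F.omega s b - F.omega s' b'| ≤ |s - s'| + F.E * |b - b'| := by
  have h1 := F.clampS_sub s s'
  have h2 := F.sat_sub b b'
  unfold omega
  calc |F.clampS s + F.sat b + F.q - (F.clampS s' + F.sat b' + F.q)|
      = |(F.clampS s - F.clampS s') + (F.sat b - F.sat b')| := by ring_nf
    _ ≤ _ := (abs_add_le _ _).trans (add_le_add h1 h2)

theorem le_clampS {s : ℝ} (h : s ≤ F.a₃) : s ≤ F.clampS s :=
  (le_min le_rfl h).trans (le_max_right _ _)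

theorem le_of_clampS_lt {s : ℝ} (h : F.clampS s < F.a₃) : s ≤ F.clampS s := by
  refine F.le_clampS ?_
  by_contra h1
  have : F.clampS s = F.a₃ := by
    unfold clampS
    rw [min_eq_right (not_le.1 h1).le, max_eq_right (F.lt₁.trans (F.lt₂.trans F.lt₃)).le]
  linarith

theorem clampS_le_of_gt {s : ℝ} (h : F.a₀ < F.clampS s) : F.clampS s ≤ s := by
  unfold clampS at *
  rcases lt_max_iff.1 h with h1 | h1
  · exact absurd h1 (lt_irrefl _)
  · rw [max_eq_right h1.le]; exact min_le_left _ _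

theorem clampS_eq {s : ℝ} (h : F.a₃ ≤ s) : F.clampS s = F.a₃ := by
  unfold clampS
  rw [min_eq_right h, max_eq_right (F.lt₁.trans (F.lt₂.trans F.lt₃)).le]

variable {F}
variable {θ lo hi θ' lo' hi' : ℝ}

/-- With an unsaturated bond, wealth changes by a factor between `min 1 E` and `max 1 E`, up to `a₀`
and the cashflow, which is what the step inequalities of `Compat` absorb. With a saturated bond, the
next wealth exceeds `θ` by at least `a₀`. The bound on `s` is needed because clamping destroys the
wealth above `a₃`. -/
theorem Compat.zone_omega (h : F.Compat θ lo hi θ' lo' hi') {ε s b : ℝ} (hε : 0 < ε)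
    (hs : 0 ≤ s) (hb : 0 ≤ b) (hs3 : s ≤ F.a₃ + min 1 F.E * ε / 4)
    (hz : zone θ' lo' hi' ε (s + b)) :
    zone θ lo hi (min (F.a₀ / 2) (min 1 F.E * ε / 2)) (F.omega s b) := by
  have hm : 0 < min 1 F.E := lt_min one_pos F.E_pos
  have hm1 : min 1 F.E ≤ 1 := min_le_left _ _
  have hmE : min 1 F.E ≤ F.E := min_le_right _ _
  have hX1 : 1 ≤ max 1 F.E := le_max_left _ _
  have hXE : F.E ≤ max 1 F.E := le_max_right _ _
  set m := min 1 F.E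
  set X := max 1 F.E
  have e1 : min (F.a₀ / 2) (m * ε / 2) ≤ F.a₀ / 2 := min_le_left _ _
  have e2 : min (F.a₀ / 2) (m * ε / 2) ≤ m * ε / 2 := min_le_right _ _
  set e := min (F.a₀ / 2) (m * ε / 2)
  have hmε : 0 < m * ε := mul_pos hm hε
  have hmε' : m * ε ≤ ε := by nlinarith
  have ha := F.a₀_pos
  have hq := F.q_nonneg
  unfold omega
  rcases le_total (b * F.E) (min (F.bm * F.E) F.bm) with h1 | h1
  · have hsat : F.sat b = b * F.E := min_eq_left h1
    have hcl : s - m * ε / 4 ≤ F.clampS s := by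
      rcases le_total s F.a₃ with h2 | h2
      · linarith [F.le_clampS h2]
      · rw [F.clampS_eq h2]; linarith
    have hlow : m * (s + b) ≤ s + b * F.E := by nlinarith
    have hup : s + b * F.E ≤ X * (s + b) := by nlinarith
    have hcu : F.clampS s ≤ F.a₀ + s := by
      unfold clampS
      exact max_le (by linarith) ((min_le_left _ _).trans (by linarith))
    rw [hsat]
    rcases hz with hz | ⟨hz1, hz2⟩
    · left
      have := mul_le_mul_of_nonneg_left hz hm.le
      linarith [h.θ_step]
    · right
      have h3 := mul_le_mul_of_nonneg_left hz1 hm.le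
      have h4 := mul_le_mul_of_nonneg_left hz2 (by linarith : 0 ≤ X)
      have h5 : ε ≤ X * ε := by nlinarith
      constructor
      · linarith [h.lo_step]
      · linarith [h.hi_step]
  · left
    have hsat : F.sat b = min (F.bm * F.E) F.bm := min_eq_right h1
    have := F.clampS_ge s
    rw [hsat]
    linarith [h.θ_le]

/-- A gain in the next wealth, or a saturated bond position, which is in the jump-free zone. -/
theorem Compat.gain (h : F.Compat θ lo hi θ' lo' hi') {s b s' b' d e δ εz r : ℝ}
    (hr : (1 + F.E) * r ≤ F.a₀ / 2) (hs : |s' - s| ≤ r) (hbb : |b' - b| ≤ r)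
    (hcl : F.clampS s - e ≤ F.clampS s') (hb : b + d ≤ b')
    (hδ : δ ≤ F.E * d - e) (hεz : εz ≤ F.a₀ / 2) :
    F.omega s b + δ ≤ F.omega s' b' ∨ zone θ lo hi εz (F.omega s b) := by
  rcases F.sat_gain hb with h1 | h1
  · left
    unfold omega
    linarith
  · right; left
    have h2 : min (F.bm * F.E) F.bm + F.a₀ ≤ F.omega s' b' := by
      unfold omega
      linarith [F.clampS_ge s', F.q_nonneg]
    have h3 := F.omega_sub s' b' s b
    have h4 := mul_le_mul_of_nonneg_left hbb F.E_pos.le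
    have h5 := (abs_le.1 (h3.trans (add_le_add hs h4))).2
    linarith [h.θ_le]

end Frame
end MeanRisk

/-! ### Imitating an allocation with a comparable wealth. -/

namespace MeanRisk
namespace Frame
variable {F : Frame} {θ lo hi θ' lo' hi' : ℝ}

/-- The wealth `x'` is comparable with `x`: slightly larger, or close to it in the jump-free
zone. -/
def Rel (Z : ℝ → ℝ → Prop) (ε ρ δ x x' : ℝ) : Prop :=
  (x + δ ≤ x' ∧ x' ≤ x + ρ) ∨ (Z ε x ∧ |x' - x| ≤ ρ)

/-- Every allocation `(s, b)` of the wealth `s + b` can be imitated with the comparable wealth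
`w'`, staying in the layer of a given node `Y` close to `s`. -/
theorem Compat.exists_control (h : F.Compat θ lo hi θ' lo' hi') {ε r₀ : ℝ} (Wb : ℝ) (hWb : 0 ≤ Wb)
    (hε : 0 < ε) (hr₀ : 0 < r₀) :
    ∃ ρ > 0, ∀ δ > 0, ∃ δ₂ > 0, ∃ η₀ > 0, ∀ η, 0 ≤ η → η ≤ η₀ → ∀ U : Set ℝ,
      (∀ t, 0 ≤ t → t ≤ 1 → ∃ u ∈ U, u ≤ t ∧ t ≤ u + η) →
      (∀ t, 0 ≤ t → t ≤ 1 → ∃ u ∈ U, t ≤ u ∧ u ≤ t + η) →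
      ∀ s b w' Y, 0 ≤ s → 0 ≤ b → w' ≤ Wb → |Y - F.clampS s| ≤ η →
        Rel (zone θ' lo' hi') ε ρ δ (s + b) w' →
        ∃ u ∈ U, |u * w' - s| ≤ r₀ ∧ |(1 - u) * w' - b| ≤ r₀ ∧
          ((F.a₁ < Y ∧ Y < F.a₂ ∧ F.a₁ < F.clampS (u * w') - η ∧ F.clampS (u * w') + η < F.a₂) ∨
          (((Y ≤ F.a₁ ∧ F.clampS (u * w') + η ≤ F.a₁) ∨
            (F.a₂ ≤ Y ∧ F.a₂ ≤ F.clampS (u * w') - η)) ∧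
            (F.omega s b + δ₂ ≤ F.omega (u * w') ((1 - u) * w') ∨
              zone θ lo hi (min (F.a₀ / 2) (min 1 F.E * ε / 2)) (F.omega s b)))) := by
  have hE := F.E_pos
  have hm : 0 < min 1 F.E := lt_min one_pos F.E_pos
  have hm1 : min 1 F.E ≤ 1 := min_le_left _ _
  have hz := fun s b => h.zone_omega (s := s) (b := b) hε
  have hεz : min (F.a₀ / 2) (min 1 F.E * ε / 2) ≤ F.a₀ / 2 := min_le_left _ _
  set εz := min (F.a₀ / 2) (min 1 F.E * ε / 2)
  have hκ : 0 < min 1 F.E * ε / 4 := by positivity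
  have hκε : min 1 F.E * ε / 4 ≤ ε / 4 := by nlinarith
  set κ := min 1 F.E * ε / 4
  have ha₀ := F.a₀_pos
  have h01 := F.lt₁
  have h12 := F.lt₂
  have h23 := F.lt₃
  -- The second bound is the one under which a saturated bond in `Compat.gain` leaves the margin `a₀
  -- / 2` in the zone.
  obtain ⟨r, hr, hrr₀, hra⟩ : ∃ r > 0, r ≤ r₀ ∧ (1 + F.E) * r ≤ F.a₀ / 2 := by
    refine ⟨min r₀ (F.a₀ / 2 / (1 + F.E)), lt_min hr₀ (by positivity), min_le_left _ _, ?_⟩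
    have := min_le_right r₀ (F.a₀ / 2 / (1 + F.E))
    rw [le_div_iff₀ (by positivity)] at this
    linarith
  obtain ⟨ρ, hρ, hρκ, hρr, hρε⟩ : ∃ ρ > 0, ρ ≤ κ / 8 ∧ ρ ≤ r / 8 ∧ ρ ≤ ε / 8 :=
    ⟨min (κ / 8) (min (r / 8) (ε / 8)), by positivity, min_le_left _ _,
      (min_le_right _ _).trans (min_le_left _ _), (min_le_right _ _).trans (min_le_right _ _)⟩
  refine ⟨ρ, hρ, fun δ' hδ' => ?_⟩
  obtain ⟨δ, hδ, hδδ, hδρ⟩ : ∃ δ > 0, δ ≤ δ' ∧ δ ≤ ρ :=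
    ⟨min δ' ρ, by positivity, min_le_left _ _, min_le_right _ _⟩
  -- `g` is the safety distance from the layer boundaries; it is so small against `δ` that moving
  -- the risky amount by a few `g` uses up at most half of the surplus.
  obtain ⟨g, hg, hgE, hgδ, hgρ, hg1, hg2, hg3⟩ : ∃ g > 0, 6 * g ≤ F.E * δ ∧ 6 * g ≤ δ ∧
      6 * g ≤ ρ ∧ 4 * g ≤ F.a₁ - F.a₀ ∧ 4 * g ≤ F.a₂ - F.a₁ ∧ 4 * g ≤ F.a₃ - F.a₂ := by
    have : ∀ᶠ g in 𝓝[>] (0 : ℝ), 6 * g ≤ F.E * δ ∧ 6 * g ≤ δ ∧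
      6 * g ≤ ρ ∧ 4 * g ≤ F.a₁ - F.a₀ ∧ 4 * g ≤ F.a₂ - F.a₁ ∧ 4 * g ≤ F.a₃ - F.a₂ := by
      have key : ∀ k x : ℝ, 0 < x → 0 < k → ∀ᶠ g in 𝓝[>] (0 : ℝ), k * g ≤ x := by
        intro k x hx hk
        filter_upwards [Ioo_mem_nhdsGT (show 0 < x / k by positivity)] with g hg
        have := hg.2
        rw [lt_div_iff₀ hk] at this
        linarith
      filter_upwards [key 6 (F.E * δ) (by positivity) (by norm_num), key 6 δ hδ (by norm_num),
        key 6 ρ hρ (by norm_num), key 4 _ (sub_pos.2 h01) (by norm_num),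
        key 4 _ (sub_pos.2 h12) (by norm_num), key 4 _ (sub_pos.2 h23) (by norm_num)]
        with g a b c d e f using ⟨a, b, c, d, e, f⟩
    obtain ⟨g, hg, hg'⟩ := (this.and self_mem_nhdsWithin).exists
    exact ⟨g, hg', hg⟩
  -- The surplus `δ` put in the bond grows to `E * δ`, and the corrections cost at most half of it.
  -- The mesh bound with `Wb + 1` turns an error in the fraction into an error of at most `g / 4` in
  -- the amount.
  refine ⟨F.E * δ / 2, by positivity, min (g / 4) (g / 4 / (Wb + 1)), by positivity,
    fun η hη hηη U hfl hce s b w' Y hs hb hw' hY hrel => ?_⟩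
  have hηg : η ≤ g / 4 := hηη.trans (min_le_left _ _)
  have hηW : η * (Wb + 1) ≤ g / 4 := by
    rw [← le_div_iff₀ (by positivity)]; exact hηη.trans (min_le_right _ _)
  have hηw : η * w' ≤ g / 4 := by nlinarith
  obtain ⟨hY1, hY2⟩ := abs_le.1 hY
  have hw'0 : 0 < w' ∧ |w' - (s + b)| ≤ ρ := by
    rcases hrel with ⟨h1, h2⟩ | ⟨h1, h2⟩
    · exact ⟨by linarith, by rw [abs_le]; constructor <;> linarith⟩
    · refine ⟨?_, h2⟩
      have := (abs_le.1 h2).1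
      rcases h1 with h1 | ⟨h1, -⟩
      · linarith [h.a₂_le]
      · linarith [h.a₁_le]
  obtain ⟨hw'0, hww⟩ := hw'0
  obtain ⟨hww1, hww2⟩ := abs_le.1 hww
  have hdist : ∀ u : ℝ, |u * w' - s| ≤ 4 * ρ → |u * w' - s| ≤ r ∧ |(1 - u) * w' - b| ≤ r := by
    intro u hu
    obtain ⟨h1, h2⟩ := abs_le.1 hu
    constructor <;> rw [abs_le] <;> constructor <;> linarith
  have floor : ∀ t, 0 ≤ t → t ≤ w' → ∃ u ∈ U, u * w' ≤ t ∧ t ≤ u * w' + g / 4 := by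
    intro t h1 h2
    obtain ⟨u, hu, h3, h4⟩ := hfl (t / w') (by positivity) ((div_le_one hw'0).2 h2)
    rw [le_div_iff₀ hw'0] at h3
    rw [div_le_iff₀ hw'0] at h4
    exact ⟨u, hu, h3, by linarith⟩
  have ceil : ∀ t, 0 ≤ t → t ≤ w' → ∃ u ∈ U, t ≤ u * w' ∧ u * w' ≤ t + g / 4 := by
    intro t h1 h2
    obtain ⟨u, hu, h3, h4⟩ := hce (t / w') (by positivity) ((div_le_one hw'0).2 h2)
    rw [div_le_iff₀ hw'0] at h3
    rw [← sub_le_iff_le_add, le_div_iff₀ hw'0] at h4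
    exact ⟨u, hu, h3, by linarith⟩
  rcases le_or_gt Y F.a₁ with hYa | hYa
  · -- lower layer
    have hsY : s ≤ F.a₁ + η := by
      have := F.le_of_clampS_lt (s := s) (by linarith)
      linarith
    -- The target is pushed below `a₁` by `g`, so that all nodes near it are still in the lower
    -- layer; the control is rounded down to let the bond keep the surplus.
    have htw : min s (F.a₁ - g) ≤ w' := by
      rcases hrel with ⟨h1, h2⟩ | ⟨h1, h2⟩
      · linarith [min_le_left s (F.a₁ - g)]
      · rcases h1 with h1 | ⟨h1, -⟩
        · linarith [h.a₂_le, min_le_right s (F.a₁ - g)]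
        · linarith [h.a₁_le, min_le_right s (F.a₁ - g)]
    have ht3 : s - 2 * g ≤ min s (F.a₁ - g) := le_min (by linarith) (by linarith)
    obtain ⟨u, hu, h3, h4⟩ := floor _ (le_min hs (by linarith)) htw
    have h5 := min_le_left s (F.a₁ - g)
    have h6 := min_le_right s (F.a₁ - g)
    obtain ⟨d1, d2⟩ := hdist u (by rw [abs_le]; constructor <;> linarith)
    refine ⟨u, hu, d1.trans hrr₀, d2.trans hrr₀, Or.inr ⟨Or.inl ⟨hYa, ?_⟩, ?_⟩⟩
    · have : F.clampS (u * w') ≤ F.a₁ - g :=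
        max_le (by linarith) ((min_le_left _ _).trans (by linarith))
      linarith
    · rcases hrel with ⟨h1, h2⟩ | ⟨h1, h2⟩
      · refine h.gain (d := δ) (e := 3 * g) hra d1 d2 ?_ (by linarith) (by linarith) hεz
        have := (abs_le.1 (F.clampS_sub s (u * w'))).2
        have : |s - u * w'| ≤ 3 * g := by rw [abs_le]; constructor <;> linarith
        linarith
      · exact Or.inr (hz s b hs hb (by linarith) h1)
  rcases le_or_gt F.a₂ Y with hYb | hYb
  · -- upper layer
    have hsY : F.a₂ - η ≤ s := by
      have := F.clampS_le_of_gt (s := s) (by linarith)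
      linarith
    rcases hrel with ⟨h1, h2⟩ | ⟨h1, h2⟩
    -- The surplus `δ ≥ 6 * g` pays for raising the risky amount to `a₂ + g`; what remains of it
    -- goes to the bond.
    · have htw : max s (F.a₂ + g) ≤ s + 2 * g := max_le (by linarith) (by linarith)
      obtain ⟨u, hu, h3, h4⟩ := ceil (max s (F.a₂ + g)) (by positivity) (by linarith)
      have h5 := le_max_left s (F.a₂ + g)
      have h6 := le_max_right s (F.a₂ + g)
      obtain ⟨d1, d2⟩ := hdist u (by rw [abs_le]; constructor <;> linarith)
      refine ⟨u, hu, d1.trans hrr₀, d2.trans hrr₀, Or.inr ⟨Or.inr ⟨hYb, ?_⟩, ?_⟩⟩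
      · have : F.a₂ + g ≤ F.clampS (u * w') :=
          (le_min (by linarith) (by linarith)).trans (le_max_right _ _)
        linarith
      · refine h.gain (d := δ - 3 * g) (e := 0) hra d1 d2 ?_ (by linarith) ?_ hεz
        · linarith [F.clampS_mono (s := s) (t := u * w') (by linarith)]
        · have h7 : F.E * (3 * g) ≤ F.E * (δ / 2) :=
            mul_le_mul_of_nonneg_left (by linarith) hE.le
          linarith
    · have hw2 : F.a₂ + ε ≤ s + b := by
        rcases h1 with h1 | ⟨-, h1⟩
        · linarith [h.a₂_le]
        · linarith [h.hi_le]
      rcases le_total (F.a₃ + κ) s with hs3 | hs3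
      -- Well above `a₃` the clamp does not see a reduction of `s` by `4 * ρ`. The released amount
      -- covers a deficit of up to `ρ` in `w'` and still yields a gain in the bond.
      · obtain ⟨u, hu, h3, h4⟩ := ceil (s - 4 * ρ) (by linarith) (by linarith)
        obtain ⟨d1, d2⟩ := hdist u (by rw [abs_le]; constructor <;> linarith)
        refine ⟨u, hu, d1.trans hrr₀, d2.trans hrr₀, Or.inr ⟨Or.inr ⟨hYb, ?_⟩, ?_⟩⟩
        · rw [F.clampS_eq (by linarith)]; linarith
        · refine h.gain (d := 2 * ρ) (e := 0) hra d1 d2 ?_ (by linarith) ?_ hεz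
          · rw [F.clampS_eq (s := s) (by linarith), F.clampS_eq (by linarith)]; linarith
          · have h7 : F.E * (δ / 2) ≤ F.E * (2 * ρ) :=
              mul_le_mul_of_nonneg_left (by linarith) hE.le
            linarith
      -- Here `w'` may be below `s`, hence the cap at `w'`. No gain is needed, since the next wealth
      -- is in the zone.
      · have t1 := min_le_left w' (max s (F.a₂ + g))
        have t2 : min w' (max s (F.a₂ + g)) ≤ s + 2 * g :=
          (min_le_right _ _).trans (max_le (by linarith) (by linarith))
        have t3 : s - ρ ≤ min w' (max s (F.a₂ + g)) :=
          le_min (by linarith) (by linarith [le_max_left s (F.a₂ + g)])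
        have t4 : F.a₂ + g ≤ min w' (max s (F.a₂ + g)) :=
          le_min (by linarith) (le_max_right _ _)
        obtain ⟨u, hu, h3, h4⟩ := ceil (min w' (max s (F.a₂ + g))) (by linarith) t1
        obtain ⟨d1, d2⟩ := hdist u (by rw [abs_le]; constructor <;> linarith)
        refine ⟨u, hu, d1.trans hrr₀, d2.trans hrr₀, Or.inr ⟨Or.inr ⟨hYb, ?_⟩, ?_⟩⟩
        · have : F.a₂ + g ≤ F.clampS (u * w') :=
            (le_min (by linarith) (by linarith)).trans (le_max_right _ _)
          linarith
        · exact Or.inr (hz s b hs hb hs3 h1)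
  · -- interior
    have hsY : s ≤ F.a₂ + η := by
      have := F.le_of_clampS_lt (s := s) (by linarith)
      linarith
    have hsY' : F.a₁ - η ≤ s := by
      have := F.clampS_le_of_gt (s := s) (by linarith)
      linarith
    have hw1 : F.a₁ + g ≤ w' ∧ s - ρ ≤ w' := by
      rcases hrel with ⟨h1, h2⟩ | ⟨h1, h2⟩
      · constructor <;> linarith
      · rcases h1 with h1 | ⟨h1, -⟩
        · constructor <;> linarith [h.a₂_le]
        · constructor <;> linarith [h.a₁_le]
    -- The target keeps the distance `g` from both ends of the open interior layer. Only closeness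
    -- matters, as interior values vary little with the node.
    set t := min w' (max (F.a₁ + g) (min s (F.a₂ - g)))
    have t1 : t ≤ w' := min_le_left _ _
    have t2 : F.a₁ + g ≤ t := le_min hw1.1 (le_max_left _ _)
    have t3 : t ≤ F.a₂ - g :=
      (min_le_right _ _).trans (max_le (by linarith) (min_le_right _ _))
    have t4 : t ≤ s + 2 * g := (min_le_right _ _).trans (max_le (by linarith)
      ((min_le_left _ _).trans (by linarith)))
    have t5 : s - ρ ≤ t := le_min hw1.2 (le_trans (le_min (by linarith) (by linarith))
      (le_max_right _ _))
    obtain ⟨u, hu, h3, h4⟩ := floor t (by linarith) t1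
    obtain ⟨d1, d2⟩ := hdist u (by rw [abs_le]; constructor <;> linarith)
    refine ⟨u, hu, d1.trans hrr₀, d2.trans hrr₀, Or.inl ⟨hYa, hYb, ?_, ?_⟩⟩
    · have := F.le_clampS (s := u * w') (by linarith)
      linarith
    · have : F.clampS (u * w') ≤ F.a₂ - g :=
        max_le (by linarith) ((min_le_left _ _).trans (by linarith))
      linarith

end Frame
end MeanRisk

/-! ### Propagation of one-sided comparability through a step. -/

namespace MeanRisk
namespace Frame
variable {F : Frame} {θ lo hi θ' lo' hi' : ℝ}

theorem abs_max_one_div_sub (a : ℝ) (ha : 0 < a) (x y : ℝ) :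
    |max 1 (x / a) - max 1 (y / a)| ≤ |x - y| / a := by
  refine (abs_max_sub_max_le_max _ _ _ _).trans (max_le ?_ ?_)
  · rw [sub_self, abs_zero]; positivity
  · rw [← sub_div, abs_div, abs_of_pos ha]

theorem amp_nonneg (s b : ℝ) : 0 ≤ F.amp s b := by unfold amp; positivity

theorem a₃_pos : 0 < F.a₃ := F.a₀_pos.trans (F.lt₁.trans (F.lt₂.trans F.lt₃))

theorem exists_amp_bound (F : Frame) (Wb : ℝ) : ∃ C > 0, ∀ s b s' b', s ≤ Wb → b ≤ Wb → s' ≤ Wb →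
    b' ≤ Wb → F.amp s b ≤ C ∧ |F.amp s b - F.amp s' b'| ≤ C * (|s - s'| + |b - b'|) := by
  have hb := F.bm_pos
  have ha := F.a₃_pos
  set A := max 1 (Wb / F.bm)
  set B := max 1 (Wb / F.a₃)
  have hA : 0 < A := by positivity
  have hB : 0 < B := by positivity
  refine ⟨A * B + A / F.a₃ + B / F.bm, by positivity, fun s b s' b' hs hb1 hs' hb' => ?_⟩
  have h1 : max 1 (b / F.bm) ≤ A := max_le_max le_rfl (by gcongr)
  have h2 : max 1 (s' / F.a₃) ≤ B := max_le_max le_rfl (by gcongr)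
  have h2' : max 1 (s / F.a₃) ≤ B := max_le_max le_rfl (by gcongr)
  have hb0 : 0 ≤ max 1 (b / F.bm) := by positivity
  have hs0 : 0 ≤ max 1 (s' / F.a₃) := by positivity
  have hs1 : 0 ≤ max 1 (s / F.a₃) := by positivity
  constructor
  · have : F.amp s b ≤ A * B := by unfold amp; gcongr
    have : 0 ≤ A / F.a₃ := by positivity
    have : 0 ≤ B / F.bm := by positivity
    linarith
  · have e : F.amp s b - F.amp s' b' = max 1 (b / F.bm) * (max 1 (s / F.a₃) - max 1 (s' / F.a₃)) +
        (max 1 (b / F.bm) - max 1 (b' / F.bm)) * max 1 (s' / F.a₃) := by unfold amp; ring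
    rw [e]
    refine (abs_add_le _ _).trans ?_
    rw [abs_mul, abs_mul, abs_of_nonneg hb0, abs_of_nonneg hs0]
    calc _ ≤ A * (|s - s'| / F.a₃) + |b - b'| / F.bm * B := by
          gcongr
          · exact abs_max_one_div_sub _ ha _ _
          · exact abs_max_one_div_sub _ hb _ _
      _ = A / F.a₃ * |s - s'| + B / F.bm * |b - b'| := by ring
      _ ≤ _ := by
          have h3 : 0 ≤ A * B * (|s - s'| + |b - b'|) := by positivity
          have h4 : 0 ≤ A / F.a₃ * |b - b'| := by positivity
          have h5 : 0 ≤ B / F.bm * |s - s'| := by positivity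
          nlinarith

theorem kap_nonneg (b : ℝ) : 0 ≤ F.kap b := by unfold kap; positivity

theorem kap_le {b : ℝ} (h : b ≤ F.bm) : F.kap b ≤ max 1 F.E := by
  refine max_le_max le_rfl ?_
  rw [div_le_iff₀ F.bm_pos, mul_comm]
  exact mul_le_mul_of_nonneg_left h F.E_pos.le

theorem kap_sub (b b' : ℝ) : |F.kap b - F.kap b'| ≤ F.E / F.bm * |b - b'| := by
  refine (abs_max_one_div_sub _ F.bm_pos _ _).trans (le_of_eq ?_)
  rw [← sub_mul, abs_mul, abs_of_pos F.E_pos]; ring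

theorem lay_nonneg (Y : ℝ) : 0 ≤ F.lay Y := by
  unfold lay; split_ifs
  · exact zero_le_one
  · exact F.c_pos.le

theorem lay_le (Y : ℝ) : F.lay Y ≤ max 1 F.c := by
  unfold lay; split_ifs
  · exact le_max_left _ _
  · exact le_max_right _ _

theorem sat_eq (b : ℝ) : min (min b F.bm * F.E) F.bm = F.sat b := by
  rw [min_mul_of_nonneg _ _ F.E_pos.le, min_assoc]; rfl

/-- Two mesh errors add up: the first, made before interest, is multiplied by `E`; the second is
made after it. -/
theorem abs_sub_sat_le {η b b₁ β : ℝ} (h : |b₁ - min b F.bm| ≤ η)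
    (hβ : |β - min (b₁ * F.E) F.bm| ≤ η) : |β - F.sat b| ≤ (1 + F.E) * η := by
  have h1 : |min (b₁ * F.E) F.bm - F.sat b| ≤ F.E * η := by
    rw [← F.sat_eq]
    refine (abs_min_sub_min_le_max _ _ _ _).trans (max_le ?_ ?_)
    · rw [← sub_mul, abs_mul, abs_of_pos F.E_pos, mul_comm]
      exact mul_le_mul_of_nonneg_left h F.E_pos.le
    · rw [sub_self, abs_zero]
      exact mul_nonneg F.E_pos.le ((abs_nonneg _).trans h)
  linarith [abs_sub_le β (min (b₁ * F.E) F.bm) (F.sat b)]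

/-- Comparability of the objective values of two families of wealth functions at comparable
wealths. -/
def Close {ι : Type*} (l : Filter ι) (R₁ R₂ : ι → ℝ → ℝ) (Z : ℝ → ℝ → Prop) : Prop :=
  ∀ Wb, ∀ ε > 0, ∃ ρ > 0, ∀ δ > 0, ∀ᶠ n in l, ∀ x x', 0 ≤ x → x ≤ Wb → 0 ≤ x' → x' ≤ Wb →
    Rel Z ε ρ δ x x' → R₁ n x ≤ R₂ n x' + ε

/-- Comparability of the values after time advancement at nearby interior nodes. -/
def InteriorClose {ι : Type*} (F : Frame) (l : Filter ι) (N₁ N₂ : ι → ℝ → ℝ → ℝ → Prop) : Prop :=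
  ∀ ε > 0, ∃ ρ > 0, ∀ᶠ n in l, ∀ Y b v Y' b' v', N₁ n Y b v → N₂ n Y' b' v' →
    F.a₁ < Y → Y < F.a₂ → F.a₁ < Y' → Y' < F.a₂ → |Y - Y'| ≤ ρ → |b - b'| ≤ ρ → v ≤ v' + ε

/-- A product estimate for factors that are close and values that are compared on one side only;
this is why `0 ≤ A` is required. -/
theorem mul_le_mul_add {A B r r' e e' CA CR : ℝ} (hA : 0 ≤ A) (hAC : A ≤ CA) (hAB : |A - B| ≤ e)
    (hr' : |r'| ≤ CR) (hr : r ≤ r' + e') (he' : 0 ≤ e') : A * r ≤ B * r' + e * CR + CA * e' := by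
  have h1 : A * r ≤ A * (r' + e') := mul_le_mul_of_nonneg_left hr hA
  have h2 : A * e' ≤ CA * e' := mul_le_mul_of_nonneg_right hAC he'
  have h3 : (A - B) * r' ≤ e * CR := (le_abs_self _).trans (by
    rw [abs_mul]
    exact mul_le_mul hAB hr' (abs_nonneg _) ((abs_nonneg _).trans hAB))
  linarith

/-- Fixes one small constant subject to finitely many linear smallness conditions, each given as a
pair of coefficient and bound. -/
theorem exists_pos_small (L : List (ℝ × ℝ)) (h : ∀ p ∈ L, 0 < p.1 ∧ 0 < p.2) :
    ∃ g > 0, ∀ p ∈ L, p.1 * g ≤ p.2 := by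
  induction L with
  | nil => exact ⟨1, one_pos, by simp⟩
  | cons p L ih =>
    obtain ⟨g, hg, hgL⟩ := ih fun x hx => h x (List.mem_cons_of_mem _ hx)
    obtain ⟨h1, h2⟩ := h p List.mem_cons_self
    refine ⟨min g (p.2 / p.1), by positivity, fun x hx => ?_⟩
    rcases List.mem_cons.1 hx with rfl | hx
    · calc x.1 * min g (x.2 / x.1) ≤ x.1 * (x.2 / x.1) := by gcongr; exact min_le_right _ _
        _ = x.2 := by field_simp
    · have := (h x (List.mem_cons_of_mem _ hx)).1
      exact (mul_le_mul_of_nonneg_left (min_le_left _ _) this.le).trans (hgL x hx)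

/-- A nearly optimal allocation for `x` is imitated from `x'`. In the interior layer the values
after time advancement are close by `InteriorClose`. In the boundary layers they are continuation
factors times the next wealth function, at wealths that are again comparable, so the comparison one
period later applies. -/
theorem Compat.close_step {ι : Type*} {l : Filter ι} (h : F.Compat θ lo hi θ' lo' hi')
    {R₁ R₂ R₁' R₂' : ι → ℝ → ℝ} {N₁ N₂ : ι → ℝ → ℝ → ℝ → Prop} {U₁ U₂ : ι → Set ℝ}
    (S₁ : ∀ η > 0, ∀ᶠ n in l, F.Step η (R₁ n) (N₁ n) (U₁ n) (R₁' n))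
    (S₂ : ∀ η > 0, ∀ᶠ n in l, F.Step η (R₂ n) (N₂ n) (U₂ n) (R₂' n))
    {CR CV : ℝ} (hR : ∀ᶠ n in l, ∀ x, 0 ≤ x → x ≤ F.a₃ + F.bm + F.q → |R₂ n x| ≤ CR)
    (hV : ∀ᶠ n in l, ∀ Y b v, N₂ n Y b v → F.a₁ < Y → Y < F.a₂ → |v| ≤ CV)
    (hI : InteriorClose F l N₁ N₂) (hC : Close l R₁ R₂ (zone θ lo hi)) :
    Close l R₁' R₂' (zone θ' lo' hi') := by
  intro Wb₀ ε hε
  obtain ⟨Wb, hWb, hWb₀⟩ : ∃ Wb ≥ 0, Wb₀ ≤ Wb := ⟨max Wb₀ 0, le_max_right _ _, le_max_left _ _⟩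
  obtain ⟨CA, hCA, hamp⟩ := F.exists_amp_bound (Wb + 1)
  have hE := F.E_pos
  have hbm := F.bm_pos
  have ha₀ := F.a₀_pos
  have hm : 0 < min 1 F.E := lt_min one_pos F.E_pos
  set CK := max 1 F.E
  set CL := max 1 F.c
  have hCK : 0 < CK := by positivity
  have hCL : 0 < CL := by positivity
  obtain ⟨CR', hCR', hCRR⟩ : ∃ C > 0, CR ≤ C := ⟨max CR 1, by positivity, le_max_left _ _⟩
  obtain ⟨CV', hCV', hCVV⟩ : ∃ C > 0, CV ≤ C := ⟨max CV 1, by positivity, le_max_left _ _⟩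
  set εz := min (F.a₀ / 2) (min 1 F.E * ε / 2) with hεz
  have hεz0 : 0 < εz := by positivity
  -- `CA * CL * CK` bounds the product of the factors in front of the next value. The bound `εz / 2`
  -- leaves room to replace the next wealth by the wealth at a node without leaving the zone.
  obtain ⟨εk, hεk, hεks⟩ := exists_pos_small [(CA * CL * CK, ε / 4), (1, εz / 2)] (by
    simp only [List.mem_cons, List.not_mem_nil, or_false]
    rintro p (rfl | rfl) <;> constructor <;> dsimp only <;> positivity)
  simp only [List.forall_mem_cons] at hεks
  obtain ⟨hεk1, hεk2, -⟩ := hεks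
  obtain ⟨ρk, hρk, hCk⟩ := hC (F.a₃ + F.bm + F.q) εk hεk
  obtain ⟨ρi, hρi, hIi⟩ := hI (ε / 4 / CA) (by positivity)
  -- This controls the change of the product of the continuation factors when the amounts move by
  -- `r` and the bond nodes by `3 * r`.
  set K₀ := CL * (3 * CA * (F.E / F.bm) + 2 * CK * CA)
  have hK₀ : 0 < K₀ := by positivity
  obtain ⟨r, hr, hrs⟩ := exists_pos_small [(K₀ * CR', ε / 4), (2 * CA * CV', ε / 4), (3, ρi),
      (4 * (1 + F.E), ρk), (1, 1)] (by
    simp only [List.mem_cons, List.not_mem_nil, or_false]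
    rintro p (rfl | rfl | rfl | rfl | rfl) <;> constructor <;> dsimp only <;> positivity)
  simp only [List.forall_mem_cons] at hrs
  obtain ⟨hr1, hr2, hr3, hr4, hr5, -⟩ := hrs
  obtain ⟨ρ, hρ, hsel⟩ := h.exists_control Wb hWb hε hr
  refine ⟨ρ, hρ, fun δ hδ => ?_⟩
  obtain ⟨δ₂, hδ₂, η₀, hη₀, hsel⟩ := hsel δ hδ
  obtain ⟨η, hη, hηs⟩ := exists_pos_small [(1, η₀), (1, r), (4 * (2 + F.E), δ₂),
      (8 * (2 + F.E), ρk), (2 * (2 + F.E), εz)] (by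
    simp only [List.mem_cons, List.not_mem_nil, or_false]
    rintro p (rfl | rfl | rfl | rfl | rfl) <;> constructor <;> dsimp only <;> positivity)
  simp only [List.forall_mem_cons] at hηs
  obtain ⟨hη1, hη2, hη3, hη4, hη5, -⟩ := hηs
  rw [one_mul] at hη1 hη2 hr5 hεk2
  filter_upwards [S₁ η hη, S₂ η hη, hR, hV, hIi, hCk (δ₂ / 2) (by positivity)] with
    n S₁ S₂ hR hV hI hC
  intro w w' hw hwW hw' hwW' hrel
  obtain ⟨u₁, hu₁, Y₁, b₁, v₁, hN₁, hY₁, hb₁, hval₁⟩ := S₁.near_le w hw (ε / 4) (by positivity)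
  obtain ⟨hu0, hu1⟩ := S₁.sub _ hu₁
  set s := u₁ * w
  set b := (1 - u₁) * w
  have hs : 0 ≤ s := mul_nonneg hu0 hw
  have hb : 0 ≤ b := mul_nonneg (by linarith) hw
  have hsb : w = s + b := by simp only [s, b]; ring
  rw [hsb] at hrel
  obtain ⟨u₂, hu₂, hds, hdb, hcase⟩ := hsel η hη.le hη1 (U₂ n) S₂.floor S₂.ceil s b w' Y₁ hs hb
    (by linarith) hY₁ hrel
  obtain ⟨Y₂, b₂, v₂, hN₂, hY₂, hb₂, hval₂⟩ := S₂.near_ge w' hw' u₂ hu₂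
  obtain ⟨hu0', hu1'⟩ := S₂.sub _ hu₂
  set s' := u₂ * w'
  set b' := (1 - u₂) * w'
  have hs' : 0 ≤ s' := mul_nonneg hu0' hw'
  have hb' : 0 ≤ b' := mul_nonneg (by linarith) hw'
  have hsb' : w' = s' + b' := by simp only [s', b']; ring
  obtain ⟨hA1, hA2⟩ := hamp s b s' b' (by linarith) (by linarith) (by linarith) (by linarith)
  have hA0 : 0 ≤ F.amp s b := amp_nonneg _ _
  have hA3 : |F.amp s b - F.amp s' b'| ≤ CA * (2 * r) := hA2.trans (by
    rw [abs_sub_comm] at hds hdb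
    exact mul_le_mul_of_nonneg_left (by linarith) hCA.le)
  suffices F.amp s b * v₁ ≤ F.amp s' b' * v₂ + ε / 2 by linarith
  obtain ⟨hY₁a, hY₁b⟩ := abs_le.1 hY₁
  obtain ⟨hY₂a, hY₂b⟩ := abs_le.1 hY₂
  have hbb : |b₁ - b₂| ≤ 3 * r := by
    have := (abs_min_sub_min_le_max b F.bm b' F.bm)
    rw [sub_self, abs_zero, max_eq_left (abs_nonneg _)] at this
    obtain ⟨h1, h2⟩ := abs_le.1 this
    obtain ⟨h3, h4⟩ := abs_le.1 hb₁
    obtain ⟨h5, h6⟩ := abs_le.1 hb₂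
    have h7 : |b - b'| ≤ r := by rwa [abs_sub_comm]
    rw [abs_le]; constructor <;> linarith
  rcases hcase with ⟨c1, c2, c3, c4⟩ | ⟨hlay, hgood⟩
  · -- interior
    have hYY : |Y₁ - Y₂| ≤ ρi := by
      have h1 := F.clampS_sub s s'
      have h2 : |s - s'| ≤ r := by rwa [abs_sub_comm]
      obtain ⟨h3, h4⟩ := abs_le.1 (h1.trans h2)
      rw [abs_le]; constructor <;> linarith
    have hv := hI Y₁ b₁ v₁ Y₂ b₂ v₂ hN₁ hN₂ c1 c2 (by linarith) (by linarith) hYY (by linarith)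
    have := mul_le_mul_add hA0 hA1 hA3 ((hV _ _ _ hN₂ (by linarith) (by linarith)).trans hCVV) hv
      (by positivity)
    have e1 : CA * (ε / 4 / CA) = ε / 4 := by field_simp
    have e2 : CA * (2 * r) * CV' = 2 * CA * CV' * r := by ring
    linarith
  · -- boundary layers
    obtain ⟨hl₁, hl₂, hlay⟩ : (Y₁ ≤ F.a₁ ∨ F.a₂ ≤ Y₁) ∧ (Y₂ ≤ F.a₁ ∨ F.a₂ ≤ Y₂) ∧
        F.lay Y₁ = F.lay Y₂ := by
      rcases hlay with ⟨h1, h2⟩ | ⟨h1, h2⟩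
      · have h3 : Y₂ ≤ F.a₁ := by linarith
        exact ⟨Or.inl h1, Or.inl h3, by simp [lay, h1, h3]⟩
      · have h3 : F.a₂ ≤ Y₂ := by linarith
        have := F.lt₂
        exact ⟨Or.inr h1, Or.inr h3, by
          simp [lay, not_le.2 (this.trans_le h1), not_le.2 (this.trans_le h3)]⟩
    obtain ⟨β₁, hβ₁0, hβ₁b, hβ₁, hv₁⟩ := S₁.layer_le hN₁ hl₁
    obtain ⟨β₂, hβ₂0, hβ₂b, hβ₂, hv₂⟩ := S₂.layer_ge hN₂ hl₂
    obtain ⟨m1, m2, m3, m4⟩ := S₁.mem hN₁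
    obtain ⟨m1', m2', m3', m4'⟩ := S₂.mem hN₂
    have hq := F.q_nonneg
    obtain ⟨g1, g2⟩ := abs_le.1 (abs_sub_sat_le hb₁ hβ₁)
    obtain ⟨g3, g4⟩ := abs_le.1 (abs_sub_sat_le hb₂ hβ₂)
    have hx₁ : |Y₁ + β₁ + F.q - F.omega s b| ≤ (2 + F.E) * η := by
      unfold omega; rw [abs_le]; constructor <;> linarith
    have hx₂ : |Y₂ + β₂ + F.q - F.omega s' b'| ≤ (2 + F.E) * η := by
      unfold omega; rw [abs_le]; constructor <;> linarith
    have hωω : |F.omega s' b' - F.omega s b| ≤ (1 + F.E) * r := by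
      refine (F.omega_sub _ _ _ _).trans ?_
      linarith [mul_le_mul_of_nonneg_left hdb hE.le]
    obtain ⟨p1, p2⟩ := abs_le.1 hx₁
    obtain ⟨p3, p4⟩ := abs_le.1 hx₂
    obtain ⟨p5, p6⟩ := abs_le.1 hωω
    set x₁ := Y₁ + β₁ + F.q
    set x₂ := Y₂ + β₂ + F.q
    -- Each of the two node wealths is off by at most `(2 + E) * η ≤ δ₂ / 4`, so half of the gain
    -- `δ₂` remains.
    have hrelk : Rel (zone θ lo hi) εk ρk (δ₂ / 2) x₁ x₂ := by
      rcases hgood with hg | hg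
      · left; constructor <;> linarith
      · right
        refine ⟨?_, by rw [abs_le]; constructor <;> linarith⟩
        rcases hg with hg | ⟨hg1, hg2⟩
        · left; linarith
        · right; constructor <;> linarith
    have hx₂0 : 0 ≤ x₂ := by simp only [x₂]; linarith
    have hx₂W : x₂ ≤ F.a₃ + F.bm + F.q := by simp only [x₂]; linarith
    have hR12 := hC x₁ x₂ (by simp only [x₁]; linarith) (by simp only [x₁]; linarith) hx₂0 hx₂W
      hrelk
    have hk1 := kap_le m4
    have hk2 : |F.kap b₁ - F.kap b₂| ≤ F.E / F.bm * (3 * r) :=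
      (F.kap_sub _ _).trans (mul_le_mul_of_nonneg_left hbb (by positivity))
    have hl0 := F.lay_nonneg Y₁
    have hl1 := F.lay_le Y₁
    have hk0 := F.kap_nonneg b₁
    have hk0' := F.kap_nonneg b₂
    have hA' : |F.amp s b * F.lay Y₁ * F.kap b₁ - F.amp s' b' * F.lay Y₁ * F.kap b₂| ≤ K₀ * r := by
      have e : F.amp s b * F.lay Y₁ * F.kap b₁ - F.amp s' b' * F.lay Y₁ * F.kap b₂ =
          F.lay Y₁ * (F.amp s b * (F.kap b₁ - F.kap b₂) +
            F.kap b₂ * (F.amp s b - F.amp s' b')) := by ring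
      rw [e, abs_mul, abs_of_nonneg hl0]
      calc _ ≤ CL * (CA * (F.E / F.bm * (3 * r)) + CK * (CA * (2 * r))) := by
            refine mul_le_mul hl1 ((abs_add_le _ _).trans ?_) (abs_nonneg _) hCL.le
            rw [abs_mul, abs_mul, abs_of_nonneg hA0, abs_of_nonneg hk0']
            have := kap_le m4'
            gcongr
        _ = K₀ * r := by simp only [K₀]; ring
    have := mul_le_mul_add (A := F.amp s b * F.lay Y₁ * F.kap b₁) (CA := CA * CL * CK)
      (by positivity) (by gcongr) hA' ((hR x₂ hx₂0 hx₂W).trans hCRR) hR12 hεk.le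
    have e1 : K₀ * r * CR' = K₀ * CR' * r := by ring
    have q1 := mul_le_mul_of_nonneg_left hv₁ hA0
    have q2 := mul_le_mul_of_nonneg_left hv₂ (F.amp_nonneg s' b')
    rw [← hlay] at q2
    have e2 : F.amp s b * (F.lay Y₁ * (F.kap b₁ * R₁ n x₁)) =
      F.amp s b * F.lay Y₁ * F.kap b₁ * R₁ n x₁ := by ring
    have e3 : F.amp s' b' * (F.lay Y₁ * (F.kap b₂ * R₂ n x₂)) =
      F.amp s' b' * F.lay Y₁ * F.kap b₂ * R₂ n x₂ := by ring
    linarith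

end Frame
end MeanRisk

/-! ### The transition density and its truncated series. -/

namespace MeanRisk
namespace Market

variable (P : Market)

open MeasureTheory

theorem dt_pos : 0 < P.dt := div_pos P.T_pos (by exact_mod_cast P.M_pos)

theorem jumpDensity_nonneg (ζ : ℝ) : 0 ≤ P.jumpDensity ζ := by
  unfold jumpDensity
  have h1 := P.pUp_nonneg
  have h2 : 0 ≤ 1 - P.pUp := by linarith [P.pUp_le_one]
  have h3 : 0 ≤ P.η₁ := by linarith [P.one_lt_η₁]
  have h4 := P.η₂_pos.le
  split_ifs <;> positivity

theorem integrable_jumpDensity : Integrable P.jumpDensity := by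
  have h1 : IntegrableOn P.jumpDensity (Set.Ici 0) := by
    rw [integrableOn_Ici_iff_integrableOn_Ioi]
    have := (integrableOn_exp_mul_Ioi (a := -P.η₁) (by linarith [P.one_lt_η₁]) 0).const_mul
      (P.pUp * P.η₁)
    refine IntegrableOn.congr_fun this (fun x hx => ?_) measurableSet_Ioi
    simp [jumpDensity, (Set.mem_Ioi.1 hx).le]
  have h2 : IntegrableOn P.jumpDensity (Set.Iio 0) := by
    have := ((integrableOn_exp_mul_Iic (a := P.η₂) P.η₂_pos 0).mono_set Set.Iio_subset_Iic_self).const_mul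
      ((1 - P.pUp) * P.η₂)
    refine IntegrableOn.congr_fun this (fun x hx => ?_) measurableSet_Iio
    simp [jumpDensity, not_le.2 (Set.mem_Iio.1 hx)]
  rw [← integrableOn_univ, ← Set.Iio_union_Ici (a := (0 : ℝ))]
  exact h2.union h1

/-- The total mass of the jump density. -/
noncomputable def jumpMass : ℝ := ∫ ζ, P.jumpDensity ζ

theorem condDensity_zero : P.condDensity 0 = fun x =>
    Real.exp (-(x - P.drift) ^ 2 / (2 * P.σ ^ 2 * P.dt)) /
      Real.sqrt (2 * Real.pi * P.σ ^ 2 * P.dt) := by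
  funext x; rw [condDensity]

theorem condDensity_succ (ℓ : ℕ) : P.condDensity (ℓ + 1) = fun x =>
    ∫ ζ, P.condDensity ℓ (x - ζ) * P.jumpDensity ζ := by
  funext x; rw [condDensity]

/-- The Gaussian factor is bounded and continuous. Convolution with the integrable jump density
multiplies the bound by its mass and, by dominated convergence, preserves continuity. Geometric
growth in `ℓ` suffices, as the Poisson weights bring a factorial. -/
theorem condDensity_bounds (ℓ : ℕ) : Continuous (P.condDensity ℓ) ∧ ∀ x, 0 ≤ P.condDensity ℓ x ∧
    P.condDensity ℓ x ≤ (Real.sqrt (2 * Real.pi * P.σ ^ 2 * P.dt))⁻¹ * P.jumpMass ^ ℓ := by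
  have hdt := P.dt_pos
  have hσ := P.σ_pos
  induction ℓ with
  | zero =>
    rw [condDensity_zero]
    refine ⟨by fun_prop, fun x => ⟨by positivity, ?_⟩⟩
    · dsimp only
      rw [pow_zero, mul_one, div_eq_mul_inv]
      refine mul_le_of_le_one_left (by positivity) (Real.exp_le_one_iff.2 ?_)
      rw [neg_div]
      exact neg_nonpos.2 (by positivity)
  | succ ℓ ih =>
    obtain ⟨hc, hb⟩ := ih
    set B := (Real.sqrt (2 * Real.pi * P.σ ^ 2 * P.dt))⁻¹ * P.jumpMass ^ ℓ
    have hdom : ∀ x ζ, ‖P.condDensity ℓ (x - ζ) * P.jumpDensity ζ‖ ≤ B * P.jumpDensity ζ := by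
      intro x ζ
      rw [Real.norm_eq_abs, abs_of_nonneg (mul_nonneg (hb _).1 (P.jumpDensity_nonneg _))]
      exact mul_le_mul_of_nonneg_right (hb _).2 (P.jumpDensity_nonneg _)
    have hmeas : ∀ x, AEStronglyMeasurable (fun ζ => P.condDensity ℓ (x - ζ) * P.jumpDensity ζ) :=
      fun x => (hc.comp (by fun_prop)).aestronglyMeasurable.mul
        P.integrable_jumpDensity.aestronglyMeasurable
    rw [condDensity_succ]
    refine ⟨?_, fun x => ⟨?_, ?_⟩⟩
    · refine continuous_of_dominated hmeas (fun x => ae_of_all _ (hdom x))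
        (P.integrable_jumpDensity.const_mul B) (ae_of_all _ fun ζ => ?_)
      exact (hc.comp (by fun_prop)).mul continuous_const
    · exact integral_nonneg fun ζ => mul_nonneg (hb _).1 (P.jumpDensity_nonneg _)
    · rw [pow_succ P.jumpMass, ← mul_assoc]
      calc _ ≤ ∫ ζ, B * P.jumpDensity ζ := by
            refine integral_mono_of_nonneg (ae_of_all _ fun ζ => ?_)
              (P.integrable_jumpDensity.const_mul B) (ae_of_all _ fun ζ => ?_)
            · exact mul_nonneg (hb _).1 (P.jumpDensity_nonneg _)
            · exact (le_abs_self _).trans (hdom x ζ)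
        _ = B * P.jumpMass := by rw [integral_const_mul]; rfl

/-- A summable bound of the terms of the density series. -/
noncomputable def termBound (ℓ : ℕ) : ℝ :=
  Real.exp (-(P.lam * P.dt)) * (Real.sqrt (2 * Real.pi * P.σ ^ 2 * P.dt))⁻¹ *
    ((P.lam * P.dt * P.jumpMass) ^ ℓ / (ℓ.factorial : ℝ))

theorem summable_termBound : Summable P.termBound :=
  (Real.summable_pow_div_factorial _).mul_left _

theorem densityTerm_nonneg (ℓ : ℕ) (z : ℝ) : 0 ≤ P.densityTerm ℓ z := by
  have := P.dt_pos
  have := P.lam_nonneg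
  have := ((P.condDensity_bounds ℓ).2 (-z)).1
  unfold densityTerm
  positivity

theorem densityTerm_le (ℓ : ℕ) (z : ℝ) : P.densityTerm ℓ z ≤ P.termBound ℓ := by
  have := P.dt_pos
  have := P.lam_nonneg
  unfold densityTerm termBound
  calc _ ≤ Real.exp (-(P.lam * P.dt)) * (P.lam * P.dt) ^ ℓ / (ℓ.factorial : ℝ) *
        ((Real.sqrt (2 * Real.pi * P.σ ^ 2 * P.dt))⁻¹ * P.jumpMass ^ ℓ) := by
        gcongr
        exact ((P.condDensity_bounds ℓ).2 (-z)).2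
    _ = _ := by rw [mul_pow (P.lam * P.dt)]; ring

theorem continuous_densityTerm (ℓ : ℕ) : Continuous (P.densityTerm ℓ) := by
  unfold densityTerm
  exact continuous_const.mul ((P.condDensity_bounds ℓ).1.comp continuous_neg)

theorem summable_densityTerm (z : ℝ) : Summable fun ℓ => P.densityTerm ℓ z :=
  P.summable_termBound.of_nonneg_of_le (fun ℓ => P.densityTerm_nonneg ℓ z)
    fun ℓ => P.densityTerm_le ℓ z

/-- A uniform bound of the density and of its partial sums. -/
noncomputable def densityBound : ℝ := ∑' ℓ, P.termBound ℓ

theorem densityTrunc_nonneg (N : ℕ) (z : ℝ) : 0 ≤ P.densityTrunc N z :=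
  Finset.sum_nonneg fun ℓ _ => P.densityTerm_nonneg ℓ z

theorem density_nonneg (z : ℝ) : 0 ≤ P.density z := tsum_nonneg fun ℓ => P.densityTerm_nonneg ℓ z

theorem density_le (z : ℝ) : P.density z ≤ P.densityBound :=
  (P.summable_densityTerm z).tsum_le_tsum (fun ℓ => P.densityTerm_le ℓ z) P.summable_termBound

theorem densityTrunc_le (N : ℕ) (z : ℝ) : P.densityTrunc N z ≤ P.densityBound :=
  ((P.summable_densityTerm z).sum_le_tsum _ fun ℓ _ => P.densityTerm_nonneg ℓ z).trans
    (P.density_le z)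

theorem densityBound_nonneg : 0 ≤ P.densityBound := (P.density_nonneg 0).trans (P.density_le 0)

theorem continuous_density : Continuous P.density :=
  continuous_tsum P.continuous_densityTerm P.summable_termBound fun ℓ z => by
    rw [Real.norm_eq_abs, abs_of_nonneg (P.densityTerm_nonneg ℓ z)]; exact P.densityTerm_le ℓ z

theorem tendstoUniformly_densityTrunc :
    TendstoUniformly P.densityTrunc P.density atTop := by
  have := tendstoUniformly_tsum_nat P.summable_termBound (f := P.densityTerm) fun ℓ z => by
    rw [Real.norm_eq_abs, abs_of_nonneg (P.densityTerm_nonneg ℓ z)]; exact P.densityTerm_le ℓ z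
  intro u hu
  exact (tendsto_add_atTop_nat 1).eventually (this u hu)

/-- The truncated density is close to the density at a nearby point. -/
theorem densityTrunc_close (K : ℝ) {ε : ℝ} (hε : 0 < ε) : ∃ ρ > 0, ∃ N₀, ∀ N ≥ N₀, ∀ z z',
    |z| ≤ K → |z'| ≤ K → |z - z'| ≤ ρ → |P.densityTrunc N z - P.density z'| ≤ ε := by
  have hu := (isCompact_Icc (a := -K) (b := K)).uniformContinuousOn_of_continuous
    P.continuous_density.continuousOn
  rw [Metric.uniformContinuousOn_iff_le] at hu
  obtain ⟨ρ, hρ, h1⟩ := hu (ε / 2) (by positivity)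
  have h2 := Metric.tendstoUniformly_iff.1 P.tendstoUniformly_densityTrunc (ε / 2) (by positivity)
  obtain ⟨N₀, hN₀⟩ := eventually_atTop.1 h2
  refine ⟨ρ, hρ, N₀, fun N hN z z' hz hz' hzz => ?_⟩
  have h3 := h1 z (abs_le.1 hz) z' (abs_le.1 hz') hzz
  have h4 := hN₀ N hN z
  rw [Real.dist_eq] at h3 h4
  rw [abs_sub_comm] at h4
  linarith [abs_sub_le (P.densityTrunc N z) (P.density z) (P.density z')]

end Market
end MeanRisk

/-! ### Interpolation, continuation outside the domain, and the discrete step. -/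

namespace MeanRisk

namespace IsPartition

variable {lo hi : ℝ} {N : ℕ} {x : ℕ → ℝ}

theorem le_of_le (h : IsPartition lo hi N x) {i j : ℕ} (hij : i ≤ j) (hj : j ≤ N) : x i ≤ x j := by
  induction j, hij using Nat.le_induction with
  | base => exact le_rfl
  | succ j hij ih => exact (ih (by omega)).trans (h.lt j (by omega)).le

theorem mem_Icc (h : IsPartition lo hi N x) {i : ℕ} (hi' : i ≤ N) : x i ∈ Set.Icc lo hi :=
  ⟨h.first ▸ h.le_of_le (Nat.zero_le i) hi', h.last ▸ h.le_of_le hi' le_rfl⟩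

theorem exists_cell (h : IsPartition lo hi N x) {t : ℝ} (h1 : lo ≤ t) (h2 : t ≤ hi) :
    ∃ i < N, x i ≤ t ∧ t ≤ x (i + 1) := by
  classical
  -- The least such index gives the cell: by minimality, `t` lies beyond the right end of the
  -- preceding cell.
  have hex : ∃ i, i < N ∧ t ≤ x (i + 1) := ⟨N - 1, by
    have := h.pos; omega, by
    rw [Nat.sub_add_cancel h.pos, h.last]; exact h2⟩
  obtain ⟨hk, hk'⟩ := Nat.find_spec hex
  refine ⟨Nat.find hex, hk, ?_, hk'⟩
  rcases Nat.eq_zero_or_pos (Nat.find hex) with h0 | h0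
  · rw [h0, h.first]; exact h1
  · have := Nat.find_min hex (m := Nat.find hex - 1) (by omega)
    rw [not_and, Nat.sub_add_cancel h0] at this
    exact (not_le.1 (this (by omega))).le

theorem interp_eq (h : IsPartition lo hi N x) (v : ℕ → ℝ) {t : ℝ} {i : ℕ} (hi' : i < N)
    (h1 : x i ≤ t) (h2 : t ≤ x (i + 1)) :
    interp N x v t = v i + (v (i + 1) - v i) * ((t - x i) / (x (i + 1) - x i)) := by
  -- Cells left of the `i`-th telescope, the `i`-th contributes its proportional part, and later
  -- ones contribute zero.
  have hsum : ∀ j ≤ N, ∑ k ∈ Finset.range j,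
      (v (k + 1) - v k) * max 0 (min 1 ((t - x k) / (x (k + 1) - x k))) =
      if j ≤ i then v j - v 0 else v i - v 0 +
        (v (i + 1) - v i) * ((t - x i) / (x (i + 1) - x i)) := by
    intro j
    induction j with
    | zero => simp
    | succ j ih =>
      intro hj
      rw [Finset.sum_range_succ, ih (by omega)]
      have hd : 0 < x (j + 1) - x j := sub_pos.2 (h.lt j (by omega))
      rcases lt_trichotomy j i with hji | rfl | hji
      · have h3 : x (j + 1) ≤ t := (h.le_of_le (by omega) (by omega)).trans h1
        have h4 : 1 ≤ (t - x j) / (x (j + 1) - x j) := by rw [le_div_iff₀ hd]; linarith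
        rw [if_pos (by omega), if_pos (by omega), min_eq_left h4, max_eq_right zero_le_one]
        ring
      · have h3 : 0 ≤ (t - x j) / (x (j + 1) - x j) := div_nonneg (by linarith) hd.le
        have h4 : (t - x j) / (x (j + 1) - x j) ≤ 1 := by rw [div_le_one hd]; linarith
        rw [if_pos le_rfl, if_neg (by omega), min_eq_right h4, max_eq_right h3]
      · have h3 : t ≤ x j := h2.trans (h.le_of_le (by omega) (by omega))
        have h4 : (t - x j) / (x (j + 1) - x j) ≤ 0 := by
          rw [div_le_iff₀ hd]; linarith
        rw [if_neg (by omega), if_neg (by omega), max_eq_left ((min_le_right _ _).trans h4)]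
        ring
  unfold interp
  rw [hsum N le_rfl, if_neg (by omega)]
  ring

/-- A convex combination is at most the larger of its two values. Interpolation is thus replaced by
one nearby node, which requires no continuity of the node values. -/
theorem exists_interp_le (h : IsPartition lo hi N x) (v : ℕ → ℝ) {t η : ℝ} (h1 : lo ≤ t)
    (h2 : t ≤ hi) (hη : ∀ i < N, x (i + 1) - x i ≤ η) :
    ∃ i ≤ N, |x i - t| ≤ η ∧ interp N x v t ≤ v i := by
  obtain ⟨i, hi', h3, h4⟩ := h.exists_cell h1 h2
  have hd : 0 < x (i + 1) - x i := sub_pos.2 (h.lt i hi')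
  have h5 : 0 ≤ (t - x i) / (x (i + 1) - x i) := div_nonneg (by linarith) hd.le
  have h6 : (t - x i) / (x (i + 1) - x i) ≤ 1 := by rw [div_le_one hd]; linarith
  rw [h.interp_eq v hi' h3 h4]
  have := hη i hi'
  rcases le_total (v i) (v (i + 1)) with h7 | h7
  · exact ⟨i + 1, hi', by rw [abs_le]; constructor <;> linarith, by nlinarith⟩
  · exact ⟨i, hi'.le, by rw [abs_le]; constructor <;> linarith, by nlinarith⟩

theorem interp_neg (N : ℕ) (x v : ℕ → ℝ) (t : ℝ) :
    interp N x (fun i => -v i) t = -interp N x v t := by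
  unfold interp
  rw [neg_add, ← Finset.sum_neg_distrib]
  congr 1
  exact Finset.sum_congr rfl fun i _ => by ring

theorem exists_le_interp (h : IsPartition lo hi N x) (v : ℕ → ℝ) {t η : ℝ} (h1 : lo ≤ t)
    (h2 : t ≤ hi) (hη : ∀ i < N, x (i + 1) - x i ≤ η) :
    ∃ i ≤ N, |x i - t| ≤ η ∧ v i ≤ interp N x v t := by
  obtain ⟨i, hi, h3, h4⟩ := h.exists_interp_le (fun i => -v i) h1 h2 hη
  rw [interp_neg] at h4
  exact ⟨i, hi, h3, by linarith⟩

/-- With `K = 1` this gives stability of interpolation, with `K = 0` a bound. -/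
theorem interp_mono (h : IsPartition lo hi N x) {v v' : ℕ → ℝ} {t K C : ℝ} (h1 : lo ≤ t)
    (h2 : t ≤ hi) (hv : ∀ i ≤ N, v i ≤ K * v' i + C) :
    interp N x v t ≤ K * interp N x v' t + C := by
  obtain ⟨i, hi', h3, h4⟩ := h.exists_cell h1 h2
  have hd : 0 < x (i + 1) - x i := sub_pos.2 (h.lt i hi')
  have h5 : 0 ≤ (t - x i) / (x (i + 1) - x i) := div_nonneg (by linarith) hd.le
  have h6 : (t - x i) / (x (i + 1) - x i) ≤ 1 := by rw [div_le_one hd]; linarith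
  rw [h.interp_eq v hi' h3 h4, h.interp_eq v' hi' h3 h4]
  have := mul_le_mul_of_nonneg_right (hv (i + 1) hi') h5
  have := mul_le_mul_of_nonneg_right (hv i hi'.le) (sub_nonneg.2 h6)
  linarith

theorem exists_floor (h : IsPartition lo hi N x) {t η : ℝ} (h1 : lo ≤ t)
    (h2 : t ≤ hi) (hη : ∀ i < N, x (i + 1) - x i ≤ η) : ∃ i ≤ N, x i ≤ t ∧ t ≤ x i + η := by
  obtain ⟨i, hi', h3, h4⟩ := h.exists_cell h1 h2
  exact ⟨i, hi'.le, h3, by linarith [hη i hi']⟩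

theorem exists_ceil (h : IsPartition lo hi N x) {t η : ℝ} (h1 : lo ≤ t)
    (h2 : t ≤ hi) (hη : ∀ i < N, x (i + 1) - x i ≤ η) : ∃ i ≤ N, t ≤ x i ∧ x i ≤ t + η := by
  obtain ⟨i, hi', h3, h4⟩ := h.exists_cell h1 h2
  exact ⟨i + 1, hi', h4, by linarith [hη i hi']⟩

end IsPartition

namespace Domain

variable (L : Domain)

/-- Linear continuation is an amplification factor times the value at the clamped argument; this
form has no case distinction. -/
theorem extB_eq (F : ℝ → ℝ) (b : ℝ) :
    L.extB F b = max 1 (b / L.bmax) * F (min b L.bmax) := by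
  have := L.bmax_pos
  unfold extB
  split_ifs with h
  · rw [min_eq_left h, max_eq_left ((div_le_one this).2 h), one_mul]
  · rw [min_eq_right (not_le.1 h).le, max_eq_right ((one_le_div this).2 (not_le.1 h).le)]

theorem extS_eq (F : ℝ → ℝ) (s : ℝ) : L.extS F s = max 1 (s / Real.exp L.ymaxD) *
    F (Real.log (max (Real.exp L.yminD) (min s (Real.exp L.ymaxD)))) := by
  have h01 : Real.exp L.yminD ≤ Real.exp L.ymaxD :=
    Real.exp_le_exp.2 (L.yminD_lt.trans (L.ymin_lt.trans L.ymax_lt)).le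
  have hp := Real.exp_pos L.ymaxD
  unfold extS
  split_ifs with h h'
  · rw [max_eq_left ((min_le_left _ _).trans h), Real.log_exp,
      max_eq_left ((div_le_one hp).2 (h.trans h01)), one_mul]
  · rw [min_eq_left h', max_eq_right (not_le.1 h).le, max_eq_left ((div_le_one hp).2 h'), one_mul]
  · rw [min_eq_right (not_le.1 h').le, max_eq_right h01, Real.log_exp,
      max_eq_right ((one_le_div hp).2 (not_le.1 h').le)]

end Domain

/-- The constants of a backward step with cashflow `q`. -/
noncomputable def frame (P : Market) (L : Domain) (q : ℝ) (hq : 0 ≤ q) : Frame where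
  a₀ := Real.exp L.yminD
  a₁ := Real.exp L.ymin
  a₂ := Real.exp L.ymax
  a₃ := Real.exp L.ymaxD
  bm := L.bmax
  E := Real.exp (P.r * P.dt)
  c := Real.exp (P.μ * P.dt)
  q := q
  a₀_pos := Real.exp_pos _
  lt₁ := Real.exp_lt_exp.2 L.yminD_lt
  lt₂ := Real.exp_lt_exp.2 L.ymin_lt
  lt₃ := Real.exp_lt_exp.2 L.ymax_lt
  bm_pos := L.bmax_pos
  E_pos := Real.exp_pos _
  c_pos := Real.exp_pos _
  q_nonneg := hq

section
variable (P : Market) (L : Domain) {q : ℝ} (hq : 0 ≤ q)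

theorem atAmounts_eq (F : ℝ → ℝ → ℝ) (s b : ℝ) : L.atAmounts F s b =
    (frame P L q hq).amp s b * F (Real.log ((frame P L q hq).clampS s)) (min b L.bmax) := by
  unfold Domain.atAmounts
  rw [L.extB_eq, L.extS_eq, ← mul_assoc]
  rfl

theorem settle_eq (F : ℝ → ℝ → ℝ) (y b : ℝ) : settle P L F y b =
    (frame P L q hq).kap b * F y (min (b * Real.exp (P.r * P.dt)) L.bmax) := by
  unfold settle
  rw [L.extB_eq]
  rfl

theorem log_clampS_mem (s : ℝ) : L.yminD ≤ Real.log ((frame P L q hq).clampS s) ∧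
    Real.log ((frame P L q hq).clampS s) ≤ L.ymaxD := by
  have h1 := (frame P L q hq).clampS_ge s
  have h2 := (frame P L q hq).clampS_le s
  have h3 : 0 < (frame P L q hq).clampS s := (Frame.a₀_pos _).trans_le h1
  exact ⟨(Real.le_log_iff_exp_le h3).2 h1, (Real.log_le_iff_le_exp h3).2 h2⟩

end

/-- The node values of a function of the wealth after the next cashflow, after time advancement
in the scheme. -/
def gridNode {L : Domain} {Wmin Wmax : ℝ} (G : Grid L Wmin Wmax) (a : ℕ → ℕ → ℝ) (Y b v : ℝ) :
    Prop :=
  ∃ n ≤ G.Ny, ∃ j ≤ G.Nb, Y = Real.exp (G.y n) ∧ b = G.b j ∧ v = a n j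

/-- The set of control nodes. -/
def gridControls {L : Domain} {Wmin Wmax : ℝ} (G : Grid L Wmin Wmax) : Set ℝ :=
  {u | ∃ i ≤ G.Nu, u = G.u i}

namespace Grid

variable {L : Domain} {Wmin Wmax : ℝ} (G : Grid L Wmin Wmax)

theorem dy_pos : 0 < G.dy :=
  div_pos (by linarith [L.yminD_lt, L.ymin_lt, L.ymax_lt]) (by exact_mod_cast G.Ny_pos)

theorem Ny_mul_dy : G.Ny * G.dy = L.ymaxD - L.yminD := by
  have : (G.Ny : ℝ) ≠ 0 := by exact_mod_cast G.Ny_pos.ne'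
  unfold dy; field_simp

theorem y_part : IsPartition L.yminD L.ymaxD G.Ny G.y where
  pos := G.Ny_pos
  first := by simp [y]
  last := by rw [y, G.Ny_mul_dy]; ring
  lt i _ := by unfold y; push_cast; linarith [G.dy_pos]

theorem y_succ_sub (i : ℕ) : G.y (i + 1) - G.y i = G.dy := by unfold y; push_cast; ring

/-- All meshes except those of the thresholds are at most `η`. -/
structure MeshLE (η : ℝ) : Prop where
  y : G.dy ≤ η
  b : ∀ i < G.Nb, G.b (i + 1) - G.b i ≤ η
  u : ∀ i < G.Nu, G.u (i + 1) - G.u i ≤ η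

/-- Discrete rebalancing with a maximization. -/
noncomputable def supRebalance (v : ℕ → ℕ → ℝ) (w : ℝ) : ℝ :=
  ⨆ i : Fin (G.Nu + 1), L.atAmounts (G.interp₂ v) (G.u i * w) ((1 - G.u i) * w)

variable (P : Market)

theorem settleH_eq {q : ℝ} (hq : 0 ≤ q) (v : ℕ → ℕ → ℝ) (n j : ℕ) : G.settleH P v n j =
    (frame P L q hq).kap (G.b j) *
      interp G.Nb G.b (v n) (min (G.b j * Real.exp (P.r * P.dt)) L.bmax) := by
  unfold settleH
  rw [L.extB_eq]
  rfl

theorem exists_interp₂_le (v : ℕ → ℕ → ℝ) {y b η : ℝ} (hη : G.MeshLE η)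
    (hy : L.yminD ≤ y ∧ y ≤ L.ymaxD) (hb : 0 ≤ b ∧ b ≤ L.bmax) :
    ∃ n ≤ G.Ny, ∃ j ≤ G.Nb, |G.y n - y| ≤ η ∧ |G.b j - b| ≤ η ∧ G.interp₂ v y b ≤ v n j := by
  obtain ⟨j, hj, h1, h2⟩ := G.b_part.exists_interp_le
    (fun j => interp G.Ny G.y (fun n => v n j) y) hb.1 hb.2 hη.b
  obtain ⟨n, hn, h3, h4⟩ := G.y_part.exists_interp_le (fun n => v n j) hy.1 hy.2
    fun i _ => (G.y_succ_sub i).trans_le hη.y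
  exact ⟨n, hn, j, hj, h3, h1, h2.trans h4⟩

theorem exists_le_interp₂ (v : ℕ → ℕ → ℝ) {y b η : ℝ} (hη : G.MeshLE η)
    (hy : L.yminD ≤ y ∧ y ≤ L.ymaxD) (hb : 0 ≤ b ∧ b ≤ L.bmax) :
    ∃ n ≤ G.Ny, ∃ j ≤ G.Nb, |G.y n - y| ≤ η ∧ |G.b j - b| ≤ η ∧ v n j ≤ G.interp₂ v y b := by
  obtain ⟨j, hj, h1, h2⟩ := G.b_part.exists_le_interp
    (fun j => interp G.Ny G.y (fun n => v n j) y) hb.1 hb.2 hη.b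
  obtain ⟨n, hn, h3, h4⟩ := G.y_part.exists_le_interp (fun n => v n j) hy.1 hy.2
    fun i _ => (G.y_succ_sub i).trans_le hη.y
  exact ⟨n, hn, j, hj, h3, h1, h4.trans h2⟩

theorem abs_exp_sub_le {y y' K η : ℝ} (hy : y ≤ K) (hy' : y' ≤ K) (h : |y - y'| ≤ η) :
    |Real.exp y - Real.exp y'| ≤ Real.exp K * η := by
  wlog hyy : y' ≤ y generalizing y y'
  · rw [abs_sub_comm]
    exact this hy' hy (by rwa [abs_sub_comm]) (not_le.1 hyy).le
  rw [abs_of_nonneg (sub_nonneg.2 hyy)] at h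
  rw [abs_of_nonneg (sub_nonneg.2 (Real.exp_le_exp.2 hyy))]
  have h1 : Real.exp y' = Real.exp y * Real.exp (y' - y) := by rw [← Real.exp_add]; ring_nf
  have h2 := Real.add_one_le_exp (y' - y)
  have h3 := Real.exp_pos y
  have h4 : Real.exp y - Real.exp y' ≤ Real.exp y * (y - y') := by nlinarith
  exact h4.trans (mul_le_mul (Real.exp_le_exp.2 hy) h (sub_nonneg.2 hyy) (Real.exp_pos _).le)

/-- The discrete backward step is a step in the abstract sense. -/
theorem step {q η η' : ℝ} (hq : 0 ≤ q) (hη : G.MeshLE η') (h1 : η' ≤ η)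
    (h2 : Real.exp L.ymaxD * η' ≤ η) (R : ℝ → ℝ) {V : ℕ → ℕ → ℝ}
    (hV : ∀ n j, V n j = R (Real.exp (G.y n) + G.b j + q)) :
    (frame P L q hq).Step η R (gridNode G (G.advanceH P (G.settleH P V))) (gridControls G)
      (G.supRebalance (G.advanceH P (G.settleH P V))) := by
  set F := frame P L q hq
  set a := G.advanceH P (G.settleH P V)
  have hbm := L.bmax_pos
  -- The mesh in log-price becomes a mesh in the risky amount, with Lipschitz constant `exp ymaxD`.
  have hexp : ∀ n ≤ G.Ny, ∀ s, |G.y n - Real.log (F.clampS s)| ≤ η' →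
      |Real.exp (G.y n) - F.clampS s| ≤ η := by
    intro n hn s hs
    have h3 : 0 < F.clampS s := F.a₀_pos.trans_le (F.clampS_ge s)
    have := abs_exp_sub_le (G.y_part.mem_Icc hn).2 (log_clampS_mem P L hq s).2 hs
    rw [Real.exp_log h3] at this
    exact this.trans h2
  have hbmem : ∀ w u : ℝ, 0 ≤ w → u ≤ 1 → 0 ≤ min ((1 - u) * w) L.bmax ∧
      min ((1 - u) * w) L.bmax ≤ L.bmax := fun w u hw hu =>
    ⟨le_min (mul_nonneg (by linarith) hw) hbm.le, min_le_right _ _⟩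
  have hset : ∀ j ≤ G.Nb, 0 ≤ min (G.b j * F.E) F.bm ∧ min (G.b j * F.E) F.bm ≤ F.bm :=
    fun j hj => ⟨le_min (mul_nonneg (G.b_part.mem_Icc hj).1 F.E_pos.le) hbm.le, min_le_right _ _⟩
  have hlay : ∀ n j, (Real.exp (G.y n) ≤ F.a₁ ∨ F.a₂ ≤ Real.exp (G.y n)) →
      a n j = F.lay (Real.exp (G.y n)) * G.settleH P V n j := by
    intro n j h
    have h3 : Real.exp (G.y n) ≤ F.a₁ ↔ G.y n ≤ L.ymin := Real.exp_le_exp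
    have h4 : F.a₂ ≤ Real.exp (G.y n) ↔ L.ymax ≤ G.y n := Real.exp_le_exp
    simp only [a, advanceH, Frame.lay, h3]
    rw [h3, h4] at h
    split_ifs with h5 h6
    · rw [one_mul]
    · rcases h with h | h
      · exact absurd h h5
      · exact absurd h6 (not_lt.2 h)
    · rfl
  refine ⟨?_, ?_, ?_, ?_, ?_, ?_, ?_, ?_⟩
  · rintro Y b v ⟨n, hn, j, hj, rfl, rfl, -⟩
    have h3 := G.y_part.mem_Icc hn
    have h4 := G.b_part.mem_Icc hj
    exact ⟨Real.exp_le_exp.2 h3.1, Real.exp_le_exp.2 h3.2, h4.1, h4.2⟩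
  · intro w hw ε hε
    obtain ⟨i, hi⟩ := exists_eq_ciSup_of_finite
      (f := fun i : Fin (G.Nu + 1) => L.atAmounts (G.interp₂ a) (G.u i * w) ((1 - G.u i) * w))
    have hu := G.u_part.mem_Icc (Nat.lt_succ_iff.1 i.2)
    obtain ⟨n, hn, j, hj, h3, h4, h5⟩ := G.exists_interp₂_le a hη
      (log_clampS_mem P L hq (G.u i * w)) (hbmem w _ hw hu.2)
    refine ⟨G.u i, ⟨i, Nat.lt_succ_iff.1 i.2, rfl⟩, _, _, _, ⟨n, hn, j, hj, rfl, rfl, rfl⟩,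
      hexp n hn _ h3, h4.trans h1, ?_⟩
    have : G.supRebalance a w = L.atAmounts (G.interp₂ a) (G.u i * w) ((1 - G.u i) * w) := hi.symm
    rw [this, atAmounts_eq P L hq]
    have := mul_le_mul_of_nonneg_left h5 (F.amp_nonneg (G.u i * w) ((1 - G.u i) * w))
    linarith
  · rintro w hw u ⟨i, hi, rfl⟩
    have hu := G.u_part.mem_Icc hi
    obtain ⟨n, hn, j, hj, h3, h4, h5⟩ := G.exists_le_interp₂ a hη
      (log_clampS_mem P L hq (G.u i * w)) (hbmem w _ hw hu.2)
    refine ⟨_, _, _, ⟨n, hn, j, hj, rfl, rfl, rfl⟩, hexp n hn _ h3, h4.trans h1, ?_⟩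
    have := le_ciSup (Set.finite_range (fun i : Fin (G.Nu + 1) =>
      L.atAmounts (G.interp₂ a) (G.u i * w) ((1 - G.u i) * w))).bddAbove ⟨i, Nat.lt_succ_iff.2 hi⟩
    refine le_trans ?_ this
    dsimp only
    rw [atAmounts_eq P L hq]
    exact mul_le_mul_of_nonneg_left h5 (F.amp_nonneg _ _)
  · rintro Y b v ⟨n, hn, j, hj, rfl, rfl, rfl⟩ hY
    obtain ⟨k, hk, h3, h4⟩ := G.b_part.exists_interp_le (V n) (hset j hj).1 (hset j hj).2 hη.b
    have h5 := G.b_part.mem_Icc hk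
    refine ⟨G.b k, h5.1, h5.2, h3.trans h1, ?_⟩
    rw [hV] at h4
    rw [hlay n j hY, G.settleH_eq P hq]
    exact mul_le_mul_of_nonneg_left (mul_le_mul_of_nonneg_left h4 (F.kap_nonneg _))
      (F.lay_nonneg _)
  · rintro Y b v ⟨n, hn, j, hj, rfl, rfl, rfl⟩ hY
    obtain ⟨k, hk, h3, h4⟩ := G.b_part.exists_le_interp (V n) (hset j hj).1 (hset j hj).2 hη.b
    have h5 := G.b_part.mem_Icc hk
    refine ⟨G.b k, h5.1, h5.2, h3.trans h1, ?_⟩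
    rw [hV] at h4
    rw [hlay n j hY, G.settleH_eq P hq]
    exact mul_le_mul_of_nonneg_left (mul_le_mul_of_nonneg_left h4 (F.kap_nonneg _))
      (F.lay_nonneg _)
  · rintro u ⟨i, hi, rfl⟩
    exact G.u_part.mem_Icc hi
  · intro t h3 h4
    obtain ⟨i, hi, h5, h6⟩ := G.u_part.exists_floor h3 h4 hη.u
    exact ⟨_, ⟨i, hi, rfl⟩, h5, h6.trans (by linarith)⟩
  · intro t h3 h4
    obtain ⟨i, hi, h5, h6⟩ := G.u_part.exists_ceil h3 h4 hη.u
    exact ⟨_, ⟨i, hi, rfl⟩, h5, h6.trans (by linarith)⟩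

end Grid
end MeanRisk

/-! ### Measurability, and the trapezoidal rule for discontinuous integrands. -/

namespace MeanRisk

open MeasureTheory

/-- A function that is lower semicontinuous from the right is measurable. -/
theorem measurable_of_right_lsc {f : ℝ → ℝ}
    (h : ∀ x a, a < f x → ∃ y > x, ∀ z ∈ Set.Ioo x y, a < f z) : Measurable f := by
  refine measurable_of_Ioi fun a => ?_
  set S := f ⁻¹' Set.Ioi a
  choose! g hg hg' using fun x => h x a
  set O := ⋃ x ∈ S, Set.Ioo x (g x)
  have hO : IsOpen O := isOpen_biUnion fun x _ => isOpen_Ioo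
  have hOS : O ⊆ S := Set.iUnion₂_subset fun x hx z hz => hg' x hx z hz
  -- A point of `S` outside `O` lies in none of the intervals, so the intervals attached to two such
  -- points are disjoint, and there are only countably many.
  have hc : (S \ O).Countable := by
    refine Set.PairwiseDisjoint.countable_of_Ioo (y := g) ?_ fun x hx => hg x hx.1
    have key : ∀ x ∈ S \ O, ∀ y ∈ S \ O, x < y → g x ≤ y := by
      intro x hx y hy hxy
      by_contra hlt
      exact hy.2 (Set.mem_biUnion hx.1 ⟨hxy, not_le.1 hlt⟩)
    intro x hx y hy hxy
    rw [Function.onFun, Set.disjoint_left]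
    rintro z ⟨h1, h2⟩ ⟨h3, h4⟩
    rcases lt_or_gt_of_ne hxy with h5 | h5
    · linarith [key x hx y hy h5]
    · linarith [key y hy x hx h5]
  rw [← Set.union_sdiff_cancel hOS]
  exact hO.measurableSet.union hc.measurableSet

namespace Grid

variable {L : Domain} {Wmin Wmax : ℝ} (G : Grid L Wmin Wmax)

/-- Grouping by cells instead of nodes splits every interior weight into two halves. -/
theorem sum_weight (a : ℕ → ℝ) : ∑ l ∈ Finset.range (G.Ny + 1), G.weight l * a l =
    ∑ i ∈ Finset.range G.Ny, G.dy * ((a i + a (i + 1)) / 2) := by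
  obtain ⟨N, hN⟩ : ∃ N, G.Ny = N + 1 := ⟨G.Ny - 1, by have := G.Ny_pos; omega⟩
  have hw : ∀ l ∈ Finset.range N, G.weight (l + 1) * a (l + 1) = G.dy * a (l + 1) := by
    intro l hl
    have := Finset.mem_range.1 hl
    rw [weight, if_neg (by omega)]
  rw [Finset.sum_range_succ', hN, Finset.sum_range_succ, Finset.sum_congr rfl hw]
  have e1 : G.weight 0 = G.dy / 2 := by simp [weight]
  have e2 : G.weight (N + 1) = G.dy / 2 := by simp [weight, hN]
  rw [e1, e2, ← Finset.mul_sum, ← Finset.mul_sum, ← Finset.sum_div, Finset.sum_add_distrib,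
    Finset.sum_range_succ' a, Finset.sum_range_succ (fun i => a (i + 1))]
  ring

/-- The trapezoidal sum is bounded by the integral of a function that dominates the node values in
the adjacent cells. -/
theorem sum_weight_le {a : ℕ → ℝ} {ψ : ℝ → ℝ} {e : ℝ}
    (hψ : IntervalIntegrable ψ volume L.yminD L.ymaxD)
    (h : ∀ i < G.Ny, ∀ t, G.y i ≤ t → t ≤ G.y (i + 1) → a i ≤ ψ t + e ∧ a (i + 1) ≤ ψ t + e) :
    ∑ l ∈ Finset.range (G.Ny + 1), G.weight l * a l ≤
      (∫ t in L.yminD..L.ymaxD, ψ t) + e * (L.ymaxD - L.yminD) := by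
  have hle : L.yminD ≤ L.ymaxD := (L.yminD_lt.trans (L.ymin_lt.trans L.ymax_lt)).le
  have hψe : IntervalIntegrable (fun t => ψ t + e) volume L.yminD L.ymaxD :=
    hψ.add intervalIntegrable_const
  have hcell : ∀ i < G.Ny, IntervalIntegrable (fun t => ψ t + e) volume (G.y i) (G.y (i + 1)) := by
    intro i hi
    have h1 := G.y_part.mem_Icc hi.le
    have h2 := G.y_part.mem_Icc (Nat.succ_le_of_lt hi)
    refine hψe.mono_set ?_
    rw [Set.uIcc_of_le (h1.1.trans h1.2), Set.uIcc_of_le (G.y_part.lt i hi).le]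
    exact Set.Icc_subset_Icc h1.1 h2.2
  have hint : (∫ t in L.yminD..L.ymaxD, ψ t) + e * (L.ymaxD - L.yminD) =
      ∑ i ∈ Finset.range G.Ny, ∫ t in G.y i..G.y (i + 1), (ψ t + e) := by
    rw [intervalIntegral.sum_integral_adjacent_intervals hcell, G.y_part.first, G.y_part.last,
      intervalIntegral.integral_add hψ intervalIntegrable_const,
      intervalIntegral.integral_const, smul_eq_mul, mul_comm e]
  rw [hint, G.sum_weight]
  refine Finset.sum_le_sum fun i hi => ?_
  have hi := Finset.mem_range.1 hi
  have hlt := G.y_part.lt i hi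
  calc G.dy * ((a i + a (i + 1)) / 2) = ∫ _ in G.y i..G.y (i + 1), (a i + a (i + 1)) / 2 := by
        rw [intervalIntegral.integral_const, smul_eq_mul, G.y_succ_sub]
    _ ≤ _ := by
        refine intervalIntegral.integral_mono_on hlt.le intervalIntegrable_const (hcell i hi)
          fun t ht => ?_
        have := h i hi t ht.1 ht.2
        linarith [this.1, this.2]

/-- One-sided comparison of the discrete convolution with the exact one. -/
theorem convolution_le (P : Market) {φ : ℝ → ℝ} {v : ℕ → ℝ} {C e e' τ y z : ℝ} {Ng : ℕ}
    (hτ : |τ| ≤ 1) (hφ : IntervalIntegrable φ volume (L.yminD - 1) (L.ymaxD + 1))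
    (hφC : ∀ t, L.yminD - 1 ≤ t → t ≤ L.ymaxD + 1 → |φ t| ≤ C) (he : 0 ≤ e)
    (hv : ∀ i < G.Ny, ∀ t, G.y i ≤ t → t ≤ G.y (i + 1) →
      v i ≤ φ (t + τ) + e ∧ v (i + 1) ≤ φ (t + τ) + e)
    (hg : ∀ i < G.Ny, ∀ t, G.y i ≤ t → t ≤ G.y (i + 1) →
      |P.densityTrunc Ng (z - G.y i) - P.density (y - (t + τ))| ≤ e' ∧
      |P.densityTrunc Ng (z - G.y (i + 1)) - P.density (y - (t + τ))| ≤ e') :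
    ∑ l ∈ Finset.range (G.Ny + 1), G.weight l * (P.densityTrunc Ng (z - G.y l) * v l) ≤
      (∫ t in L.yminD..L.ymaxD, φ t * P.density (y - t)) +
        (e' * C + P.densityBound * e) * (L.ymaxD - L.yminD) + 2 * |τ| * (C * P.densityBound) := by
  obtain ⟨hτ1, hτ2⟩ := abs_le.1 hτ
  have hle : L.yminD ≤ L.ymaxD := (L.yminD_lt.trans (L.ymin_lt.trans L.ymax_lt)).le
  have hint : IntervalIntegrable (fun t => φ t * P.density (y - t)) volume (L.yminD - 1)
      (L.ymaxD + 1) :=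
    hφ.mul_continuousOn (P.continuous_density.comp (by fun_prop)).continuousOn
  have hsub : ∀ a b, L.yminD - 1 ≤ a → a ≤ L.ymaxD + 1 → L.yminD - 1 ≤ b → b ≤ L.ymaxD + 1 →
      IntervalIntegrable (fun t => φ t * P.density (y - t)) volume a b := by
    intro a b h1 h2 h3 h4
    refine hint.mono_set ?_
    rw [Set.uIcc_of_le (a := L.yminD - 1) (by linarith)]
    exact Set.uIcc_subset_Icc ⟨h1, h2⟩ ⟨h3, h4⟩
  have hshift : IntervalIntegrable (fun t => φ (t + τ) * P.density (y - (t + τ))) volume L.yminD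
      L.ymaxD := by
    have := (hsub (L.yminD + τ) (L.ymaxD + τ) (by linarith) (by linarith) (by linarith)
      (by linarith)).comp_add_right τ
    simpa using this
  refine (G.sum_weight_le (a := fun l => P.densityTrunc Ng (z - G.y l) * v l)
    (e := e' * C + P.densityBound * e) hshift ?_).trans ?_
  · intro i hi t h1 h2
    have h3 := G.y_part.mem_Icc hi.le
    have h4 := G.y_part.mem_Icc (Nat.succ_le_of_lt hi)
    have hC := hφC (t + τ) (by linarith [h3.1]) (by linarith [h4.2])
    obtain ⟨v1, v2⟩ := hv i hi t h1 h2
    obtain ⟨g1, g2⟩ := hg i hi t h1 h2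
    have q1 := Frame.mul_le_mul_add (P.densityTrunc_nonneg _ _) (P.densityTrunc_le _ _) g1 hC v1 he
    have q2 := Frame.mul_le_mul_add (P.densityTrunc_nonneg _ _) (P.densityTrunc_le _ _) g2 hC v2 he
    constructor <;> linarith
  -- The substitution moves the interval by `τ`. The two integrals differ by two end pieces of
  -- length `|τ|`, each bounded through the sup norms.
  · have hsh : ∫ t in L.yminD..L.ymaxD, φ (t + τ) * P.density (y - (t + τ)) =
        ∫ t in (L.yminD + τ)..(L.ymaxD + τ), φ t * P.density (y - t) :=
      intervalIntegral.integral_comp_add_right (fun t => φ t * P.density (y - t)) τ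
    have h1 := intervalIntegral.integral_interval_sub_interval_comm
      (hsub (L.yminD + τ) (L.ymaxD + τ) (by linarith) (by linarith) (by linarith) (by linarith))
      (hsub L.yminD L.ymaxD (by linarith) (by linarith) (by linarith) (by linarith))
      (hsub (L.yminD + τ) L.yminD (by linarith) (by linarith) (by linarith) (by linarith))
    have hb : ∀ a b, L.yminD - 1 ≤ a → a ≤ L.ymaxD + 1 → L.yminD - 1 ≤ b → b ≤ L.ymaxD + 1 →
        |∫ t in a..b, φ t * P.density (y - t)| ≤ C * P.densityBound * |b - a| := by
      intro a b h1 h2 h3 h4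
      rw [← Real.norm_eq_abs (∫ t in a..b, _)]
      refine intervalIntegral.norm_integral_le_of_norm_le_const fun t ht => ?_
      have ht := Set.uIcc_subset_Icc ⟨h1, h2⟩ ⟨h3, h4⟩ (Set.uIoc_subset_uIcc ht)
      rw [Real.norm_eq_abs, abs_mul, abs_of_nonneg (P.density_nonneg _)]
      exact mul_le_mul (hφC t ht.1 ht.2) (P.density_le _) (P.density_nonneg _)
        ((abs_nonneg _).trans (hφC t ht.1 ht.2))
    have h2 := hb (L.yminD + τ) L.yminD (by linarith) (by linarith) (by linarith) (by linarith)
    have h3 := hb (L.ymaxD + τ) L.ymaxD (by linarith) (by linarith) (by linarith) (by linarith)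
    rw [sub_add_cancel_left, abs_neg] at h2 h3
    rw [hsh]
    linarith [(abs_le.1 h2).2, (abs_le.1 h3).1]

end Grid

theorem abs_log_sub_le {a x y : ℝ} (ha : 0 < a) (hx : a ≤ x) (hy : a ≤ y) :
    |Real.log x - Real.log y| ≤ |x - y| / a := by
  wlog h : y ≤ x generalizing x y
  · rw [abs_sub_comm, abs_sub_comm x]
    exact this hy hx (not_le.1 h).le
  have hy0 : 0 < y := ha.trans_le hy
  have hx0 : 0 < x := ha.trans_le hx
  rw [abs_of_nonneg (sub_nonneg.2 (Real.log_le_log hy0 h)), abs_of_nonneg (sub_nonneg.2 h),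
    ← Real.log_div hx0.ne' hy0.ne']
  calc Real.log (x / y) ≤ x / y - 1 := Real.log_le_sub_one_of_pos (by positivity)
    _ = (x - y) / y := by field_simp
    _ ≤ (x - y) / a := by gcongr

end MeanRisk

/-! ### The exact backward step and its bounds. -/

namespace MeanRisk

open MeasureTheory

/-- Rebalancing with a maximization. -/
noncomputable def supRebalance (L : Domain) (F : ℝ → ℝ → ℝ) (w : ℝ) : ℝ :=
  ⨆ u : Set.Icc (0 : ℝ) 1, L.atAmounts F (u * w) ((1 - u) * w)

/-- `v` is the value at the node `(log Y, b)` of the domain of the function `a` of `(y, b)`. -/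
def domainNode (L : Domain) (a : ℝ → ℝ → ℝ) (Y b v : ℝ) : Prop :=
  Real.exp L.yminD ≤ Y ∧ Y ≤ Real.exp L.ymaxD ∧ 0 ≤ b ∧ b ≤ L.bmax ∧ v = a (Real.log Y) b

/-- The rebalanced value is squeezed, up to an arbitrary `ε`, between amplified node values. -/
theorem Frame.Step.abs_le {F : Frame} {η : ℝ} {R : ℝ → ℝ} {N : ℝ → ℝ → ℝ → Prop} {U : Set ℝ}
    {R' : ℝ → ℝ} (S : F.Step η R N U R') {Wb CA Cv : ℝ}
    (hCA : ∀ s b, s ≤ Wb → b ≤ Wb → F.amp s b ≤ CA)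
    (hN : ∀ Y b v, N Y b v → |v| ≤ Cv) {w : ℝ} (hw : 0 ≤ w) (hwW : w ≤ Wb) : |R' w| ≤ CA * Cv := by
  have key : ∀ u ∈ U, ∀ v, |v| ≤ Cv → |F.amp (u * w) ((1 - u) * w) * v| ≤ CA * Cv := by
    intro u hu v hv
    obtain ⟨h0, h1⟩ := S.sub u hu
    rw [abs_mul, abs_of_nonneg (F.amp_nonneg _ _)]
    have h2 : u * w ≤ w := mul_le_of_le_one_left hw h1
    have h3 : (1 - u) * w ≤ w := mul_le_of_le_one_left hw (by linarith)
    have h4 := hCA (u * w) ((1 - u) * w) (by linarith) (by linarith)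
    exact mul_le_mul h4 hv (abs_nonneg _) ((F.amp_nonneg _ _).trans h4)
  rw [_root_.abs_le]
  constructor
  · obtain ⟨u, hu, -⟩ := S.floor 0 le_rfl zero_le_one
    obtain ⟨Y, b, v, hv, -, -, h⟩ := S.near_ge w hw u hu
    linarith [(_root_.abs_le.1 (key u hu v (hN _ _ _ hv))).1]
  · refine le_of_forall_pos_le_add fun ε hε => ?_
    obtain ⟨u, hu, Y, b, v, hv, -, -, h⟩ := S.near_le w hw ε hε
    linarith [(_root_.abs_le.1 (key u hu v (hN _ _ _ hv))).2]

section
variable (P : Market) (L : Domain)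

theorem Domain.yminD_lt_ymaxD : L.yminD < L.ymaxD := L.yminD_lt.trans (L.ymin_lt.trans L.ymax_lt)

/-- A bound of the values after time advancement, per unit of the values before it. -/
noncomputable def advanceBound : ℝ :=
  max 1 (Real.exp (P.r * P.dt)) *
    (max 1 (Real.exp (P.μ * P.dt)) + 2 * P.densityBound * (L.ymaxD - L.yminD))

theorem advanceBound_pos : 0 < advanceBound P L := by
  have := P.densityBound_nonneg
  have := L.yminD_lt_ymaxD
  have : 0 ≤ L.ymaxD - L.yminD := by linarith
  unfold advanceBound
  positivity

variable {q : ℝ} (hq : 0 ≤ q)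

theorem min_mul_mem {b : ℝ} (hb : 0 ≤ b) : 0 ≤ min (b * Real.exp (P.r * P.dt)) L.bmax ∧
    min (b * Real.exp (P.r * P.dt)) L.bmax ≤ L.bmax :=
  ⟨le_min (by positivity) L.bmax_pos.le, min_le_right _ _⟩

theorem abs_settle_le {V : ℝ → ℝ → ℝ} {C : ℝ}
    (hV : ∀ y b, L.yminD ≤ y → y ≤ L.ymaxD → 0 ≤ b → b ≤ L.bmax → |V y b| ≤ C) {y b : ℝ}
    (hy : L.yminD ≤ y) (hy' : y ≤ L.ymaxD) (hb : 0 ≤ b) (hb' : b ≤ L.bmax) :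
    |settle P L V y b| ≤ max 1 (Real.exp (P.r * P.dt)) * C := by
  rw [settle_eq P L le_rfl, abs_mul, abs_of_nonneg ((frame P L 0 le_rfl).kap_nonneg _)]
  obtain ⟨h1, h2⟩ := min_mul_mem P L hb
  exact mul_le_mul ((frame P L 0 le_rfl).kap_le hb') (hV _ _ hy hy' h1 h2) (abs_nonneg _)
    (by positivity)

theorem abs_advance_le {V : ℝ → ℝ → ℝ} {C : ℝ}
    (hV : ∀ y b, L.yminD ≤ y → y ≤ L.ymaxD → 0 ≤ b → b ≤ L.bmax → |V y b| ≤ C) {y b : ℝ}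
    (hy : L.yminD ≤ y) (hy' : y ≤ L.ymaxD) (hb : 0 ≤ b) (hb' : b ≤ L.bmax) :
    |advance P L (settle P L V) y b| ≤ advanceBound P L * C := by
  have hS := fun y hy hy' => abs_settle_le P L hV (y := y) (b := b) hy hy' hb hb'
  have hC : 0 ≤ C := (abs_nonneg _).trans (hV y b hy hy' hb hb')
  have hB := P.densityBound_nonneg
  have hlen : 0 ≤ L.ymaxD - L.yminD := by linarith [L.yminD_lt_ymaxD]
  set K := max 1 (Real.exp (P.r * P.dt)) * C with hK
  have hK0 : 0 ≤ K := by positivity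
  have e : advanceBound P L * C = K * max 1 (Real.exp (P.μ * P.dt)) +
      2 * (K * P.densityBound * (L.ymaxD - L.yminD)) := by
    rw [advanceBound, hK]; ring
  have h3 : 0 ≤ K * P.densityBound * (L.ymaxD - L.yminD) := by positivity
  rw [e]
  unfold advance
  split_ifs
  · have := mul_le_mul_of_nonneg_left (le_max_left 1 (Real.exp (P.μ * P.dt))) hK0
    linarith [hS y hy hy']
  · rw [← Real.norm_eq_abs (∫ t in L.yminD..L.ymaxD, _)]
    have := intervalIntegral.norm_integral_le_of_norm_le_const (C := K * P.densityBound)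
      (f := fun t => settle P L V t b * P.density (y - t)) (a := L.yminD) (b := L.ymaxD)
      fun t ht => by
        rw [Set.uIoc_of_le (by linarith)] at ht
        rw [Real.norm_eq_abs, abs_mul, abs_of_nonneg (P.density_nonneg _)]
        exact mul_le_mul (hS t ht.1.le ht.2) (P.density_le _) (P.density_nonneg _) hK0
    rw [abs_of_nonneg hlen] at this
    have h4 : 0 ≤ K * max 1 (Real.exp (P.μ * P.dt)) := by positivity
    linarith
  · rw [abs_mul, abs_of_pos (Real.exp_pos _)]
    have := mul_le_mul (le_max_right 1 (Real.exp (P.μ * P.dt))) (hS y hy hy') (abs_nonneg _)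
      (by positivity)
    linarith

/-- The exact backward step is a step in the abstract sense. -/
theorem step_exact {R : ℝ → ℝ} {C : ℝ}
    (hR : ∀ x, 0 ≤ x → x ≤ Real.exp L.ymaxD + L.bmax + q → |R x| ≤ C) {η : ℝ} (hη : 0 ≤ η)
    {V : ℝ → ℝ → ℝ} (hV : ∀ y b, V y b = R (Real.exp y + b + q)) :
    (frame P L q hq).Step η R (domainNode L (advance P L (settle P L V))) (Set.Icc 0 1)
      (supRebalance L (advance P L (settle P L V))) := by
  set F := frame P L q hq
  set a := advance P L (settle P L V)
  have hbm := L.bmax_pos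
  have hVC : ∀ y b, L.yminD ≤ y → y ≤ L.ymaxD → 0 ≤ b → b ≤ L.bmax → |V y b| ≤ C := by
    intro y b h1 h2 h3 h4
    rw [hV]
    have := Real.exp_le_exp.2 h2
    exact hR _ (by positivity) (by linarith)
  have hnode : ∀ w u : ℝ, 0 ≤ w → u ≤ 1 → domainNode L a (F.clampS (u * w))
      (min ((1 - u) * w) F.bm) (a (Real.log (F.clampS (u * w))) (min ((1 - u) * w) L.bmax)) := by
    intro w u hw hu
    exact ⟨F.clampS_ge _, F.clampS_le _, le_min (mul_nonneg (by linarith) hw) hbm.le,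
      min_le_right _ _, rfl⟩
  have hbdd : ∀ w, 0 ≤ w →
      BddAbove (Set.range fun u : Set.Icc (0 : ℝ) 1 => L.atAmounts a (u * w) ((1 - u) * w)) := by
    intro w hw
    obtain ⟨CA, hCA, hamp⟩ := F.exists_amp_bound w
    refine ⟨CA * (advanceBound P L * C), ?_⟩
    rintro _ ⟨u, rfl⟩
    have h2 : u * w ≤ w := mul_le_of_le_one_left hw u.2.2
    have h3 : (1 - u) * w ≤ w := mul_le_of_le_one_left hw (by linarith [u.2.1])
    obtain ⟨h4, h5⟩ := log_clampS_mem P L hq (u * w)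
    obtain ⟨-, -, h6, h7, -⟩ := hnode w u hw u.2.2
    have h8 := abs_advance_le P L hVC h4 h5 h6 h7
    dsimp only
    rw [atAmounts_eq P L hq]
    exact (mul_le_mul_of_nonneg_left ((le_abs_self _).trans h8) (F.amp_nonneg _ _)).trans
      (mul_le_mul_of_nonneg_right (hamp _ _ _ _ h2 h3 h2 h3).1 ((abs_nonneg _).trans h8))
  have hlay : ∀ Y b v, domainNode L a Y b v → (Y ≤ F.a₁ ∨ F.a₂ ≤ Y) → ∃ β, 0 ≤ β ∧ β ≤ F.bm ∧
      |β - min (b * F.E) F.bm| ≤ η ∧ v = F.lay Y * (F.kap b * R (Y + β + F.q)) := by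
    rintro Y b v ⟨h1, h2, h3, h4, rfl⟩ hY
    obtain ⟨m1, m2⟩ := min_mul_mem P L h3
    refine ⟨min (b * F.E) F.bm, m1, m2, by simpa using hη, ?_⟩
    have hY0 : 0 < Y := F.a₀_pos.trans_le h1
    have h5 : Real.log Y ≤ L.ymin ↔ Y ≤ F.a₁ := Real.log_le_iff_le_exp hY0
    have h6 : L.ymax ≤ Real.log Y ↔ F.a₂ ≤ Y := Real.le_log_iff_exp_le hY0
    have h7 : settle P L V (Real.log Y) b = F.kap b * R (Y + min (b * F.E) F.bm + F.q) := by
      rw [settle_eq P L hq, hV, Real.exp_log hY0]; rfl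
    rw [← h7]
    simp only [a, advance, Frame.lay, h5]
    split_ifs with h8 h9
    · rw [one_mul]
    · rcases hY with hY | hY
      · exact absurd hY h8
      · exact absurd h9 (not_lt.2 (h6.2 hY))
    · rfl
  refine ⟨fun h => ⟨h.1, h.2.1, h.2.2.1, h.2.2.2.1⟩, ?_, ?_, ?_, ?_, fun u hu => hu, ?_, ?_⟩
  · intro w hw ε hε
    -- The exact supremum need not be attained, because the objective may jump in the control; this
    -- is why `near_le` has a slack `ε`.
    obtain ⟨u, hu⟩ := exists_lt_of_lt_ciSup (sub_lt_self (supRebalance L a w) hε)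
    refine ⟨u, u.2, _, _, _, hnode w u hw u.2.2, by simpa using hη, by simpa using hη, ?_⟩
    rw [atAmounts_eq P L hq] at hu
    exact (sub_lt_iff_lt_add.1 hu).le
  · intro w hw u hu
    refine ⟨_, _, _, hnode w u hw hu.2, by simpa using hη, by simpa using hη, ?_⟩
    have := le_ciSup (hbdd w hw) ⟨u, hu⟩
    dsimp only at this
    rwa [atAmounts_eq P L hq] at this
  · intro Y b v h1 h2
    obtain ⟨β, h3, h4, h5, h6⟩ := hlay Y b v h1 h2
    exact ⟨β, h3, h4, h5, h6.le⟩
  · intro Y b v h1 h2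
    obtain ⟨β, h3, h4, h5, h6⟩ := hlay Y b v h1 h2
    exact ⟨β, h3, h4, h5, h6.ge⟩
  · exact fun t h1 h2 => ⟨t, ⟨h1, h2⟩, le_rfl, by linarith⟩
  · exact fun t h1 h2 => ⟨t, ⟨h1, h2⟩, le_rfl, by linarith⟩

end
end MeanRisk

/-! ### Discrete against exact time advancement in the interior layer. -/

namespace MeanRisk

open MeasureTheory

namespace Grid
variable {L : Domain} {Wmin Wmax : ℝ} (G : Grid L Wmin Wmax) (P : Market)

theorem abs_settleH_le {V : ℕ → ℕ → ℝ} {C : ℝ}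
    (hV : ∀ n ≤ G.Ny, ∀ j ≤ G.Nb, |V n j| ≤ C) {n j : ℕ} (hn : n ≤ G.Ny) (hj : j ≤ G.Nb) :
    |G.settleH P V n j| ≤ max 1 (Real.exp (P.r * P.dt)) * C := by
  rw [G.settleH_eq P le_rfl, abs_mul, abs_of_nonneg ((frame P L 0 le_rfl).kap_nonneg _)]
  have hb := G.b_part.mem_Icc hj
  obtain ⟨h1, h2⟩ := min_mul_mem P L hb.1
  have hC : |interp G.Nb G.b (V n) (min (G.b j * Real.exp (P.r * P.dt)) L.bmax)| ≤ C := by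
    have h3 := fun j hj => abs_le.1 (hV n hn j hj)
    rw [abs_le]
    have h4 := G.b_part.interp_mono (v := V n) (v' := fun _ => 0) (K := 0) (C := C) h1 h2
      fun j hj => by linarith [(h3 j hj).2]
    have h5 := G.b_part.interp_mono (v := fun j => - V n j) (v' := fun _ => 0) (K := 0) (C := C)
      h1 h2 fun j hj => by linarith [(h3 j hj).1]
    rw [IsPartition.interp_neg] at h5
    constructor <;> linarith
  exact mul_le_mul ((frame P L 0 le_rfl).kap_le hb.2) hC (abs_nonneg _) (by positivity)

theorem sum_weight_bound {a : ℕ → ℝ} {K : ℝ} (ha : ∀ l ≤ G.Ny, |a l| ≤ K) :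
    |∑ l ∈ Finset.range (G.Ny + 1), G.weight l * a l| ≤ K * (L.ymaxD - L.yminD) := by
  rw [G.sum_weight]
  refine (Finset.abs_sum_le_sum_abs _ _).trans ?_
  calc _ ≤ ∑ i ∈ Finset.range G.Ny, G.dy * K := by
        refine Finset.sum_le_sum fun i hi => ?_
        have hi := Finset.mem_range.1 hi
        rw [abs_mul, abs_of_pos G.dy_pos]
        refine mul_le_mul_of_nonneg_left ?_ G.dy_pos.le
        obtain ⟨h1, h2⟩ := abs_le.1 (ha i hi.le)
        obtain ⟨h3, h4⟩ := abs_le.1 (ha (i + 1) hi)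
        rw [abs_le]; constructor <;> linarith
    _ = K * (G.Ny * G.dy) := by rw [Finset.sum_const, Finset.card_range, nsmul_eq_mul]; ring
    _ = _ := by rw [G.Ny_mul_dy]

theorem abs_advanceH_le {V : ℕ → ℕ → ℝ} {C : ℝ}
    (hV : ∀ n ≤ G.Ny, ∀ j ≤ G.Nb, |V n j| ≤ C) {n j : ℕ} (hn : n ≤ G.Ny) (hj : j ≤ G.Nb) :
    |G.advanceH P (G.settleH P V) n j| ≤ advanceBound P L * C := by
  have hS := fun n hn => G.abs_settleH_le P hV (n := n) (j := j) hn hj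
  have hC : 0 ≤ C := (abs_nonneg _).trans (hV n hn j hj)
  have hB := P.densityBound_nonneg
  have hlen : 0 ≤ L.ymaxD - L.yminD := by linarith [L.yminD_lt_ymaxD]
  set K := max 1 (Real.exp (P.r * P.dt)) * C with hK
  have hK0 : 0 ≤ K := by positivity
  have e : advanceBound P L * C = K * max 1 (Real.exp (P.μ * P.dt)) +
      2 * (K * P.densityBound * (L.ymaxD - L.yminD)) := by
    rw [advanceBound, hK]; ring
  have h3 : 0 ≤ K * P.densityBound * (L.ymaxD - L.yminD) := by positivity
  rw [e]
  unfold advanceH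
  split_ifs
  · have := mul_le_mul_of_nonneg_left (le_max_left 1 (Real.exp (P.μ * P.dt))) hK0
    linarith [hS n hn]
  · simp only [mul_assoc]
    have := G.sum_weight_bound (K := K * P.densityBound)
      (a := fun l => P.densityTrunc G.Ng (G.y n - G.y l) * G.settleH P V l j) fun l hl => by
        rw [abs_mul, abs_of_nonneg (P.densityTrunc_nonneg _ _), mul_comm K]
        exact mul_le_mul (P.densityTrunc_le _ _) (hS l hl) (abs_nonneg _) hB
    have h4 : 0 ≤ K * max 1 (Real.exp (P.μ * P.dt)) := by positivity
    rw [mul_assoc] at this h3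
    linarith
  · rw [abs_mul, abs_of_pos (Real.exp_pos _)]
    have := mul_le_mul (le_max_right 1 (Real.exp (P.μ * P.dt))) (hS n hn) (abs_nonneg _)
      (by positivity)
    linarith

end Grid

/-- Right lower semicontinuity of the limit from comparability in both directions. -/
theorem right_lsc_of_close {ι : Type*} {l : Filter ι} [l.NeBot] {R : ℝ → ℝ} {Rn : ι → ℝ → ℝ}
    {Z : ℝ → ℝ → Prop} (h₁ : Frame.Close l (fun _ => R) Rn Z)
    (h₂ : Frame.Close l Rn (fun _ => R) Z) : Measurable fun x => R (max x 0) := by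
  refine measurable_of_right_lsc fun x a ha => ?_
  rcases lt_or_ge x 0 with hx | hx
  · refine ⟨0, hx, fun z hz => ?_⟩
    rw [max_eq_right hx.le] at ha
    rwa [max_eq_right hz.2.le]
  · rw [max_eq_left hx] at ha
    have hε : 0 < (R x - a) / 3 := by linarith
    obtain ⟨ρ₁, hρ₁, h₁⟩ := h₁ (x + 1) _ hε
    obtain ⟨ρ₂, hρ₂, h₂⟩ := h₂ (x + 1) _ hε
    obtain ⟨ρ, hρ, k1, k2, k3⟩ : ∃ ρ > 0, ρ ≤ ρ₁ ∧ ρ ≤ ρ₂ ∧ ρ ≤ 1 :=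
      ⟨min ρ₁ (min ρ₂ 1), by positivity, min_le_left _ _,
        (min_le_right _ _).trans (min_le_left _ _), (min_le_right _ _).trans (min_le_right _ _)⟩
    refine ⟨x + ρ, by linarith, fun z hz => ?_⟩
    obtain ⟨hz1, hz2⟩ := hz
    rw [max_eq_left (hx.trans hz1.le)]
    -- The comparison of `R` with itself passes through the discrete value at the midpoint; each of
    -- the two moves gains `(z - x) / 2`.
    obtain ⟨n, hn1, hn2⟩ := ((h₁ ((z - x) / 2) (by linarith)).and
      (h₂ ((z - x) / 2) (by linarith))).exists
    have q1 := hn1 x ((x + z) / 2) hx (by linarith) (by linarith) (by linarith)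
      (Or.inl ⟨by linarith, by linarith⟩)
    have q2 := hn2 ((x + z) / 2) z (by linarith) (by linarith) (by linarith) (by linarith)
      (Or.inl ⟨by linarith, by linarith⟩)
    linarith

theorem exp_sub_exp_ge {a y y' : ℝ} (ha : a ≤ y) (h : y ≤ y') :
    Real.exp a * (y' - y) ≤ Real.exp y' - Real.exp y := by
  have h1 : Real.exp y' = Real.exp y * Real.exp (y' - y) := by rw [← Real.exp_add]; ring_nf
  have h2 := Real.add_one_le_exp (y' - y)
  have h3 := Real.exp_pos y
  have h4 := mul_le_mul_of_nonneg_right (Real.exp_le_exp.2 ha) (sub_nonneg.2 h)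
  nlinarith

section
variable (P : Market) (L : Domain) {q : ℝ} (hq : 0 ≤ q) {Wmin Wmax : ℝ}
variable {ι : Type*} {l : Filter ι} {G : ι → Grid L Wmin Wmax}

/-- Discrete and exact time advancement at nearby interior nodes. -/
theorem interiorClose [l.NeBot] (hG : ∀ η > 0, ∀ᶠ n in l, (G n).MeshLE η)
    (hNg : Tendsto (fun n => (G n).Ng) l atTop)
    {R : ℝ → ℝ} {Rn : ι → ℝ → ℝ} {V : ℝ → ℝ → ℝ} {Vn : ι → ℕ → ℕ → ℝ}
    (hV : ∀ y b, V y b = R (Real.exp y + b + q))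
    (hVn : ∀ n i j, Vn n i j = Rn n (Real.exp ((G n).y i) + (G n).b j + q))
    {Z : ℝ → ℝ → Prop} (h₁ : Frame.Close l Rn (fun _ => R) Z)
    (h₂ : Frame.Close l (fun _ => R) Rn Z) {CR : ℝ}
    (hR : ∀ x, 0 ≤ x → x ≤ Real.exp (L.ymaxD + 1) + L.bmax + q → |R x| ≤ CR) :
    Frame.InteriorClose (frame P L q hq) l
      (fun n => gridNode (G n) ((G n).advanceH P ((G n).settleH P (Vn n))))
      (fun _ => domainNode L (advance P L (settle P L V))) ∧
    Frame.InteriorClose (frame P L q hq) l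
      (fun _ => domainNode L (advance P L (settle P L V)))
      (fun n => gridNode (G n) ((G n).advanceH P ((G n).settleH P (Vn n)))) := by
  set F := frame P L q hq
  have hmeas := right_lsc_of_close h₂ h₁
  suffices H : ∀ ε > 0, ∃ ρ > 0, ∀ᶠ n in l, ∀ i ≤ (G n).Ny, ∀ j ≤ (G n).Nb, ∀ Y b,
      F.a₀ ≤ Y → Y ≤ F.a₃ → 0 ≤ b → b ≤ F.bm →
      |Real.exp ((G n).y i) - Y| ≤ ρ → |(G n).b j - b| ≤ ρ →
      |∑ l ∈ Finset.range ((G n).Ny + 1), (G n).weight l *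
        P.densityTrunc (G n).Ng ((G n).y i - (G n).y l) * (G n).settleH P (Vn n) l j -
      ∫ t in L.yminD..L.ymaxD, settle P L V t b * P.density (Real.log Y - t)| ≤ ε by
    have hh : ∀ n i j, F.a₁ < Real.exp ((G n).y i) → Real.exp ((G n).y i) < F.a₂ →
        (G n).advanceH P ((G n).settleH P (Vn n)) i j = ∑ l ∈ Finset.range ((G n).Ny + 1),
          (G n).weight l * P.densityTrunc (G n).Ng ((G n).y i - (G n).y l) *
            (G n).settleH P (Vn n) l j := by
      intro n i j h1 h2
      have h1 := Real.exp_lt_exp.1 h1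
      have h2 := Real.exp_lt_exp.1 h2
      rw [Grid.advanceH, if_neg (not_le.2 h1), if_pos h2]
    have he : ∀ Y b, F.a₁ < Y → Y < F.a₂ → advance P L (settle P L V) (Real.log Y) b =
        ∫ t in L.yminD..L.ymaxD, settle P L V t b * P.density (Real.log Y - t) := by
      intro Y b h1 h2
      have hY : 0 < Y := (Real.exp_pos _).trans h1
      have h1 := (Real.lt_log_iff_exp_lt hY).2 h1
      have h2 := (Real.log_lt_iff_lt_exp hY).2 h2
      rw [advance, if_neg (not_le.2 h1), if_pos h2]
    constructor <;> intro ε hε <;> obtain ⟨ρ, hρ, H⟩ := H ε hε <;>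
      refine ⟨ρ, hρ, H.mono fun n H => ?_⟩
    · rintro Y b v Y' b' v' ⟨i, hi, j, hj, rfl, rfl, rfl⟩ ⟨g1, g2, g3, g4, rfl⟩ a1 a2 a3 a4 d1 d2
      rw [hh n i j a1 a2, he Y' b' a3 a4]
      linarith [(abs_le.1 (H i hi j hj Y' b' g1 g2 g3 g4 d1 d2)).2]
    · rintro Y' b' v' Y b v ⟨g1, g2, g3, g4, rfl⟩ ⟨i, hi, j, hj, rfl, rfl, rfl⟩ a1 a2 a3 a4 d1 d2
      rw [abs_sub_comm] at d1 d2
      rw [hh n i j a3 a4, he Y' b' a1 a2]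
      linarith [(abs_le.1 (H i hi j hj Y' b' g1 g2 g3 g4 d1 d2)).1]
  intro ε hε
  have hE := F.E_pos
  have hbm := F.bm_pos
  have ha₀ := F.a₀_pos
  have hB := P.densityBound_nonneg
  have hlen := L.yminD_lt_ymaxD
  set len := L.ymaxD - L.yminD
  have hlen' : len = L.ymaxD - L.yminD := rfl
  have hlen0 : 0 < len := sub_pos.2 hlen
  set D := Real.exp (L.ymaxD + 1)
  have hD : 0 < D := Real.exp_pos _
  set α := Real.exp (L.yminD - 1)
  have hα : 0 < α := Real.exp_pos _
  set K := max 1 F.E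
  have hK : 0 < K := by positivity
  obtain ⟨C, hC, hCC⟩ : ∃ C > 0, CR ≤ C := ⟨max CR 1, by positivity, le_max_left _ _⟩
  obtain ⟨ε₁, hε₁, hs⟩ := Frame.exists_pos_small [(P.densityBound * len + 1, ε / 3)] (by
    simp only [List.mem_cons, List.not_mem_nil, or_false]
    rintro p rfl; constructor <;> dsimp only <;> positivity)
  simp only [List.forall_mem_cons] at hs
  obtain ⟨hε₁', -⟩ := hs
  obtain ⟨e', he', hs⟩ := Frame.exists_pos_small [(K * C * len, ε / 3)] (by
    simp only [List.mem_cons, List.not_mem_nil, or_false]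
    rintro p rfl; constructor <;> dsimp only <;> positivity)
  simp only [List.forall_mem_cons] at hs
  obtain ⟨he'1, -⟩ := hs
  obtain ⟨ρg, hρg, N₀, hg⟩ := P.densityTrunc_close (len + 1) he'
  obtain ⟨εk, hεk, hs⟩ := Frame.exists_pos_small [(K, ε₁ / 2)] (by
    simp only [List.mem_cons, List.not_mem_nil, or_false]
    rintro p rfl; constructor <;> dsimp only <;> positivity)
  simp only [List.forall_mem_cons] at hs
  obtain ⟨hεk', -⟩ := hs
  obtain ⟨ρ₁, hρ₁, h₁⟩ := h₁ (D + L.bmax + q) εk hεk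
  obtain ⟨ρ₂, hρ₂, h₂⟩ := h₂ (D + L.bmax + q) εk hεk
  -- `τ` is the shift of the log-price: small enough for the density error, the radii of
  -- comparability and the end pieces, but fixed before the mesh.
  obtain ⟨τ, hτ, hs⟩ := Frame.exists_pos_small [(1, 1), (3, ρg), (4 * D, ρ₁), (4 * D, ρ₂),
      (2 * (K * C * P.densityBound) + 1, ε / 3)] (by
    simp only [List.mem_cons, List.not_mem_nil, or_false]
    rintro p (rfl | rfl | rfl | rfl | rfl) <;> constructor <;> dsimp only <;> positivity)
  simp only [List.forall_mem_cons] at hs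
  obtain ⟨hτ1, hτg, hτ₁, hτ₂, hτε, -⟩ := hs
  obtain ⟨ρ, hρ, hs⟩ := Frame.exists_pos_small [(3, F.a₀ * ρg), (4 * F.E, ρ₁), (4 * F.E, ρ₂),
      (4 * F.E, α * τ), (F.E / F.bm * C, ε₁ / 2)] (by
    simp only [List.mem_cons, List.not_mem_nil, or_false]
    rintro p (rfl | rfl | rfl | rfl | rfl) <;> constructor <;> dsimp only <;> positivity)
  simp only [List.forall_mem_cons] at hs
  obtain ⟨hρg', hρ₁', hρ₂', hρα, hρε, -⟩ := hs
  -- The shift gains at least `3 * α * τ / 4` in the risky amount, and the bond errors `η` and `E *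
  -- ρ` each cost at most `α * τ / 4`. A surplus of `α * τ / 4` is left.
  obtain ⟨η, hη, hs⟩ := Frame.exists_pos_small [(4, τ), (3, ρg), (4, ρ₁), (4, ρ₂), (4, α * τ)] (by
    simp only [List.mem_cons, List.not_mem_nil, or_false]
    rintro p (rfl | rfl | rfl | rfl | rfl) <;> constructor <;> dsimp only <;> positivity)
  simp only [List.forall_mem_cons] at hs
  obtain ⟨hητ, hηg, hη₁, hη₂, hηα, -⟩ := hs
  refine ⟨ρ, hρ, ?_⟩
  filter_upwards [hG η hη, hNg.eventually_ge_atTop N₀, h₁ (α * τ / 4) (by positivity),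
    h₂ (α * τ / 4) (by positivity)] with n hGn hN h₁ h₂
  intro i hi j hj Y b hY1 hY2 hb0 hb1 hdY hdb
  have hbj := (G n).b_part.mem_Icc hj
  set σ' := min (b * F.E) F.bm
  obtain ⟨hσ0, hσ1⟩ : 0 ≤ σ' ∧ σ' ≤ F.bm := min_mul_mem P L hb0
  have hσ : ∀ β, |β - min ((G n).b j * F.E) F.bm| ≤ η → |β - σ'| ≤ η + F.E * ρ := by
    intro β h
    refine (abs_sub_le _ _ _).trans (add_le_add h ?_)
    refine (abs_min_sub_min_le_max _ _ _ _).trans (max_le ?_ ?_)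
    · rw [← sub_mul, abs_mul, abs_of_pos hE, mul_comm]
      exact mul_le_mul_of_nonneg_left hdb hE.le
    · rw [sub_self, abs_zero]; positivity
  set φ := fun t => settle P L V t b with hφdef
  have hφ : ∀ t, φ t = F.kap b * R (Real.exp t + σ' + q) := by
    intro t
    simp only [φ]
    rw [settle_eq P L hq, hV]; rfl
  have hRb : ∀ t, t ≤ L.ymaxD + 1 → |R (Real.exp t + σ' + q)| ≤ C := fun t ht => by
    have := Real.exp_le_exp.2 ht
    have h3 : σ' ≤ L.bmax := hσ1
    exact (hR _ (by positivity) (by linarith)).trans hCC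
  have hφC : ∀ t, L.yminD - 1 ≤ t → t ≤ L.ymaxD + 1 → |φ t| ≤ K * C := by
    intro t _ ht
    rw [hφ, abs_mul, abs_of_nonneg (F.kap_nonneg _)]
    exact mul_le_mul (F.kap_le hb1) (hRb t ht) (abs_nonneg _) hK.le
  -- Discontinuity leaves measurability as something to prove; it comes from right lower
  -- semicontinuity of `R`.
  have hφm : Measurable φ := by
    have : φ = fun t => F.kap b * (fun x => R (max x 0)) (Real.exp t + σ' + q) := by
      funext t
      rw [hφ]
      dsimp only
      rw [max_eq_left (by positivity)]
    rw [this]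
    exact (hmeas.comp (by fun_prop)).const_mul _
  have hφi : IntervalIntegrable φ volume (L.yminD - 1) (L.ymaxD + 1) := by
    rw [intervalIntegrable_iff_integrableOn_Ioc_of_le (by linarith)]
    refine Measure.integrableOn_of_bounded (M := K * C) measure_Ioc_lt_top.ne
      hφm.aestronglyMeasurable ?_
    refine (ae_restrict_mem measurableSet_Ioc).mono fun t ht => ?_
    exact hφC t ht.1.le ht.2
  set v := fun l => (G n).settleH P (Vn n) l j with hvdef
  have hkap : |F.kap ((G n).b j) - F.kap b| ≤ F.E / F.bm * ρ :=
    (F.kap_sub _ _).trans (mul_le_mul_of_nonneg_left hdb (by positivity))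
  have hset : 0 ≤ min ((G n).b j * F.E) F.bm ∧ min ((G n).b j * F.E) F.bm ≤ F.bm :=
    min_mul_mem P L hbj.1
  have hx : ∀ l ≤ (G n).Ny, ∀ β, 0 ≤ β → β ≤ F.bm → 0 ≤ Real.exp ((G n).y l) + β + q ∧
      Real.exp ((G n).y l) + β + q ≤ D + L.bmax + q := by
    intro l hl β h1 h2
    have h3 : β ≤ L.bmax := h2
    have := Real.exp_le_exp.2 ((G n).y_part.mem_Icc hl).2
    have : Real.exp L.ymaxD ≤ D := Real.exp_le_exp.2 (by linarith)
    exact ⟨by positivity, by linarith⟩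
  have hx' : ∀ t, t ≤ L.ymaxD + 1 → 0 ≤ Real.exp t + σ' + q ∧
      Real.exp t + σ' + q ≤ D + L.bmax + q := by
    intro t ht
    have h3 : σ' ≤ L.bmax := hσ1
    have : Real.exp t ≤ D := Real.exp_le_exp.2 ht
    exact ⟨by positivity, by linarith⟩
  -- Looking `τ` to the right, the exact function has the larger wealth and dominates the node
  -- value.
  have hup : ∀ l ≤ (G n).Ny, ∀ t, L.yminD ≤ t → t ≤ L.ymaxD → |t - (G n).y l| ≤ η →
      v l ≤ φ (t + τ) + ε₁ := by
    intro l hl t ht1 ht2 htl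
    obtain ⟨k, hk, hk1, hk2⟩ := (G n).b_part.exists_interp_le (Vn n l) hset.1 hset.2 hGn.b
    obtain ⟨hk3, hk4⟩ := (G n).b_part.mem_Icc hk
    obtain ⟨q1, q2⟩ := abs_le.1 (hσ _ hk1)
    obtain ⟨q3, q4⟩ := abs_le.1 htl
    have hyl := (G n).y_part.mem_Icc hl
    have h3 := exp_sub_exp_ge (a := L.yminD - 1) (y := (G n).y l) (y' := t + τ)
      (by linarith [hyl.1]) (by linarith)
    have h4 := (abs_le.1 (Grid.abs_exp_sub_le (y := t + τ) (y' := (G n).y l) (K := L.ymaxD + 1)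
      (η := τ + η) (by linarith) (by linarith [hyl.2])
      (by rw [abs_le]; constructor <;> linarith))).2
    have h5 : α * (τ * (3 / 4)) ≤ α * (t + τ - (G n).y l) :=
      mul_le_mul_of_nonneg_left (by linarith) hα.le
    have h6 : D * (τ + η) ≤ D * (2 * τ) := mul_le_mul_of_nonneg_left (by linarith) hD.le
    obtain ⟨x1, x2⟩ := hx l hl _ hk3 hk4
    obtain ⟨x3, x4⟩ := hx' (t + τ) (by linarith)
    have h7 := h₁ _ _ x1 x2 x3 x4 (Or.inl ⟨by linarith, by linarith⟩)
    have h8 := Frame.mul_le_mul_add (F.kap_nonneg ((G n).b j)) (F.kap_le hbj.2) hkap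
      (hRb (t + τ) (by linarith)) h7 hεk.le
    have h9 : v l = F.kap ((G n).b j) *
      interp (G n).Nb (G n).b (Vn n l) (min ((G n).b j * F.E) F.bm) := (G n).settleH_eq P hq _ _ _
    rw [hVn] at hk2
    have h10 := mul_le_mul_of_nonneg_left hk2 (F.kap_nonneg ((G n).b j))
    have h11 : F.E / F.bm * ρ * C = F.E / F.bm * C * ρ := by ring
    rw [hφ]
    linarith
  -- Looking `τ` to the left, the node has the larger wealth; the signs are reversed so that
  -- `convolution_le` applies again.
  have hlo : ∀ l ≤ (G n).Ny, ∀ t, L.yminD ≤ t → t ≤ L.ymaxD → |t - (G n).y l| ≤ η →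
      -v l ≤ -φ (t + -τ) + ε₁ := by
    intro l hl t ht1 ht2 htl
    obtain ⟨k, hk, hk1, hk2⟩ := (G n).b_part.exists_le_interp (Vn n l) hset.1 hset.2 hGn.b
    obtain ⟨hk3, hk4⟩ := (G n).b_part.mem_Icc hk
    obtain ⟨q1, q2⟩ := abs_le.1 (hσ _ hk1)
    obtain ⟨q3, q4⟩ := abs_le.1 htl
    have hyl := (G n).y_part.mem_Icc hl
    have h3 := exp_sub_exp_ge (a := L.yminD - 1) (y := t + -τ) (y' := (G n).y l)
      (by linarith [hyl.1]) (by linarith)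
    have h4 := (abs_le.1 (Grid.abs_exp_sub_le (y := (G n).y l) (y' := t + -τ) (K := L.ymaxD + 1)
      (η := τ + η) (by linarith [hyl.2]) (by linarith)
      (by rw [abs_le]; constructor <;> linarith))).2
    have h5 : α * (τ * (3 / 4)) ≤ α * ((G n).y l - (t + -τ)) :=
      mul_le_mul_of_nonneg_left (by linarith) hα.le
    have h6 : D * (τ + η) ≤ D * (2 * τ) := mul_le_mul_of_nonneg_left (by linarith) hD.le
    obtain ⟨x1, x2⟩ := hx l hl _ hk3 hk4
    obtain ⟨x3, x4⟩ := hx' (t + -τ) (by linarith)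
    have h7 := h₂ _ _ x3 x4 x1 x2 (Or.inl ⟨by linarith, by linarith⟩)
    have h8 := Frame.mul_le_mul_add (r := -Rn n (Real.exp ((G n).y l) + (G n).b k + q))
      (r' := -R (Real.exp (t + -τ) + σ' + q)) (e' := εk) (CR := C)
      (F.kap_nonneg ((G n).b j)) (F.kap_le hbj.2) hkap
      (by rw [abs_neg]; exact hRb (t + -τ) (by linarith)) (by linarith) hεk.le
    have h9 : v l = F.kap ((G n).b j) *
      interp (G n).Nb (G n).b (Vn n l) (min ((G n).b j * F.E) F.bm) := (G n).settleH_eq P hq _ _ _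
    rw [hVn] at hk2
    have h10 := mul_le_mul_of_nonneg_left hk2 (F.kap_nonneg ((G n).b j))
    have h11 : F.E / F.bm * ρ * C = F.E / F.bm * C * ρ := by ring
    rw [hφ]
    linarith
  have hcell : ∀ i < (G n).Ny, ∀ t, (G n).y i ≤ t → t ≤ (G n).y (i + 1) →
      (L.yminD ≤ t ∧ t ≤ L.ymaxD) ∧ |t - (G n).y i| ≤ η ∧ |t - (G n).y (i + 1)| ≤ η := by
    intro i hi t h1 h2
    have h3 := (G n).y_part.mem_Icc hi.le
    have h4 := (G n).y_part.mem_Icc (Nat.succ_le_of_lt hi)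
    have h5 := (G n).y_succ_sub i
    have h6 := hGn.y
    refine ⟨⟨h3.1.trans h1, h2.trans h4.2⟩, ?_, ?_⟩ <;> rw [abs_le] <;> constructor <;> linarith
  have hYlog : L.yminD ≤ Real.log Y ∧ Real.log Y ≤ L.ymaxD :=
    ⟨(Real.le_log_iff_exp_le (ha₀.trans_le hY1)).2 hY1,
      (Real.log_le_iff_le_exp (ha₀.trans_le hY1)).2 hY2⟩
  have hyi := (G n).y_part.mem_Icc hi
  have hlog : |(G n).y i - Real.log Y| ≤ ρg / 3 := by
    have := abs_log_sub_le (a := F.a₀) ha₀ (Real.exp_le_exp.2 hyi.1) hY1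
    rw [Real.log_exp] at this
    refine this.trans ((div_le_div_of_nonneg_right hdY ha₀.le).trans ?_)
    rw [div_le_iff₀ ha₀]
    linarith
  obtain ⟨hlog1, hlog2⟩ := abs_le.1 hlog
  have hgc : ∀ τ', |τ'| ≤ τ → ∀ l ≤ (G n).Ny, ∀ t, L.yminD ≤ t → t ≤ L.ymaxD →
      |t - (G n).y l| ≤ η → |P.densityTrunc (G n).Ng ((G n).y i - (G n).y l) -
        P.density (Real.log Y - (t + τ'))| ≤ e' := by
    intro τ' hτ' l hl t ht1 ht2 htl
    obtain ⟨q1, q2⟩ := abs_le.1 hτ'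
    obtain ⟨q3, q4⟩ := abs_le.1 htl
    have hyl := (G n).y_part.mem_Icc hl
    refine hg _ hN _ _ ?_ ?_ ?_ <;> rw [abs_le] <;> constructor <;>
      linarith [hlen', hyi.1, hyi.2, hyl.1, hyl.2, hYlog.1, hYlog.2]
  have habs : |τ| = τ := abs_of_pos hτ
  have hneg : |-τ| = τ := by rw [abs_neg, habs]
  have r1 := (G n).convolution_le P (τ := τ) (y := Real.log Y) (z := (G n).y i) (Ng := (G n).Ng)
    (e := ε₁) (e' := e') (by linarith) hφi hφC hε₁.le
    (fun i hi t h1 h2 => by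
      obtain ⟨⟨c1, c2⟩, c3, c4⟩ := hcell i hi t h1 h2
      exact ⟨hup _ hi.le t c1 c2 c3, hup _ hi t c1 c2 c4⟩)
    (fun i hi t h1 h2 => by
      obtain ⟨⟨c1, c2⟩, c3, c4⟩ := hcell i hi t h1 h2
      exact ⟨hgc τ habs.le _ hi.le t c1 c2 c3, hgc τ habs.le _ hi t c1 c2 c4⟩)
  have r2 := (G n).convolution_le P (φ := fun t => -φ t) (v := fun l => -v l) (τ := -τ)
    (y := Real.log Y) (z := (G n).y i) (Ng := (G n).Ng)
    (e := ε₁) (e' := e') (by linarith) hφi.neg (fun t h1 h2 => by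
      rw [abs_neg]; exact hφC t h1 h2) hε₁.le
    (fun i hi t h1 h2 => by
      obtain ⟨⟨c1, c2⟩, c3, c4⟩ := hcell i hi t h1 h2
      exact ⟨hlo _ hi.le t c1 c2 c3, hlo _ hi t c1 c2 c4⟩)
    (fun i hi t h1 h2 => by
      obtain ⟨⟨c1, c2⟩, c3, c4⟩ := hcell i hi t h1 h2
      exact ⟨hgc _ hneg.le _ hi.le t c1 c2 c3, hgc _ hneg.le _ hi t c1 c2 c4⟩)
  simp only [mul_neg, neg_mul, Finset.sum_neg_distrib, intervalIntegral.integral_neg] at r2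
  rw [habs] at r1
  rw [hneg] at r2
  have herr : (e' * (K * C) + P.densityBound * ε₁) * len + 2 * τ * (K * C * P.densityBound) ≤ ε := by
    have : 0 ≤ ε₁ := hε₁.le
    linarith
  simp only [mul_assoc] at r1 r2 ⊢
  simp only [mul_assoc] at herr
  rw [abs_le]
  constructor <;> linarith
end
end MeanRisk

/-! ### Induction over the periods for a fixed payoff. -/

namespace MeanRisk

/-- The cashflow between the wealth with `k` periods to go and the amounts before it. -/
noncomputable def cash (P : Market) (k : ℕ) : ℝ := if k = 0 then 0 else P.q (P.M - k)

theorem cash_nonneg (P : Market) (k : ℕ) : 0 ≤ cash P k := by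
  unfold cash
  split_ifs
  · exact le_rfl
  · exact P.q_nonneg _ (by have := P.M_pos; omega)

/-- The exact maximal value with `k` periods to go for the payoff `p`, as a function of the wealth
after the cashflow. -/
noncomputable def wealthValue (P : Market) (L : Domain) (p : ℝ → ℝ) : ℕ → ℝ → ℝ
  | 0 => p
  | k + 1 => supRebalance L (advance P L (settle P L
      fun y b => wealthValue P L p k (Real.exp y + b + cash P k)))

/-- The discrete counterpart of `wealthValue`. -/
noncomputable def Grid.wealthValue {L : Domain} {Wmin Wmax : ℝ} (G : Grid L Wmin Wmax) (P : Market)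
    (p : ℝ → ℝ) : ℕ → ℝ → ℝ
  | 0 => p
  | k + 1 => G.supRebalance (G.advanceH P (G.settleH P
      fun n j => G.wealthValue P p k (Real.exp (G.y n) + G.b j + cash P k)))

section
variable (P : Market) (L : Domain) {p : ℝ → ℝ}

theorem exists_wealthValue_bound (hp : Continuous p) (k : ℕ) (Wb : ℝ) :
    ∃ C, ∀ x, 0 ≤ x → x ≤ Wb → |wealthValue P L p k x| ≤ C := by
  induction k generalizing Wb with
  | zero =>
    obtain ⟨C, hC⟩ := (isCompact_Icc (a := 0) (b := Wb)).exists_bound_of_continuousOn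
      hp.continuousOn
    exact ⟨C, fun x h1 h2 => hC x ⟨h1, h2⟩⟩
  | succ k ih =>
    obtain ⟨C, hC⟩ := ih (Real.exp L.ymaxD + L.bmax + cash P k)
    obtain ⟨CA, -, hamp⟩ := (frame P L _ (cash_nonneg P k)).exists_amp_bound Wb
    have S := step_exact P L (cash_nonneg P k) hC zero_le_one
      (V := fun y b => wealthValue P L p k (Real.exp y + b + cash P k)) fun y b => rfl
    refine ⟨CA * (advanceBound P L * C), fun x h1 h2 => ?_⟩
    refine S.abs_le (fun s b h3 h4 => (hamp s b s b h3 h4 h3 h4).1) ?_ h1 h2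
    rintro Y b v ⟨h3, h4, h5, h6, rfl⟩
    have hY : 0 < Y := (Real.exp_pos _).trans_le h3
    refine abs_advance_le P L (fun y b g1 g2 g3 g4 => hC _ ?_ ?_)
      ((Real.le_log_iff_exp_le hY).2 h3) ((Real.log_le_iff_le_exp hY).2 h4) h5 h6
    · have := cash_nonneg P k
      positivity
    · have := Real.exp_le_exp.2 g2
      linarith

variable {Wmin Wmax : ℝ}

theorem Grid.exists_wealthValue_bound {ι : Type*} {l : Filter ι} {G : ι → Grid L Wmin Wmax}
    (hG : ∀ η > 0, ∀ᶠ n in l, (G n).MeshLE η) (hp : Continuous p) (k : ℕ) (Wb : ℝ) :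
    ∃ C, ∀ᶠ n in l, ∀ x, 0 ≤ x → x ≤ Wb → |(G n).wealthValue P p k x| ≤ C := by
  induction k generalizing Wb with
  | zero =>
    obtain ⟨C, hC⟩ := (isCompact_Icc (a := 0) (b := Wb)).exists_bound_of_continuousOn
      hp.continuousOn
    exact ⟨C, .of_forall fun n x h1 h2 => hC x ⟨h1, h2⟩⟩
  | succ k ih =>
    obtain ⟨C, hC⟩ := ih (Real.exp L.ymaxD + L.bmax + cash P k)
    obtain ⟨CA, -, hamp⟩ := (frame P L _ (cash_nonneg P k)).exists_amp_bound Wb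
    refine ⟨CA * (advanceBound P L * C), ?_⟩
    filter_upwards [hC, hG 1 one_pos] with n hC hn x h1 h2
    have S := (G n).step P (η := max 1 (Real.exp L.ymaxD)) (cash_nonneg P k) hn (le_max_left _ _)
      (by rw [mul_one]; exact le_max_right _ _) _
      (V := fun i j => (G n).wealthValue P p k (Real.exp ((G n).y i) + (G n).b j + cash P k))
      fun i j => rfl
    refine S.abs_le (fun s b h3 h4 => (hamp s b s b h3 h4 h3 h4).1) ?_ h1 h2
    rintro Y b v ⟨i, hi, j, hj, rfl, rfl, rfl⟩
    refine (G n).abs_advanceH_le P (fun i hi j hj => hC _ ?_ ?_) hi hj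
    · have := cash_nonneg P k
      have := ((G n).b_part.mem_Icc hj).1
      positivity
    · have := Real.exp_le_exp.2 ((G n).y_part.mem_Icc hi).2
      have := ((G n).b_part.mem_Icc hj).2
      linarith

/-- Lower end of the jump-free wealths above the domain, with `k` periods to go. -/
noncomputable def zoneθ (k : ℕ) : ℝ := Real.exp L.ymax / min 1 (Real.exp (P.r * P.dt)) ^ k

/-- Lower end of the jump-free window of wealths, with `k` periods to go. -/
noncomputable def zoneLo (k : ℕ) : ℝ := Real.exp L.ymin / min 1 (Real.exp (P.r * P.dt)) ^ k

/-- Upper end of the jump-free window of wealths, with `k` periods to go. -/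
noncomputable def zoneHi (k : ℕ) : ℝ := Real.exp L.ymax / max 1 (Real.exp (P.r * P.dt)) ^ k -
  ∑ i ∈ Finset.range k, cash P i - k * Real.exp L.yminD

theorem M_mul_dt : P.M * P.dt = P.T := by
  have : (P.M : ℝ) ≠ 0 := by exact_mod_cast P.M_pos.ne'
  unfold Market.dt; field_simp

theorem max_one_pow {E : ℝ} (hE : 0 ≤ E) (n : ℕ) : max 1 E ^ n = max 1 (E ^ n) := by
  rcases le_total 1 E with h | h
  · rw [max_eq_right h, max_eq_right (one_le_pow₀ h)]
  · rw [max_eq_left h, max_eq_left (pow_le_one₀ hE h), one_pow]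

theorem max_exp_pow : max 1 (Real.exp (P.r * P.dt)) ^ P.M = max 1 (Real.exp (P.r * P.T)) := by
  rw [max_one_pow (Real.exp_pos _).le, ← Real.exp_nat_mul, ← M_mul_dt]
  ring_nf

theorem min_exp_inv (x : ℝ) : (min 1 (Real.exp x))⁻¹ = max 1 (Real.exp (-x)) := by
  rcases le_total 0 x with h | h
  · rw [min_eq_left (Real.one_le_exp h), max_eq_left (Real.exp_le_one_iff.2 (by linarith)), inv_one]
  · rw [min_eq_right (Real.exp_le_one_iff.2 h), max_eq_right (Real.one_le_exp (by linarith)),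
      Real.exp_neg]

theorem min_exp_pow : (min 1 (Real.exp (P.r * P.dt)) ^ P.M)⁻¹ =
    max 1 (Real.exp (-(P.r * P.T))) := by
  rw [← inv_pow, min_exp_inv, max_one_pow (Real.exp_pos _).le, ← Real.exp_nat_mul, ← M_mul_dt]
  ring_nf

/-- The powers of `min 1 E` make the lower step conditions equalities. The bond condition on the
domain places `θ` below the saturated bond. The upper end decreases by one cashflow and one `exp
yminD` per period, which pays for the cashflow and for clamping a small risky amount up. -/
theorem compat {s₀ b₀ : ℝ} (hL : LargeEnough P L s₀ b₀) {k : ℕ} (hk : k < P.M) :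
    (frame P L _ (cash_nonneg P k)).Compat (zoneθ P L k) (zoneLo P L k) (zoneHi P L k)
      (zoneθ P L (k + 1)) (zoneLo P L (k + 1)) (zoneHi P L (k + 1)) := by
  have hm : 0 < min 1 (Real.exp (P.r * P.dt)) := by positivity
  have hm1 : min 1 (Real.exp (P.r * P.dt)) ≤ 1 := min_le_left _ _
  have hX : 0 < max 1 (Real.exp (P.r * P.dt)) := by positivity
  have hX1 : 1 ≤ max 1 (Real.exp (P.r * P.dt)) := le_max_left _ _
  have hstep : ∀ a : ℝ, a / min 1 (Real.exp (P.r * P.dt)) ^ k =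
      min 1 (Real.exp (P.r * P.dt)) * (a / min 1 (Real.exp (P.r * P.dt)) ^ (k + 1)) := by
    intro a; field_simp; ring
  have hge : ∀ a : ℝ, 0 ≤ a → ∀ i, a ≤ a / min 1 (Real.exp (P.r * P.dt)) ^ i := by
    intro a ha i
    rw [le_div_iff₀ (by positivity)]
    exact mul_le_of_le_one_right ha (pow_le_one₀ hm.le hm1)
  have hsum : 0 ≤ ∑ i ∈ Finset.range k, cash P i := Finset.sum_nonneg fun i _ => cash_nonneg P i
  have hc := cash_nonneg P k
  have hy := Real.exp_pos L.yminD
  refine ⟨?_, (hstep _).le, hge _ (Real.exp_pos _).le _, (hstep _).le,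
    hge _ (Real.exp_pos _).le _, ?_, ?_⟩
  · have h1 := hL.bond
    rw [← min_exp_pow, ← div_eq_mul_inv] at h1
    have h2 : Real.exp L.ymax / min 1 (Real.exp (P.r * P.dt)) ^ (k + 1) ≤
        Real.exp L.ymax / min 1 (Real.exp (P.r * P.dt)) ^ P.M :=
      div_le_div_of_nonneg_left (Real.exp_pos _).le (by positivity)
        (pow_le_pow_of_le_one hm.le hm1 hk)
    have h3 := mul_le_mul_of_nonneg_left (h2.trans h1) hm.le
    rw [← hstep] at h3
    refine h3.trans (le_of_eq ?_)
    change _ = min (L.bmax * Real.exp (P.r * P.dt)) L.bmax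
    rw [min_mul_of_nonneg _ _ L.bmax_pos.le, one_mul, min_comm, mul_comm]
  · change max 1 (Real.exp (P.r * P.dt)) * zoneHi P L (k + 1) + Real.exp L.yminD + cash P k ≤ _
    unfold zoneHi
    rw [Finset.sum_range_succ]
    set S := ∑ i ∈ Finset.range k, cash P i
    set X := max 1 (Real.exp (P.r * P.dt))
    have e : X * (Real.exp L.ymax / X ^ (k + 1)) = Real.exp L.ymax / X ^ k := by field_simp; ring
    have h1 : 0 ≤ S + cash P k + ((k + 1 : ℕ) : ℝ) * Real.exp L.yminD := by positivity
    have h2 := mul_le_mul_of_nonneg_right hX1 h1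
    push_cast at h2 ⊢
    linarith
  · change zoneHi P L (k + 1) ≤ Real.exp L.ymax
    unfold zoneHi
    have h1 : 0 ≤ ∑ i ∈ Finset.range (k + 1), cash P i :=
      Finset.sum_nonneg fun i _ => cash_nonneg P i
    have h2 : 0 ≤ ((k + 1 : ℕ) : ℝ) * Real.exp L.yminD := by positivity
    have h3 : Real.exp L.ymax / max 1 (Real.exp (P.r * P.dt)) ^ (k + 1) ≤ Real.exp L.ymax :=
      div_le_self (Real.exp_pos _).le (one_le_pow₀ hX1)
    linarith

theorem initial_mem_window {s₀ b₀ : ℝ} (hL : LargeEnough P L s₀ b₀) :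
    zoneLo P L P.M < s₀ + b₀ + P.q 0 ∧ s₀ + b₀ + P.q 0 < zoneHi P L P.M := by
  constructor
  · have := hL.lower
    rwa [← min_exp_pow, ← div_eq_mul_inv] at this
  · have h := hL.upper
    rw [← max_exp_pow, ← lt_div_iff₀ (by positivity)] at h
    -- Counted backwards, the terms `cash P i` with `0 < i < M` are the cashflows after the initial
    -- one; `cash P 0` vanishes because nothing is paid at maturity.
    have e : ∑ i ∈ Finset.range P.M, cash P i + P.q 0 = ∑ m ∈ Finset.range P.M, P.q m := by
      obtain ⟨N, hN⟩ : ∃ N, P.M = N + 1 := ⟨P.M - 1, by have := P.M_pos; omega⟩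
      rw [hN, Finset.sum_range_succ', Finset.sum_range_succ' P.q, ← Finset.sum_range_reflect]
      simp only [cash, if_true, add_zero]
      congr 1
      refine Finset.sum_congr rfl fun i hi => ?_
      have := Finset.mem_range.1 hi
      rw [if_neg (by omega)]
      congr 1; omega
    unfold zoneHi
    linarith

variable {ι : Type*} {l : Filter ι} {G : ι → Grid L Wmin Wmax}

/-- Comparability of the exact and the discrete values with `k` periods to go. -/
theorem close_wealthValue [l.NeBot] (hG : ∀ η > 0, ∀ᶠ n in l, (G n).MeshLE η)
    (hNg : Tendsto (fun n => (G n).Ng) l atTop) (hp : Continuous p) {s₀ b₀ : ℝ}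
    (hL : LargeEnough P L s₀ b₀) {k : ℕ} (hk : k ≤ P.M) :
    Frame.Close l (fun n => (G n).wealthValue P p k) (fun _ => wealthValue P L p k)
      (Frame.zone (zoneθ P L k) (zoneLo P L k) (zoneHi P L k)) ∧
    Frame.Close l (fun _ => wealthValue P L p k) (fun n => (G n).wealthValue P p k)
      (Frame.zone (zoneθ P L k) (zoneLo P L k) (zoneHi P L k)) := by
  induction k with
  | zero =>
    -- At maturity both functions are the continuous payoff, so uniform continuity on bounded
    -- wealths is enough.
    suffices H : Frame.Close l (fun _ => p) (fun _ => p)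
      (Frame.zone (zoneθ P L 0) (zoneLo P L 0) (zoneHi P L 0)) from ⟨H, H⟩
    intro Wb ε hε
    have hu := (isCompact_Icc (a := 0) (b := Wb)).uniformContinuousOn_of_continuous
      hp.continuousOn
    rw [Metric.uniformContinuousOn_iff_le] at hu
    obtain ⟨ρ, hρ, h⟩ := hu ε hε
    refine ⟨ρ, hρ, fun δ hδ => .of_forall fun n x x' h1 h2 h3 h4 hr => ?_⟩
    have hd : |x - x'| ≤ ρ := by
      rcases hr with ⟨h5, h6⟩ | ⟨-, h5⟩
      · rw [abs_le]; constructor <;> linarith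
      · rwa [abs_sub_comm]
    have := h x ⟨h1, h2⟩ x' ⟨h3, h4⟩ hd
    rw [Real.dist_eq] at this
    linarith [(abs_le.1 this).2]
  | succ k ih =>
    obtain ⟨h₁, h₂⟩ := ih (by omega)
    have hcmp := compat P L hL (k := k) (by omega)
    have hq := cash_nonneg P k
    set V : ℝ → ℝ → ℝ := fun y b => wealthValue P L p k (Real.exp y + b + cash P k)
    set Vn : ι → ℕ → ℕ → ℝ := fun n i j =>
      (G n).wealthValue P p k (Real.exp ((G n).y i) + (G n).b j + cash P k)
    obtain ⟨C, hC⟩ := exists_wealthValue_bound P L hp k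
      (Real.exp (L.ymaxD + 1) + L.bmax + cash P k)
    have hexp : Real.exp L.ymaxD ≤ Real.exp (L.ymaxD + 1) := Real.exp_le_exp.2 (by linarith)
    have hC' : ∀ x, 0 ≤ x → x ≤ Real.exp L.ymaxD + L.bmax + cash P k →
        |wealthValue P L p k x| ≤ C := fun x h3 h4 => hC x h3 (by linarith)
    obtain ⟨Cn, hCn⟩ := Grid.exists_wealthValue_bound P L hG hp k
      (Real.exp L.ymaxD + L.bmax + cash P k)
    obtain ⟨I₁, I₂⟩ := interiorClose P L hq hG hNg (V := V) (Vn := Vn) (fun y b => rfl)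
      (fun n i j => rfl) h₁ h₂ hC
    have S₂ : ∀ η > 0, ∀ᶠ _ in l, (frame P L _ hq).Step η (wealthValue P L p k)
        (domainNode L (advance P L (settle P L V))) (Set.Icc 0 1) (wealthValue P L p (k + 1)) :=
      fun η hη => .of_forall fun _ => step_exact P L hq hC' (le_of_lt hη) fun y b => rfl
    have S₁ : ∀ η > 0, ∀ᶠ n in l, (frame P L _ hq).Step η ((G n).wealthValue P p k)
        (gridNode (G n) ((G n).advanceH P ((G n).settleH P (Vn n)))) (gridControls (G n))
        ((G n).wealthValue P p (k + 1)) := by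
      intro η hη
      have hy := Real.exp_pos L.ymaxD
      filter_upwards [hG (min η (η / Real.exp L.ymaxD)) (by positivity)] with n hn
      refine (G n).step P hq hn (min_le_left _ _) ?_ _ fun i j => rfl
      have := min_le_right η (η / Real.exp L.ymaxD)
      rwa [le_div_iff₀ hy, mul_comm] at this
    have B₂ : ∀ Y b v, domainNode L (advance P L (settle P L V)) Y b v →
        |v| ≤ advanceBound P L * C := by
      rintro Y b v ⟨h3, h4, h5, h6, rfl⟩
      have hY : 0 < Y := (Real.exp_pos _).trans_le h3
      refine abs_advance_le P L (fun y b g1 g2 g3 g4 => hC' _ ?_ ?_)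
        ((Real.le_log_iff_exp_le hY).2 h3) ((Real.log_le_iff_le_exp hY).2 h4) h5 h6
      · positivity
      · have := Real.exp_le_exp.2 g2
        linarith
    have B₁ : ∀ᶠ n in l, ∀ Y b v,
        gridNode (G n) ((G n).advanceH P ((G n).settleH P (Vn n))) Y b v →
        |v| ≤ advanceBound P L * Cn := by
      filter_upwards [hCn] with n hCn
      rintro Y b v ⟨i, hi, j, hj, rfl, rfl, rfl⟩
      refine (G n).abs_advanceH_le P (fun i hi j hj => hCn _ ?_ ?_) hi hj
      · have := ((G n).b_part.mem_Icc hj).1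
        positivity
      · have := Real.exp_le_exp.2 ((G n).y_part.mem_Icc hi).2
        have := ((G n).b_part.mem_Icc hj).2
        linarith
    exact ⟨hcmp.close_step S₁ S₂ (.of_forall fun _ => hC')
        (.of_forall fun _ Y b v hv _ _ => B₂ Y b v hv) I₁ h₁,
      hcmp.close_step S₂ S₁ hCn (B₁.mono fun n h Y b v hv _ _ => h Y b v hv) I₂ h₂⟩

/-- Convergence of the discrete values at the initial wealth, for a fixed payoff. -/
theorem tendsto_wealthValue [l.NeBot] (hG : ∀ η > 0, ∀ᶠ n in l, (G n).MeshLE η)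
    (hNg : Tendsto (fun n => (G n).Ng) l atTop) (hp : Continuous p) {s₀ b₀ : ℝ} (hs₀ : 0 ≤ s₀)
    (hb₀ : 0 ≤ b₀) (hL : LargeEnough P L s₀ b₀) :
    Tendsto (fun n => (G n).wealthValue P p P.M (s₀ + b₀ + P.q 0)) l
      (𝓝 (wealthValue P L p P.M (s₀ + b₀ + P.q 0))) := by
  obtain ⟨h₁, h₂⟩ := close_wealthValue P L hG hNg hp hL (le_refl P.M)
  obtain ⟨h3, h4⟩ := initial_mem_window P L hL
  have hw : 0 ≤ s₀ + b₀ + P.q 0 := by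
    have := P.q_nonneg 0 P.M_pos
    linarith
  set w := s₀ + b₀ + P.q 0
  rw [Metric.tendsto_nhds]
  intro ε hε
  obtain ⟨e, he, e1, e2, e3⟩ : ∃ e > 0, e < ε ∧ e ≤ w - zoneLo P L P.M ∧ e ≤ zoneHi P L P.M - w :=
    ⟨min (ε / 2) (min (w - zoneLo P L P.M) (zoneHi P L P.M - w)),
      lt_min (by linarith) (lt_min (by linarith) (by linarith)),
      (min_le_left _ _).trans_lt (by linarith), (min_le_right _ _).trans (min_le_left _ _),
      (min_le_right _ _).trans (min_le_right _ _)⟩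
  obtain ⟨ρ₁, hρ₁, h₁⟩ := h₁ w e he
  obtain ⟨ρ₂, hρ₂, h₂⟩ := h₂ w e he
  filter_upwards [h₁ 1 one_pos, h₂ 1 one_pos] with n h₁ h₂
  have hz : Frame.zone (zoneθ P L P.M) (zoneLo P L P.M) (zoneHi P L P.M) e w :=
    -- The initial wealth is compared with itself through the zone alternative; the surplus
    -- parameter, set to `1`, plays no role.
    Or.inr ⟨by linarith, by linarith⟩
  have q1 := h₁ w w hw le_rfl hw le_rfl (Or.inr ⟨hz, by simpa using hρ₁.le⟩)
  have q2 := h₂ w w hw le_rfl hw le_rfl (Or.inr ⟨hz, by simpa using hρ₂.le⟩)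
  rw [Real.dist_eq, abs_lt]
  constructor <;> linarith

end
end MeanRisk

/-! ### Stability of the scheme in the payoff. -/

namespace MeanRisk

namespace Grid
variable {L : Domain} {Wmin Wmax : ℝ} (G : Grid L Wmin Wmax) (P : Market)

theorem advanceH_le {V V' : ℕ → ℕ → ℝ} {C : ℝ} (hC : 0 ≤ C)
    (hV : ∀ n ≤ G.Ny, ∀ j ≤ G.Nb, V n j ≤ V' n j + C) {n j : ℕ} (hn : n ≤ G.Ny) (hj : j ≤ G.Nb) :
    G.advanceH P (G.settleH P V) n j ≤
      G.advanceH P (G.settleH P V') n j + advanceBound P L * C := by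
  have hB := P.densityBound_nonneg
  have hlen : 0 ≤ L.ymaxD - L.yminD := by linarith [L.yminD_lt_ymaxD]
  have hb := G.b_part.mem_Icc hj
  obtain ⟨h1, h2⟩ := min_mul_mem P L hb.1
  set K := max 1 (Real.exp (P.r * P.dt)) * C with hK
  have hK0 : 0 ≤ K := by positivity
  have hS : ∀ n ≤ G.Ny, G.settleH P V n j ≤ G.settleH P V' n j + K := by
    intro n hn
    rw [G.settleH_eq P le_rfl, G.settleH_eq P le_rfl]
    have h3 := G.b_part.interp_mono (v := V n) (v' := V' n) (K := 1) (C := C) h1 h2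
      fun i hi => by linarith [hV n hn i hi]
    rw [one_mul] at h3
    have h4 := mul_le_mul_of_nonneg_left h3 ((frame P L 0 le_rfl).kap_nonneg (G.b j))
    have h5 := mul_le_mul_of_nonneg_right ((frame P L 0 le_rfl).kap_le hb.2) hC
    rw [mul_add] at h4
    exact h4.trans (add_le_add le_rfl h5)
  have e : advanceBound P L * C = K * max 1 (Real.exp (P.μ * P.dt)) +
      2 * (K * P.densityBound * (L.ymaxD - L.yminD)) := by
    rw [advanceBound, hK]; ring
  have h3 : 0 ≤ K * P.densityBound * (L.ymaxD - L.yminD) := by positivity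
  rw [e]
  unfold advanceH
  split_ifs
  · have := mul_le_mul_of_nonneg_left (le_max_left 1 (Real.exp (P.μ * P.dt))) hK0
    linarith [hS n hn]
  · have h4 : 0 ≤ K * max 1 (Real.exp (P.μ * P.dt)) := by positivity
    simp only [mul_assoc (G.weight _)]
    rw [G.sum_weight, G.sum_weight]
    have key : ∀ l ≤ G.Ny, P.densityTrunc G.Ng (G.y n - G.y l) * G.settleH P V l j ≤
        P.densityTrunc G.Ng (G.y n - G.y l) * G.settleH P V' l j + P.densityBound * K := by
      intro l hl
      have h5 := mul_le_mul_of_nonneg_left (hS l hl) (P.densityTrunc_nonneg G.Ng (G.y n - G.y l))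
      have h6 := mul_le_mul_of_nonneg_right (P.densityTrunc_le G.Ng (G.y n - G.y l)) hK0
      linarith
    have : ∑ i ∈ Finset.range G.Ny, G.dy *
        ((P.densityTrunc G.Ng (G.y n - G.y i) * G.settleH P V i j +
          P.densityTrunc G.Ng (G.y n - G.y (i + 1)) * G.settleH P V (i + 1) j) / 2) ≤
        ∑ i ∈ Finset.range G.Ny, (G.dy *
        ((P.densityTrunc G.Ng (G.y n - G.y i) * G.settleH P V' i j +
          P.densityTrunc G.Ng (G.y n - G.y (i + 1)) * G.settleH P V' (i + 1) j) / 2) +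
          G.dy * (P.densityBound * K)) := by
      refine Finset.sum_le_sum fun i hi => ?_
      have hi := Finset.mem_range.1 hi
      rw [← mul_add]
      refine mul_le_mul_of_nonneg_left ?_ G.dy_pos.le
      linarith [key i hi.le, key (i + 1) hi]
    rw [Finset.sum_add_distrib, Finset.sum_const, Finset.card_range, nsmul_eq_mul, ← mul_assoc,
      G.Ny_mul_dy] at this
    linarith
  · have h4 := mul_le_mul_of_nonneg_left (hS n hn) (Real.exp_pos (P.μ * P.dt)).le
    have h5 := mul_le_mul_of_nonneg_left (le_max_right 1 (Real.exp (P.μ * P.dt))) hK0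
    linarith

/-- A uniform change `C` of the node values survives interpolation unchanged and is multiplied only
by the continuation factor, so the constant does not depend on the grid. -/
theorem supRebalance_le {a a' : ℕ → ℕ → ℝ} {C Wb CA : ℝ} (hC : 0 ≤ C)
    (h : ∀ n ≤ G.Ny, ∀ j ≤ G.Nb, a n j ≤ a' n j + C)
    (hCA : ∀ s b, s ≤ Wb → b ≤ Wb → (frame P L 0 le_rfl).amp s b ≤ CA) {w : ℝ} (hw : 0 ≤ w)
    (hwW : w ≤ Wb) : G.supRebalance a w ≤ G.supRebalance a' w + CA * C := by
  refine ciSup_le fun i => ?_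
  obtain ⟨hu0, hu1⟩ := G.u_part.mem_Icc (Nat.lt_succ_iff.1 i.2)
  have h1 := le_ciSup (Set.finite_range (fun i : Fin (G.Nu + 1) =>
      L.atAmounts (G.interp₂ a') (G.u i * w) ((1 - G.u i) * w))).bddAbove i
  refine le_trans ?_ (add_le_add h1 le_rfl)
  obtain ⟨hy0, hy1⟩ := log_clampS_mem P L le_rfl (G.u i * w)
  rw [atAmounts_eq P L le_rfl, atAmounts_eq P L le_rfl]
  have h2 : 0 ≤ min ((1 - G.u i) * w) L.bmax :=
    le_min (mul_nonneg (by linarith) hw) L.bmax_pos.le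
  have h3 : G.interp₂ a (Real.log ((frame P L 0 le_rfl).clampS (G.u i * w)))
      (min ((1 - G.u i) * w) L.bmax) ≤
      1 * G.interp₂ a' (Real.log ((frame P L 0 le_rfl).clampS (G.u i * w)))
      (min ((1 - G.u i) * w) L.bmax) + C :=
    G.b_part.interp_mono h2 (min_le_right _ _) fun j hj =>
      G.y_part.interp_mono hy0 hy1 fun n hn => by linarith [h n hn j hj]
  rw [one_mul] at h3
  have h4 := mul_le_mul_of_nonneg_left h3
    ((frame P L 0 le_rfl).amp_nonneg (G.u i * w) ((1 - G.u i) * w))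
  have h5 : G.u i * w ≤ w := mul_le_of_le_one_left hw hu1
  have h6 : (1 - G.u i) * w ≤ w := mul_le_of_le_one_left hw (by linarith)
  have h7 := mul_le_mul_of_nonneg_right
    (hCA (G.u i * w) ((1 - G.u i) * w) (by linarith) (by linarith)) hC
  linarith

variable (L Wmin Wmax) in
/-- Stability of the scheme with respect to the payoff, uniformly in the grid. -/
theorem exists_stability (k : ℕ) (Wb : ℝ) : ∃ K Wp : ℝ, 0 ≤ K ∧ ∀ (G : Grid L Wmin Wmax)
    (p p' : ℝ → ℝ) (C : ℝ), 0 ≤ C → (∀ x, 0 ≤ x → x ≤ Wp → p x ≤ p' x + C) →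
    ∀ w, 0 ≤ w → w ≤ Wb → G.wealthValue P p k w ≤ G.wealthValue P p' k w + K * C := by
  induction k generalizing Wb with
  | zero => exact ⟨1, Wb, zero_le_one, fun G p p' C _ h w h1 h2 => by
      rw [one_mul]; exact h w h1 h2⟩
  | succ k ih =>
    obtain ⟨K, Wp, hK, ih⟩ := ih (Real.exp L.ymaxD + L.bmax + cash P k)
    obtain ⟨CA, hCA, hamp⟩ := (frame P L 0 le_rfl).exists_amp_bound Wb
    have hA := advanceBound_pos P L
    refine ⟨CA * (advanceBound P L * K), Wp, by positivity, fun G p p' C hC h w h1 h2 => ?_⟩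
    have h3 := G.supRebalance_le P (C := advanceBound P L * (K * C)) (by positivity)
      (fun n hn j hj => G.advanceH_le P (C := K * C) (by positivity)
        (V := fun n j => G.wealthValue P p k (Real.exp (G.y n) + G.b j + cash P k))
        (V' := fun n j => G.wealthValue P p' k (Real.exp (G.y n) + G.b j + cash P k))
        (fun n hn j hj => ih G p p' C hC h _ ?_ ?_) hn hj)
      (fun s b h3 h4 => (hamp s b s b h3 h4 h3 h4).1) h1 h2
    · have e : CA * (advanceBound P L * K) * C = CA * (advanceBound P L * (K * C)) := by ring
      rw [e]
      exact h3
    · have := cash_nonneg P k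
      have := (G.b_part.mem_Icc hj).1
      positivity
    · have := Real.exp_le_exp.2 (G.y_part.mem_Icc hn).2
      have := (G.b_part.mem_Icc hj).2
      linarith

end Grid

/-! ### Signed criteria and the dependence of the payoff on the threshold. -/

namespace Criterion

variable (c : Criterion)

/-- The sign that turns the criterion into a maximization. -/
def sgn : Criterion → ℝ
  | bPoE _ _ => -1
  | cvar _ _ => 1

theorem sgn_mul_sgn : c.sgn * c.sgn = 1 := by cases c <;> simp [sgn]

theorem sgn_mul_cancel (x : ℝ) : c.sgn * (c.sgn * x) = x := by
  rw [← mul_assoc, sgn_mul_sgn, one_mul]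

/-- The payoff, signed such that it is to be maximized. -/
noncomputable def gain (W w : ℝ) : ℝ := c.sgn * c.payoff W w

/-- The real `sInf` is minus the `sSup` of the negated set for every set, with the default value for
unbounded ones, so no boundedness is required. -/
theorem opt_eq {ι : Type} (f : ι → ℝ) : c.opt f = c.sgn * ⨆ i, c.sgn * f i := by
  cases c with
  | bPoE γ D =>
    simp only [opt, sgn, neg_mul, one_mul]
    rw [iInf, iSup, ← neg_neg (sInf _), ← Real.sSup_neg]
    congr 2
    ext x
    simp [neg_eq_iff_eq_neg]
  | cvar γ α => simp [opt, sgn]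

theorem atLeastAsGood_iff (x x' : ℝ) : c.AtLeastAsGood x x' ↔ c.sgn * x' ≤ c.sgn * x := by
  cases c <;> simp [AtLeastAsGood, sgn]

theorem opt_eq_of_best {ι : Type} (f : ι → ℝ) (i : ι)
    (h : ∀ j, c.AtLeastAsGood (f i) (f j)) : c.opt f = f i := by
  have : Nonempty ι := ⟨i⟩
  rw [opt_eq]
  have h1 : ⨆ i, c.sgn * f i = c.sgn * f i := by
    refine le_antisymm (ciSup_le fun j => (c.atLeastAsGood_iff _ _).1 (h j))
      (le_ciSup (f := fun i => c.sgn * f i) ⟨c.sgn * f i, ?_⟩ i)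
    rintro _ ⟨j, rfl⟩
    exact (c.atLeastAsGood_iff _ _).1 (h j)
  rw [h1, sgn_mul_cancel]

theorem continuous_gain (W : ℝ) : Continuous (c.gain W) := by
  cases c <;> unfold gain payoff <;> fun_prop

/-- The payoff depends continuously on a feasible threshold, uniformly in bounded wealths. -/
theorem eventually_gain_close (hc : c.Valid) {W₀ : ℝ} (hW₀ : c.Feasible W₀) (Wp : ℝ) {ε : ℝ}
    (hε : 0 < ε) : ∀ᶠ W in 𝓝 W₀, ∀ x, 0 ≤ x → x ≤ Wp → |c.gain W x - c.gain W₀ x| ≤ ε := by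
  cases c with
  | bPoE γ D =>
    obtain ⟨hγ, hD⟩ := hc
    have hW₀ : D < W₀ := hW₀
    have hne : W₀ - D ≠ 0 := by linarith
    -- The payoff depends on `W` only through `(W - D)⁻¹`, which is continuous at a feasible
    -- threshold.
    have hcont : Tendsto (fun W => γ * (|Wp| + D) * |(W - D)⁻¹ - (W₀ - D)⁻¹|) (𝓝 W₀) (𝓝 0) := by
      have : ContinuousAt (fun W => γ * (|Wp| + D) * |(W - D)⁻¹ - (W₀ - D)⁻¹|) W₀ := by
        have : ContinuousAt (fun W : ℝ => (W - D)⁻¹) W₀ :=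
          ContinuousAt.inv₀ (by fun_prop) hne
        fun_prop
      simpa [ContinuousAt] using this
    filter_upwards [hcont.eventually_le_const hε] with W hW x hx hxW
    refine le_trans ?_ hW
    have h1 : |x - D| ≤ |Wp| + D := by
      have := le_abs_self Wp
      rw [abs_le]; constructor <;> linarith [abs_nonneg Wp]
    have h2 : |max (1 - (x - D) / (W - D)) 0 - max (1 - (x - D) / (W₀ - D)) 0| ≤
        |x - D| * |(W - D)⁻¹ - (W₀ - D)⁻¹| := by
      refine (abs_max_sub_max_le_abs _ _ _).trans (le_of_eq ?_)
      rw [← abs_mul, ← abs_neg]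
      congr 1
      ring
    have e : (bPoE γ D).gain W x - (bPoE γ D).gain W₀ x =
        -(γ * (max (1 - (x - D) / (W - D)) 0 - max (1 - (x - D) / (W₀ - D)) 0)) := by
      simp only [gain, sgn, payoff]; ring
    rw [e, abs_neg, abs_mul, abs_of_pos hγ, mul_assoc]
    exact mul_le_mul_of_nonneg_left
      (h2.trans (mul_le_mul_of_nonneg_right h1 (abs_nonneg _))) hγ.le
  | cvar γ α =>
    obtain ⟨hγ, hα, -⟩ := hc
    have hcont : Tendsto (fun W => γ * (1 + 1 / α) * |W - W₀|) (𝓝 W₀) (𝓝 0) := by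
      have : ContinuousAt (fun W => γ * (1 + 1 / α) * |W - W₀|) W₀ := by fun_prop
      simpa [ContinuousAt] using this
    filter_upwards [hcont.eventually_le_const hε] with W hW x hx hxW
    refine le_trans ?_ hW
    have h2 : |min (x - W) 0 - min (x - W₀) 0| ≤ |W - W₀| := by
      refine (abs_min_sub_min_le_max _ _ _ _).trans (max_le (le_of_eq ?_) (by simp))
      rw [← abs_neg]; congr 1; ring
    have e : (cvar γ α).gain W x - (cvar γ α).gain W₀ x =
        γ * ((W - W₀) + 1 / α * (min (x - W) 0 - min (x - W₀) 0)) := by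
      simp only [gain, sgn, payoff]; ring
    have h3 : (0 : ℝ) ≤ 1 / α := by positivity
    rw [e, abs_mul, abs_of_pos hγ, mul_assoc]
    refine mul_le_mul_of_nonneg_left ((abs_add_le _ _).trans ?_) hγ.le
    rw [abs_mul, abs_of_nonneg h3]
    have := mul_le_mul_of_nonneg_left h2 h3
    linarith

/-- For bPoE, lowering the threshold improves the payoff at most by the weight. -/
theorem bPoE_gain_le {γ D W W₀ : ℝ} (hγ : 0 < γ) (hW : D < W) (hWW : W ≤ W₀) (x : ℝ) :
    (bPoE γ D).gain W x ≤ (bPoE γ D).gain W₀ x + γ := by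
  have h : max (1 - (x - D) / (W₀ - D)) 0 ≤ max (1 - (x - D) / (W - D)) 0 + 1 := by
    have h0 : 0 ≤ max (1 - (x - D) / (W - D)) 0 := le_max_right _ _
    refine max_le ?_ (by linarith)
    -- Above `D` the shortfall term is at most one; below `D` it only grows as the threshold
    -- decreases.
    rcases le_total D x with hx | hx
    · have : 0 ≤ (x - D) / (W₀ - D) := div_nonneg (by linarith) (by linarith)
      linarith
    · have h1 : (D - x) / (W₀ - D) ≤ (D - x) / (W - D) :=
        div_le_div_of_nonneg_left (by linarith) (by linarith) (by linarith)
      have h2 := le_max_left (1 - (x - D) / (W - D)) 0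
      have h3 : ∀ y, (x - D) / y = -((D - x) / y) := fun y => by ring
      rw [h3] at h2 ⊢
      rw [h3 (W - D)]
      linarith
  have := mul_le_mul_of_nonneg_left h hγ.le
  simp only [gain, sgn, payoff]
  linarith

end Criterion

/-! ### Reduction of both problems to a maximization over functions of the wealth. -/

section
variable (P : Market) (L : Domain) (c : Criterion)

/-- Interest and time advancement are linear, so the sign of the criterion passes through them. The
optimization absorbs it in `rebalance_sgn`. -/
theorem advance_settle_mul (a : ℝ) (V : ℝ → ℝ → ℝ) :
    advance P L (settle P L fun y b => a * V y b) =
      fun y b => a * advance P L (settle P L V) y b := by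
  have h : settle P L (fun y b => a * V y b) = fun y b => a * settle P L V y b := by
    funext y b
    rw [settle_eq P L le_rfl, settle_eq P L le_rfl]; ring
  rw [h]
  funext y b
  unfold advance
  split_ifs
  · rfl
  · rw [← intervalIntegral.integral_const_mul]
    simp only [mul_assoc]
  · ring

theorem rebalance_sgn (a : ℝ → ℝ → ℝ) (w : ℝ) :
    rebalance L c (fun y b => c.sgn * a y b) w = c.sgn * supRebalance L a w := by
  have h : ∀ s b, c.sgn * L.atAmounts (fun y b => c.sgn * a y b) s b = L.atAmounts a s b := by
    intro s b
    unfold Domain.atAmounts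
    simp only [L.extB_eq, L.extS_eq]
    linear_combination (max 1 (b / L.bmax) * (max 1 (s / Real.exp L.ymaxD) *
      a (Real.log (max (Real.exp L.yminD) (min s (Real.exp L.ymaxD)))) (min b L.bmax))) *
        c.sgn_mul_sgn
  unfold rebalance supRebalance
  rw [c.opt_eq]
  simp only [h]

theorem value_eq (W : ℝ) (k : ℕ) : value P L c W k =
    fun y b => c.sgn * wealthValue P L (c.gain W) k (Real.exp y + b + cash P k) := by
  induction k with
  | zero =>
    funext y b
    simp [value, wealthValue, cash, Criterion.gain, c.sgn_mul_cancel]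
  | succ k ih =>
    funext y b
    rw [value, ih, advance_settle_mul]
    dsimp only
    rw [rebalance_sgn]
    simp [wealthValue, cash]

theorem objective_eq (s₀ b₀ W : ℝ) : objective P L c s₀ b₀ W =
    c.sgn * wealthValue P L (c.gain W) P.M (s₀ + b₀ + P.q 0) := by
  obtain ⟨k, hk⟩ : ∃ k, P.M = k + 1 := ⟨P.M - 1, by have := P.M_pos; omega⟩
  rw [objective, value_eq, advance_settle_mul, rebalance_sgn, hk, Nat.add_sub_cancel]
  rfl

namespace Grid
variable {L} {Wmin Wmax : ℝ} (G : Grid L Wmin Wmax)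

theorem interp_const_mul (N : ℕ) (x v : ℕ → ℝ) (a t : ℝ) :
    interp N x (fun i => a * v i) t = a * interp N x v t := by
  unfold interp
  rw [mul_add, Finset.mul_sum]
  congr 1
  exact Finset.sum_congr rfl fun i _ => by ring

theorem advanceH_settleH_mul (a : ℝ) (V : ℕ → ℕ → ℝ) :
    G.advanceH P (G.settleH P fun n j => a * V n j) =
      fun n j => a * G.advanceH P (G.settleH P V) n j := by
  have h : G.settleH P (fun n j => a * V n j) = fun n j => a * G.settleH P V n j := by
    funext n j
    rw [G.settleH_eq P le_rfl, G.settleH_eq P le_rfl, interp_const_mul]; ring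
  rw [h]
  funext n j
  unfold advanceH
  split_ifs
  · rfl
  · rw [Finset.mul_sum]
    exact Finset.sum_congr rfl fun i _ => by ring
  · ring

theorem rebalanceH_sgn (a : ℕ → ℕ → ℝ) (w : ℝ) :
    G.rebalanceH c (fun n j => c.sgn * a n j) w = c.sgn * G.supRebalance a w := by
  have h0 : G.interp₂ (fun n j => c.sgn * a n j) = fun y b => c.sgn * G.interp₂ a y b := by
    funext y b
    unfold interp₂
    simp only [interp_const_mul]
  have h : ∀ s b, c.sgn * L.atAmounts (G.interp₂ fun n j => c.sgn * a n j) s b =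
      L.atAmounts (G.interp₂ a) s b := by
    intro s b
    rw [h0]
    unfold Domain.atAmounts
    simp only [L.extB_eq, L.extS_eq]
    linear_combination (max 1 (b / L.bmax) * (max 1 (s / Real.exp L.ymaxD) *
      G.interp₂ a (Real.log (max (Real.exp L.yminD) (min s (Real.exp L.ymaxD))))
        (min b L.bmax))) * c.sgn_mul_sgn
  unfold rebalanceH supRebalance
  rw [c.opt_eq]
  simp only [h]

theorem valueH_eq (W : ℝ) (k : ℕ) : G.valueH P c W k =
    fun n j => c.sgn * G.wealthValue P (c.gain W) k (Real.exp (G.y n) + G.b j + cash P k) := by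
  induction k with
  | zero =>
    funext n j
    simp [valueH, wealthValue, cash, Criterion.gain, c.sgn_mul_cancel]
  | succ k ih =>
    funext n j
    rw [valueH, ih, advanceH_settleH_mul]
    dsimp only
    rw [rebalanceH_sgn]
    simp [wealthValue, cash]

theorem objectiveH_eq (s₀ b₀ W : ℝ) : G.objectiveH P c s₀ b₀ W =
    c.sgn * G.wealthValue P (c.gain W) P.M (s₀ + b₀ + P.q 0) := by
  obtain ⟨k, hk⟩ : ∃ k, P.M = k + 1 := ⟨P.M - 1, by have := P.M_pos; omega⟩
  rw [objectiveH, valueH_eq, advanceH_settleH_mul, rebalanceH_sgn, hk, Nat.add_sub_cancel]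
  rfl

end Grid
end
end MeanRisk

/-! ### Computed thresholds: existence, compactness and limits. -/

namespace MeanRisk

section
variable (P : Market) {L : Domain} (c : Criterion) {Wmin Wmax : ℝ}

namespace Grid
variable (G : Grid L Wmin Wmax)

theorem finite_nodes : (G.Nodes c).Finite := by
  refine (Set.finite_range fun k : Fin (G.Nw + 1) => G.W k).subset ?_
  rintro _ ⟨k, hk, rfl, -⟩
  exact ⟨⟨k, Nat.lt_succ_iff.2 hk⟩, rfl⟩

theorem nodes_subset : G.Nodes c ⊆ Set.Icc Wmin Wmax := by
  rintro _ ⟨k, hk, rfl, -⟩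
  exact G.W_part.mem_Icc hk

variable {c} in
theorem feasible_mono {W W' : ℝ} (h : c.Feasible W) (hW : W ≤ W') : c.Feasible W' := by
  cases c
  · exact lt_of_lt_of_le h hW
  · exact le_trans h hW

/-- The node above a feasible threshold. -/
theorem exists_node {W : ℝ} (hW : W ∈ Set.Icc Wmin Wmax) (hf : c.Feasible W) :
    ∃ V ∈ G.Nodes c, W ≤ V ∧ ∃ k < G.Nw, V ≤ W + (G.W (k + 1) - G.W k) := by
  obtain ⟨k, hk, h1, h2⟩ := G.W_part.exists_cell hW.1 hW.2
  -- The right end of the cell is taken, since feasibility passes to larger thresholds.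
  exact ⟨G.W (k + 1), ⟨k + 1, hk, rfl, feasible_mono hf h2⟩, h2, k, hk, by linarith⟩

theorem exists_computedThreshold (s₀ b₀ : ℝ) (h : (G.Nodes c).Nonempty) :
    ∃ W, G.IsComputedThreshold P c s₀ b₀ W := by
  obtain ⟨W, hW, hmax⟩ := Set.exists_max_image _ (fun W => c.sgn * G.objectiveH P c s₀ b₀ W)
    (G.finite_nodes c) h
  exact ⟨W, hW, fun W' hW' => (c.atLeastAsGood_iff _ _).2 (hmax W' hW')⟩

theorem valueFunctionH_eq {s₀ b₀ W : ℝ} (h : G.IsComputedThreshold P c s₀ b₀ W) :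
    G.valueFunctionH P c s₀ b₀ = G.objectiveH P c s₀ b₀ W :=
  c.opt_eq_of_best (fun W : G.Nodes c => G.objectiveH P c s₀ b₀ W) ⟨W, h.1⟩
    fun W' => h.2 W' W'.2

end Grid

theorem valueFunction_eq {s₀ b₀ W : ℝ} (h : IsOptimalThreshold P L c s₀ b₀ W) :
    valueFunction P L c s₀ b₀ = objective P L c s₀ b₀ W :=
  c.opt_eq_of_best (fun W : {W : ℝ // c.Feasible W} => objective P L c s₀ b₀ W) ⟨W, h.1⟩
    fun W' => h.2 W' W'.2

variable {c} {s₀ b₀ : ℝ} {G : ℕ → Grid L Wmin Wmax}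

/-- The signed discrete objective converges along converging thresholds. -/
theorem tendsto_objectiveH (hc : c.Valid) (hs₀ : 0 ≤ s₀) (hb₀ : 0 ≤ b₀)
    (hL : LargeEnough P L s₀ b₀) (hG : ∀ η > 0, ∀ᶠ n in atTop, (G n).MeshLE η)
    (hNg : Tendsto (fun n => (G n).Ng) atTop atTop) {W : ℕ → ℝ} {W₀ : ℝ}
    (hW : Tendsto W atTop (𝓝 W₀)) (hW₀ : c.Feasible W₀) :
    Tendsto (fun n => c.sgn * (G n).objectiveH P c s₀ b₀ (W n)) atTop
      (𝓝 (c.sgn * objective P L c s₀ b₀ W₀)) := by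
  have hw : 0 ≤ s₀ + b₀ + P.q 0 := by
    have := P.q_nonneg 0 P.M_pos
    linarith
  simp only [Grid.objectiveH_eq, objective_eq, c.sgn_mul_cancel]
  have h := tendsto_wealthValue P L hG hNg (c.continuous_gain W₀) hs₀ hb₀ hL
  obtain ⟨K, Wp, hK, hst⟩ := Grid.exists_stability L Wmin Wmax P P.M (s₀ + b₀ + P.q 0)
  set w := s₀ + b₀ + P.q 0
  rw [Metric.tendsto_nhds] at h ⊢
  intro ε hε
  have hε' : 0 < ε / (2 * (K + 1)) := by positivity
  have hKε : K * (ε / (2 * (K + 1))) ≤ ε / 2 := by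
    rw [mul_div_assoc', div_le_div_iff₀ (by positivity) (by positivity)]
    nlinarith
  filter_upwards [h (ε / 2) (by positivity),
    hW.eventually (c.eventually_gain_close hc hW₀ Wp hε')] with n h1 h2
  rw [Real.dist_eq, abs_lt] at h1 ⊢
  have q1 := hst (G n) (c.gain (W n)) (c.gain W₀) _ hε'.le
    (fun x hx hx' => by linarith [(abs_le.1 (h2 x hx hx')).2]) w hw le_rfl
  have q2 := hst (G n) (c.gain W₀) (c.gain (W n)) _ hε'.le
    (fun x hx hx' => by linarith [(abs_le.1 (h2 x hx hx')).1]) w hw le_rfl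
  constructor <;> linarith

/-- Compactness: computed thresholds subconverge to an optimal threshold, together with the
objective values. -/
theorem exists_subseq_computedThreshold (hc : c.Valid) (hs₀ : 0 ≤ s₀) (hb₀ : 0 ≤ b₀)
    (hL : LargeEnough P L s₀ b₀) (hWmin : c.LeftEnd Wmin (objective P L c s₀ b₀))
    (hopt : ∃ W ∈ Set.Icc Wmin Wmax, IsOptimalThreshold P L c s₀ b₀ W)
    (hG : ∀ η > 0, ∀ᶠ n in atTop, (G n).MeshLE η)
    (hNg : Tendsto (fun n => (G n).Ng) atTop atTop)
    (hGW : ∀ η > 0, ∀ᶠ n in atTop, ∀ k < (G n).Nw, (G n).W (k + 1) - (G n).W k < η)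
    {W : ℕ → ℝ} (hW : ∀ n, (G n).IsComputedThreshold P c s₀ b₀ (W n)) :
    ∃ Wstar, IsOptimalThreshold P L c s₀ b₀ Wstar ∧ Wstar ∈ Set.Icc Wmin Wmax ∧
      ∃ φ : ℕ → ℕ, StrictMono φ ∧ Tendsto (fun n => W (φ n)) atTop (𝓝 Wstar) ∧
        Tendsto (fun n => (G (φ n)).objectiveH P c s₀ b₀ (W (φ n))) atTop
          (𝓝 (objective P L c s₀ b₀ Wstar)) := by
  obtain ⟨Wo, hWo, hWof, hWobest⟩ := hopt
  obtain ⟨W₁, hW₁, φ, hφ, hlim⟩ := (isCompact_Icc (a := Wmin) (b := Wmax)).tendsto_subseq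
    fun n => (G n).nodes_subset c (hW n).1
  have hφt := hφ.tendsto_atTop
  have hGφ : ∀ η > 0, ∀ᶠ n in atTop, (G (φ n)).MeshLE η := fun η hη => hφt.eventually (hG η hη)
  have hNgφ : Tendsto (fun n => (G (φ n)).Ng) atTop atTop := hNg.comp hφt
  -- the nodes above the exact optimal threshold
  choose V hV hV1 hV2 using fun n => (G n).exists_node c hWo hWof
  have hVlim : Tendsto V atTop (𝓝 Wo) := by
    rw [Metric.tendsto_nhds]
    intro ε hε
    filter_upwards [hGW ε hε] with n hn
    obtain ⟨k, hk, h⟩ := hV2 n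
    have := hn k hk
    rw [Real.dist_eq, abs_lt]
    constructor <;> linarith [hV1 n]
  have hVobj := tendsto_objectiveH P hc hs₀ hb₀ hL hGφ hNgφ (hVlim.comp hφt) hWof
  have hle : ∀ n, c.sgn * (G (φ n)).objectiveH P c s₀ b₀ (V (φ n)) ≤
      c.sgn * (G (φ n)).objectiveH P c s₀ b₀ (W (φ n)) := fun n =>
    (c.atLeastAsGood_iff _ _).1 ((hW (φ n)).2 _ (hV (φ n)))
  have hfeas : c.Feasible W₁ := by
    cases c with
    | cvar γ α => exact le_trans hWmin hW₁.1
    | bPoE γ D =>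
      rcases hWmin with h | ⟨rfl, hblow⟩
      · exact lt_of_lt_of_le h hW₁.1
      · refine lt_of_le_of_ne hW₁.1 fun heq => ?_
        -- the limit cannot be the infeasible threshold, where the objective blows up
        obtain ⟨K, Wp, hK, hst⟩ := Grid.exists_stability L Wmin Wmax P P.M (s₀ + b₀ + P.q 0)
        have hw : 0 ≤ s₀ + b₀ + P.q 0 := by
          have := P.q_nonneg 0 P.M_pos
          linarith
        have hγ : 0 < γ := hc.1
        -- If the computed thresholds tended to `D`, they would eventually be below any fixed `W₀ >
        -- D`. Replacing them by `W₀` loses at most `γ` in the payoff, hence at most `K * γ` in the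
        -- objective, with `K` independent of `W₀`. In the limit this bounds the exact objective
        -- near `D`.
        have key : ∀ W₀, Wmin < W₀ → (Criterion.bPoE γ Wmin).sgn *
            objective P L (Criterion.bPoE γ Wmin) s₀ b₀ Wo ≤ (Criterion.bPoE γ Wmin).sgn *
            objective P L (Criterion.bPoE γ Wmin) s₀ b₀ W₀ + K * γ := by
          intro W₀ hW₀
          have h1 := tendsto_objectiveH P hc hs₀ hb₀ hL hGφ hNgφ
            (tendsto_const_nhds (x := W₀)) (c := Criterion.bPoE γ Wmin) hW₀
          refine le_of_tendsto_of_tendsto hVobj (h1.add_const (K * γ)) ?_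
          have h2 : ∀ᶠ n in atTop, W (φ n) < W₀ := by
            refine hlim.eventually (eventually_lt_nhds ?_)
            rwa [← heq]
          filter_upwards [h2] with n hn
          refine (hle n).trans ?_
          obtain ⟨_, _, _, hfW⟩ := (hW (φ n)).1
          have h3 := hst (G (φ n)) _ _ γ hγ.le (fun x _ _ =>
            Criterion.bPoE_gain_le hγ hfW hn.le x) _ hw le_rfl
          rw [Grid.objectiveH_eq, Grid.objectiveH_eq, Criterion.sgn_mul_cancel,
            Criterion.sgn_mul_cancel]
          exact h3
        obtain ⟨W₀, h1, h2⟩ := ((hblow.eventually_gt_atTop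
          (objective P L (Criterion.bPoE γ Wmin) s₀ b₀ Wo + K * γ)).and
            self_mem_nhdsWithin).exists
        have h3 := key W₀ h2
        simp only [Criterion.sgn] at h3
        linarith
  have hWobj := tendsto_objectiveH P hc hs₀ hb₀ hL hGφ hNgφ hlim hfeas
  -- Computed thresholds do at least as well as the nodes above `Wo`; in the limit, `W₁` does at
  -- least as well as `Wo`.
  have hfin := le_of_tendsto_of_tendsto' hVobj hWobj hle
  refine ⟨W₁, ⟨hfeas, fun W' hW' => ?_⟩, hW₁, φ, hφ, hlim, ?_⟩
  · have := (c.atLeastAsGood_iff _ _).1 (hWobest W' hW')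
    exact (c.atLeastAsGood_iff _ _).2 (this.trans hfin)
  · simpa only [c.sgn_mul_cancel, Function.comp_apply] using hWobj.const_mul c.sgn

theorem Refines.eventually_meshLE {G : ℝ → Grid L Wmin Wmax} (hG : Refines G) {η : ℝ}
    (hη : 0 < η) : ∀ᶠ h in 𝓝[>] (0 : ℝ), (G h).MeshLE η := by
  have hy : Tendsto (fun h => (G h).dy) (𝓝[>] 0) (𝓝 0) :=
    (tendsto_natCast_atTop_atTop.comp hG.y).const_div_atTop _
  filter_upwards [hy.eventually_le_const hη, hG.b η hη, hG.u η hη] with h h1 h2 h3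
  exact ⟨h1, fun i hi => (h2 i hi).le, fun i hi => (h3 i hi).le⟩

end

end MeanRisk

theorem theorem7p1 (P : MeanRisk.Market) (L : MeanRisk.Domain) (c : MeanRisk.Criterion)
    (hc : c.Valid) (s₀ b₀ : ℝ) (hs₀ : 0 ≤ s₀) (hb₀ : 0 ≤ b₀)
    (hL : MeanRisk.LargeEnough P L s₀ b₀)
    (Wmin Wmax : ℝ) (hWmin : c.LeftEnd Wmin (MeanRisk.objective P L c s₀ b₀))
    (hopt : ∃ W ∈ Set.Icc Wmin Wmax, MeanRisk.IsOptimalThreshold P L c s₀ b₀ W)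
    (G : ℝ → MeanRisk.Grid L Wmin Wmax) (hG : MeanRisk.Refines G) :
    Tendsto (fun h => |(G h).valueFunctionH P c s₀ b₀ - MeanRisk.valueFunction P L c s₀ b₀|)
        (𝓝[>] 0) (𝓝 0) ∧
      ∀ (h W : ℕ → ℝ), (∀ n, 0 < h n) → Tendsto h atTop (𝓝 0) →
        (∀ n, (G (h n)).IsComputedThreshold P c s₀ b₀ (W n)) →
        ∃ Wstar, MeanRisk.IsOptimalThreshold P L c s₀ b₀ Wstar ∧ Wstar ∈ Set.Icc Wmin Wmax ∧
          ∃ φ : ℕ → ℕ, StrictMono φ ∧ Tendsto (fun n => W (φ n)) atTop (𝓝 Wstar) := by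
  have core : ∀ h : ℕ → ℝ, Tendsto h atTop (𝓝[>] 0) → ∀ W : ℕ → ℝ,
      (∀ n, (G (h n)).IsComputedThreshold P c s₀ b₀ (W n)) → _ := fun h hh W hW =>
    MeanRisk.exists_subseq_computedThreshold P (G := fun n => G (h n)) hc hs₀ hb₀ hL hWmin hopt
      (fun η hη => hh.eventually (hG.eventually_meshLE hη)) (hG.g.comp hh)
      (fun η hη => hh.eventually (hG.W η hη)) hW
  constructor
  -- Every sequence of meshes has a subsequence along which the computed optimum tends to the
  -- objective at an optimal threshold. That number is the exact value, whichever optimal threshold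
  -- arises.
  · refine tendsto_of_subseq_tendsto fun h hh => ?_
    obtain ⟨W₀, hW₀, hf⟩ := hopt
    choose W hW using fun n => (G (h n)).exists_computedThreshold P c s₀ b₀
      (((G (h n)).exists_node c hW₀ hf.1).imp fun _ hV => hV.1)
    obtain ⟨Wstar, hopt', -, φ, -, -, hlim⟩ := core h hh W hW
    refine ⟨φ, ?_⟩
    have := (hlim.sub_const (MeanRisk.objective P L c s₀ b₀ Wstar)).abs
    rw [sub_self, abs_zero] at this
    rw [MeanRisk.valueFunction_eq P c hopt']
    simp only [fun n => (G (h n)).valueFunctionH_eq P c (hW n)]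
    exact this
  · intro h W hpos hh hW
    obtain ⟨Wstar, h1, h2, φ, h3, h4, -⟩ := core h
      (tendsto_nhdsWithin_iff.2 ⟨hh, .of_forall hpos⟩) W hW
    exact ⟨Wstar, h1, h2, φ, h3, h4⟩
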